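/- Let $s_{AB}$ be the standard metric of the unit sphere $S_2$. On $(u_0,u_1)\times(r_0,\infty)\times S_2$ consider a smooth metric of signature $(+,-,-,-)$ $$g=du\,(g_{00}\,du+2\,dr+2\omega_A\,dx^A)+g_{AB}\,dx^A dx^B ,$$ with $g_{AB}$ symmetric and negative definite, which is asymptotically flat: $$g_{00}=1+\tfrac12 n_{,u}-2Mr^{-1}+O(r^{-2}),\quad g_{AB}=-s_{AB}r^2+n_{AB}r+m_{AB}+O(r^{-1}),\quad \omega_A=\psi_A+\kappa_A r^{-1}+O(r^{-2}),$$ where $M,n_{AB},m_{AB},\psi_A,\kappa_A$ are smooth and independent of $r$, $n=-s^{AB}n_{AB}$, and, for each $u$, the $O$-terms are uniform over the sphere and may be differentiated once in $u$ or once in $r$ (the latter gaining a factor $r^{-1}$). Put $\sigma=\sqrt{\det g_{AB}}$, $\sigma_s=\sqrt{\det s_{AB}}$, $\omega^A=g^{AB}\omega_B$, $g^{11}=\omega^A\omega_A-g_{00}$; let $R^{(2)}$ and ${}_{|A}$ be the Ricci scalar and the covariant derivative of $g_{AB}$, and $$\theta_-=g^{11}(\ln\sigma)_{,r}+2(\ln\sigma)_{,u}-2\omega^A{}_{|A},\qquad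 \langle n\rangle=\frac1{4\pi}\int_{S_2}n\,\sigma_s\,d^2x,$$ $$E(u)=\frac1{4\pi}\int_{S_2}M_B\,\sigma_s\,d^2x,\qquad M_B=\frac1{4\sigma_s}\lim_{r\to\infty}\bigl(\sigma_{,r}+g^{11}\sigma_{,r}+2\sigma_{,u}\bigr).$$ Let $S(u,r)$ be the surface of constant $u$ and $r$, and $A=\int_{S(u,r)}\sigma\,d^2x$ its area. Fix $u\in(u_0,u_1)$, and let $T_{\mu\nu}$ be a covariant tensor field (the energy–momentum tensor) which, at all points of the null surface $u=\mathrm{const}$, satisfies the dominant energy condition ($T_{\mu\nu}v^\mu w^\nu\ge0$ for all future directed timelike $v,w$, where $\partial_r$ is future directed) and the equations, with $T_{11}=T(\partial_r,\partial_r)$ and $T=T^\mu{}_\mu$, $$(\ln\sigma)_{,rr}-\tfrac14 g_{AB,r}\,g^{AB}{}_{,r}=-T_{11},$$ $$\sigma^{-1}(\sigma\theta_-)_{,r}-R^{(2)}+(\omega^A{}_{,r})_{|A}+\tfrac12 g_{AB}\,\omega^A{}_{,r}\,\omega^B{}_{,r}=T-g^{AB}T_{AB}.$$ Nothing is assumed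 about a vertex of the null surface. Then the limit $M_B$ exists at every point of $S_2$, the integrals that occur here are finite, and the following hold. 1. For every $r>r_0$, $$E(u)\ \ge\ \tfrac12 r+\tfrac18\langle n\rangle+\frac1{16\pi}\int_{S(u,r)}\sigma\,\theta_-\,d^2x .$$ 2. $r+\tfrac14 n>0$ at all points of the null surface $u=\mathrm{const}$ with $r>r_0$. 3. For every $r>r_0$ such that $\hat r=r+\tfrac14 n$ is constant on $S(u,r)$ (in particular if $r$ is itself the special affine coordinate, $\hat r=r$), $$E(u)\ \ge\ \sqrt{\frac{A}{16\pi}}+\frac1{16\pi}\int_{S(u,r)}\sigma\,\theta_-\,d^2x .$$ -/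

import Mathlib

open scoped ContDiff RealInnerProductSpace

noncomputable section

namespace BondiSachs

/-! ### The sphere and its two stereographic charts -/

/-- The plane of the angular coordinates `(x², x³)`. -/
abbrev E2 := EuclideanSpace ℝ (Fin 2)

/-- The Euclidean space in which the unit sphere sits. -/
abbrev E3 := EuclideanSpace ℝ (Fin 3)

/-- The unit sphere `S₂`. -/
abbrev S2 := Metric.sphere (0 : E3) 1

/-- The two stereographic charts, named after the pole from which one projects; together they
cover the sphere, and each of them misses just that pole. -/
inductive Pole where
  | north
  | south

/-- The third Cartesian coordinate of a pole. -/
def Pole.height : Pole → ℝ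
  | Pole.north => 1
  | Pole.south => -1

/-- The stereographic parametrization of the sphere minus one pole, as a map into space. -/
def stereo (b : Pole) (x : E2) : E3 :=
  (1 + x 0 ^ 2 + x 1 ^ 2)⁻¹ •
    !₂[2 * x 0, 2 * x 1, b.height * (x 0 ^ 2 + x 1 ^ 2 - 1)]

theorem stereo_mem (b : Pole) (x : E2) : stereo b x ∈ S2 := by
  have hb : b.height ^ 2 = 1 := by cases b <;> simp [Pole.height]
  have hpos : 0 < 1 + x 0 ^ 2 + x 1 ^ 2 := by positivity
  have h : ‖stereo b x‖ ^ 2 = 1 := by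
    rw [EuclideanSpace.norm_sq_eq]
    simp only [stereo, Fin.sum_univ_three, PiLp.smul_apply, smul_eq_mul, Real.norm_eq_abs, sq_abs]
    simp only [Matrix.cons_val_zero, Matrix.cons_val_one, Matrix.cons_val, mul_pow, hb]
    field_simp
    ring
  rw [mem_sphere_zero_iff_norm]
  exact (sq_eq_sq₀ (norm_nonneg _) zero_le_one).1 (by rw [h]; norm_num)

/-- The stereographic parametrization. -/
def chart (b : Pole) (x : E2) : S2 := ⟨stereo b x, stereo_mem b x⟩

/-- The coordinate vector field `∂_A` at the point with coordinates `x`, a vector tangent to the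
sphere. -/
def frame (b : Pole) (A : Fin 2) (x : E2) : E3 :=
  fderiv ℝ (stereo b) x (EuclideanSpace.single A 1)

/-- `X` is tangent to the sphere at `p`. -/
def IsTangent (p : S2) (X : E3) : Prop := ⟪(p : E3), X⟫ = 0

/-- Unit vectors tangent to the sphere. -/
abbrev UnitTangent := {v : S2 × E3 // IsTangent v.1 v.2 ∧ ‖v.2‖ = 1}

/-- Pairs of unit vectors tangent to the sphere at the same point. -/
abbrev UnitTangentPair :=
  {v : S2 × E3 × E3 // (IsTangent v.1 v.2.1 ∧ ‖v.2.1‖ = 1) ∧ IsTangent v.1 v.2.2 ∧ ‖v.2.2‖ = 1}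

/-- A covector at a point of the sphere; only its values on tangent vectors matter. -/
abbrev Covec := E3 →L[ℝ] ℝ

/-- A covariant tensor of rank two at a point of the sphere; only its values on tangent vectors
matter. -/
abbrev Bilin := E3 →L[ℝ] E3 →L[ℝ] ℝ

/-- The components `ω_A` of a field of covectors in a chart. -/
def covecComp (b : Pole) (w : S2 → Covec) (x : E2) (A : Fin 2) : ℝ :=
  w (chart b x) (frame b A x)

/-- The components `g_AB` of a field of covariant tensors in a chart. -/
def bilinComp (b : Pole) (h : S2 → Bilin) (x : E2) : Matrix (Fin 2) (Fin 2) ℝ :=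
  Matrix.of fun A B => h (chart b x) (frame b A x) (frame b B x)

/-- The components `s_AB` of the standard metric of the sphere. -/
def roundComp (b : Pole) (x : E2) : Matrix (Fin 2) (Fin 2) ℝ :=
  Matrix.of fun A B => ⟪frame b A x, frame b B x⟫

/-- The density `σ_s = √(det s_AB)`. -/
def roundDensity (b : Pole) (x : E2) : ℝ := √(roundComp b x).det

/-! ### Two-dimensional metrics in coordinates -/

/-- The partial derivative `∂_A f`. -/
def pd (A : Fin 2) (f : E2 → ℝ) (x : E2) : ℝ :=
  fderiv ℝ f x (EuclideanSpace.single A 1)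

/-- The Christoffel symbols `Γ^A_BC` of the metric `h`. -/
def christoffel (h : E2 → Matrix (Fin 2) (Fin 2) ℝ) (A B C : Fin 2) (x : E2) : ℝ :=
  ∑ D, (h x)⁻¹ A D / 2 *
    (pd B (fun y => h y D C) x + pd C (fun y => h y D B) x - pd D (fun y => h y B C) x)

/-- The Ricci tensor `R_BD = ∂_A Γ^A_BD - ∂_D Γ^A_AB + Γ^A_AE Γ^E_BD - Γ^A_DE Γ^E_AB`. -/
def ricci (h : E2 → Matrix (Fin 2) (Fin 2) ℝ) (B D : Fin 2) (x : E2) : ℝ :=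
  ∑ A, (pd A (christoffel h A B D) x - pd D (christoffel h A A B) x +
    ∑ E, (christoffel h A A E x * christoffel h E B D x -
      christoffel h A D E x * christoffel h E A B x))

/-- The Ricci scalar `R⁽²⁾`. -/
def scalarCurv (h : E2 → Matrix (Fin 2) (Fin 2) ℝ) (x : E2) : ℝ :=
  ∑ B, ∑ D, (h x)⁻¹ B D * ricci h B D x

/-- The covariant divergence `V^A_{|A} = ∂_A V^A + Γ^A_AB V^B`. -/
def divergence (h : E2 → Matrix (Fin 2) (Fin 2) ℝ) (V : E2 → Fin 2 → ℝ) (x : E2) : ℝ :=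
  ∑ A, (pd A (fun y => V y A) x + ∑ B, christoffel h A A B x * V x B)

/-! ### Metrics `du (g₀₀ du + 2 dr + 2 ω_A dx^A) + g_AB dx^A dx^B` -/

/-- The coefficients of a metric `du (g₀₀ du + 2 dr + 2 ω_A dx^A) + g_AB dx^A dx^B`, as functions
of `u`, of `r` and of the point of the sphere. -/
structure BSMetric where
  g00 : ℝ → ℝ → S2 → ℝ
  om : ℝ → ℝ → S2 → Covec
  ang : ℝ → ℝ → S2 → Bilin

namespace BSMetric

variable (g : BSMetric)

/-- The scalar product of two vectors `a ∂_u + c ∂_r + X`, where `X` is tangent to the sphere. -/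
def inner4 (u r : ℝ) (p : S2) (v w : ℝ × ℝ × E3) : ℝ :=
  g.g00 u r p * v.1 * w.1 + (v.1 * w.2.1 + v.2.1 * w.1) +
    (v.1 * g.om u r p w.2.2 + w.1 * g.om u r p v.2.2) + g.ang u r p v.2.2 w.2.2

/-- The metric is smooth on `(u₀, u₁) × (r₀, ∞) × S₂`, and `g_AB` is a symmetric, negative definite
tensor there (so that the signature is `+ - - -`). -/
structure IsRegular (u₀ u₁ r₀ : ℝ) : Prop where
  smooth_g00 : ∀ b, ContDiffOn ℝ ∞ (fun z : ℝ × ℝ × E2 => g.g00 z.1 z.2.1 (chart b z.2.2))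
    (Set.Ioo u₀ u₁ ×ˢ Set.Ioi r₀ ×ˢ Set.univ)
  smooth_om : ∀ b A, ContDiffOn ℝ ∞ (fun z : ℝ × ℝ × E2 => covecComp b (g.om z.1 z.2.1) z.2.2 A)
    (Set.Ioo u₀ u₁ ×ˢ Set.Ioi r₀ ×ˢ Set.univ)
  smooth_ang : ∀ b A B, ContDiffOn ℝ ∞
    (fun z : ℝ × ℝ × E2 => bilinComp b (g.ang z.1 z.2.1) z.2.2 A B)
    (Set.Ioo u₀ u₁ ×ˢ Set.Ioi r₀ ×ˢ Set.univ)
  symm : ∀ u ∈ Set.Ioo u₀ u₁, ∀ r > r₀, ∀ p X Y, IsTangent p X → IsTangent p Y →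
    g.ang u r p X Y = g.ang u r p Y X
  neg : ∀ u ∈ Set.Ioo u₀ u₁, ∀ r > r₀, ∀ p X, IsTangent p X → X ≠ 0 → g.ang u r p X X < 0

/-- The components `g_AB`. -/
def h (b : Pole) (u r : ℝ) (x : E2) : Matrix (Fin 2) (Fin 2) ℝ := bilinComp b (g.ang u r) x

/-- The components `ω^A = g^AB ω_B`. -/
def omUp (b : Pole) (u r : ℝ) (x : E2) (A : Fin 2) : ℝ :=
  ∑ B, (g.h b u r x)⁻¹ A B * covecComp b (g.om u r) x B

/-- The component `g¹¹ = ω^A ω_A - g₀₀` of the inverse metric. -/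
def g11Up (b : Pole) (u r : ℝ) (x : E2) : ℝ :=
  ∑ A, g.omUp b u r x A * covecComp b (g.om u r) x A - g.g00 u r (chart b x)

/-- The density `σ = √(det g_AB)`. -/
def density (b : Pole) (u r : ℝ) (x : E2) : ℝ := √(g.h b u r x).det

/-- The ingoing null expansion `θ₋ = g¹¹ (ln σ)_{,r} + 2 (ln σ)_{,u} - 2 ω^A_{|A}`. -/
def thetaMinus (b : Pole) (u r : ℝ) (x : E2) : ℝ :=
  g.g11Up b u r x * deriv (fun r' => Real.log (g.density b u r' x)) r +
    2 * deriv (fun u' => Real.log (g.density b u' r x)) u -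
    2 * divergence (g.h b u r) (g.omUp b u r) x

/-- The quantity whose limit for `r → ∞` is the mass aspect:
`(σ_{,r} + g¹¹ σ_{,r} + 2 σ_{,u}) / (4 σ_s)`. -/
def massQuotient (b : Pole) (u r : ℝ) (x : E2) : ℝ :=
  (deriv (fun r' => g.density b u r' x) r +
    g.g11Up b u r x * deriv (fun r' => g.density b u r' x) r +
    2 * deriv (fun u' => g.density b u' r x) u) / (4 * roundDensity b x)

/-- The mass aspect `M_B`. -/
def massAspect (b : Pole) (u : ℝ) (x : E2) : ℝ :=
  Filter.limUnder Filter.atTop fun r => g.massQuotient b u r x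

/-- The Trautman–Bondi energy `E(u) = (1/4π) ∫ M_B σ_s d²x`; the chart covers the sphere up to one
point. -/
def energy (u : ℝ) : ℝ :=
  1 / (4 * Real.pi) * ∫ x : E2, g.massAspect Pole.north u x * roundDensity Pole.north x

/-- The area of the cut `S(u, r)`. -/
def area (u r : ℝ) : ℝ := ∫ x : E2, g.density Pole.north u r x

/-- The integral of `σ θ₋` over the cut `S(u, r)`. -/
def intThetaMinus (u r : ℝ) : ℝ :=
  ∫ x : E2, g.density Pole.north u r x * g.thetaMinus Pole.north u r x

end BSMetric

/-! ### Asymptotic flatness -/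

/-- `F = O(r⁻ᵏ)` on the null surface `u = const`, uniformly in `i`, where the estimate may be
differentiated once with respect to `r` (which gains a power of `r`) or to `u`. -/
def IsBigOTerm {ι : Type*} (k : ℕ) (u : ℝ) (F : ℝ → ℝ → ι → ℝ) : Prop :=
  ∃ C R : ℝ, 0 < R ∧ ∀ r ≥ R, ∀ i, |F u r i| ≤ C / r ^ k ∧
    |deriv (fun r' => F u r' i) r| ≤ C / r ^ (k + 1) ∧
    |deriv (fun u' => F u' r i) u| ≤ C / r ^ k

/-- The coefficients of the asymptotic expansions, as functions of `u` and of the point of the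
sphere. -/
structure Coeffs where
  nT : ℝ → S2 → Bilin
  mT : ℝ → S2 → Bilin
  M : ℝ → S2 → ℝ
  ψ : ℝ → S2 → Covec
  κ : ℝ → S2 → Covec

namespace Coeffs

variable (a : Coeffs)

/-- The function `n = - s^AB n_AB`. -/
def n (b : Pole) (u : ℝ) (x : E2) : ℝ :=
  -∑ A, ∑ B, (roundComp b x)⁻¹ A B * bilinComp b (a.nT u) x A B

/-- The mean value `⟨n⟩` over the unit sphere. -/
def nMean (u : ℝ) : ℝ :=
  1 / (4 * Real.pi) * ∫ x : E2, a.n Pole.north u x * roundDensity Pole.north x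

/-- The coefficients are smooth on `(u₀, u₁) × S₂`. -/
structure IsSmooth (u₀ u₁ : ℝ) : Prop where
  smooth_nT : ∀ b A B, ContDiffOn ℝ ∞ (fun z : ℝ × E2 => bilinComp b (a.nT z.1) z.2 A B)
    (Set.Ioo u₀ u₁ ×ˢ Set.univ)
  smooth_mT : ∀ b A B, ContDiffOn ℝ ∞ (fun z : ℝ × E2 => bilinComp b (a.mT z.1) z.2 A B)
    (Set.Ioo u₀ u₁ ×ˢ Set.univ)
  smooth_M : ∀ b, ContDiffOn ℝ ∞ (fun z : ℝ × E2 => a.M z.1 (chart b z.2))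
    (Set.Ioo u₀ u₁ ×ˢ Set.univ)
  smooth_ψ : ∀ b A, ContDiffOn ℝ ∞ (fun z : ℝ × E2 => covecComp b (a.ψ z.1) z.2 A)
    (Set.Ioo u₀ u₁ ×ˢ Set.univ)
  smooth_κ : ∀ b A, ContDiffOn ℝ ∞ (fun z : ℝ × E2 => covecComp b (a.κ z.1) z.2 A)
    (Set.Ioo u₀ u₁ ×ˢ Set.univ)

end Coeffs

/-- Asymptotic flatness:
`g₀₀ = 1 + n_{,u}/2 - 2 M/r + O(r⁻²)`, `g_AB = -s_AB r² + n_AB r + m_AB + O(r⁻¹)` and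
`ω_A = ψ_A + κ_A/r + O(r⁻²)`. -/
structure IsAsymptoticallyFlat (g : BSMetric) (a : Coeffs) (u₀ u₁ : ℝ) : Prop where
  smooth : a.IsSmooth u₀ u₁
  exp_g00 : ∀ u ∈ Set.Ioo u₀ u₁, ∀ b, IsBigOTerm 2 u fun u' r (x : E2) =>
    g.g00 u' r (chart b x) -
      (1 + 1 / 2 * deriv (fun v => a.n b v x) u' - 2 * a.M u' (chart b x) / r)
  exp_ang : ∀ u ∈ Set.Ioo u₀ u₁, IsBigOTerm 1 u fun u' r (v : UnitTangentPair) =>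
    g.ang u' r v.1.1 v.1.2.1 v.1.2.2 -
      (-⟪v.1.2.1, v.1.2.2⟫ * r ^ 2 + a.nT u' v.1.1 v.1.2.1 v.1.2.2 * r +
        a.mT u' v.1.1 v.1.2.1 v.1.2.2)
  exp_om : ∀ u ∈ Set.Ioo u₀ u₁, IsBigOTerm 2 u fun u' r (v : UnitTangent) =>
    g.om u' r v.1.1 v.1.2 - (a.ψ u' v.1.1 v.1.2 + a.κ u' v.1.1 v.1.2 / r)

/-! ### Matter -/

/-- A field of covariant tensors of rank two on spacetime, evaluated on vectors
`a ∂_u + c ∂_r + X`, where `X` is tangent to the sphere. -/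
abbrev Tensor4 := ℝ → ℝ → S2 → (ℝ × ℝ × E3) →L[ℝ] (ℝ × ℝ × E3) →L[ℝ] ℝ

/-- The coordinate vectors `∂_u, ∂_r, ∂_2, ∂_3`. -/
def frame4 (b : Pole) (x : E2) : Fin 4 → ℝ × ℝ × E3 :=
  ![(1, 0, 0), (0, 1, 0), (0, 0, frame b 0 x), (0, 0, frame b 1 x)]

/-- The vector `v` is tangent to spacetime, timelike and directed to the future (that of the null
vector `∂_r`; the component `v^u` is the scalar product of `v` with `∂_r`). -/
def BSMetric.IsFutureTimelike (g : BSMetric) (u r : ℝ) (p : S2) (v : ℝ × ℝ × E3) : Prop :=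
  IsTangent p v.2.2 ∧ 0 < g.inner4 u r p v v ∧ 0 < v.1

/-- The dominant energy condition at a point: `T_μν v^μ w^ν ≥ 0` for all future directed timelike
vectors `v` and `w`. -/
def DominantEnergy (g : BSMetric) (T : Tensor4) (u r : ℝ) (p : S2) : Prop :=
  ∀ v w, g.IsFutureTimelike u r p v → g.IsFutureTimelike u r p w → 0 ≤ T u r p v w

/-- The trace `T = g^μν T_μν`. -/
def trace4 (g : BSMetric) (T : Tensor4) (b : Pole) (u r : ℝ) (x : E2) : ℝ :=
  ∑ i, ∑ j, (Matrix.of fun k l =>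
      g.inner4 u r (chart b x) (frame4 b x k) (frame4 b x l))⁻¹ i j *
    T u r (chart b x) (frame4 b x i) (frame4 b x j)

/-- The partial trace `g^AB T_AB`. -/
def trace2 (g : BSMetric) (T : Tensor4) (b : Pole) (u r : ℝ) (x : E2) : ℝ :=
  ∑ A, ∑ B, (g.h b u r x)⁻¹ A B *
    T u r (chart b x) (0, 0, frame b A x) (0, 0, frame b B x)

/-- The Einstein equation `(ln σ)_{,rr} - (1/4) g_{AB,r} g^{AB}_{,r} = -T₁₁`. -/
def EinsteinRR (g : BSMetric) (T : Tensor4) (b : Pole) (u r : ℝ) (x : E2) : Prop :=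
  iteratedDeriv 2 (fun r' => Real.log (g.density b u r' x)) r -
      1 / 4 * ∑ A, ∑ B, deriv (fun r' => g.h b u r' x A B) r *
        deriv (fun r' => (g.h b u r' x)⁻¹ A B) r =
    -T u r (chart b x) (0, 1, 0) (0, 1, 0)

/-- The Einstein equation
`σ⁻¹ (σ θ₋)_{,r} - R⁽²⁾ + (ω^A_{,r})_{|A} + (1/2) g_AB ω^A_{,r} ω^B_{,r} = T - g^AB T_AB`. -/
def EinsteinTrace (g : BSMetric) (T : Tensor4) (b : Pole) (u r : ℝ) (x : E2) : Prop :=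
  (g.density b u r x)⁻¹ * deriv (fun r' => g.density b u r' x * g.thetaMinus b u r' x) r -
      scalarCurv (g.h b u r) x +
      divergence (g.h b u r) (fun y A => deriv (fun r' => g.omUp b u r' y A) r) x +
      1 / 2 * ∑ A, ∑ B, g.h b u r x A B * deriv (fun r' => g.omUp b u r' x A) r *
        deriv (fun r' => g.omUp b u r' x B) r =
    trace4 g T b u r x - trace2 g T b u r x

end BondiSachs

end

/-!
The whole argument takes place on one null surface `u = const`.

*Focusing.* The vector `∂_r` is a limit of future directed timelike vectors, so that `T₁₁ ≥ 0`, and the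
first Einstein equation makes `√σ` a concave function of `r` (`IsRegular.concaveOn_sqrt_density`). By
asymptotic flatness `√σ - √σ_s (r + n / 4)` tends to zero. A concave function with the limit zero is
nonpositive, so that `0 < √σ ≤ √σ_s (r + n / 4)` (`IsAsymptoticallyFlat.density_le`). This is the
positivity of `r + n / 4`, and it bounds the area of a cut on which `r + n / 4` is constant by that of
the round sphere of this radius (`IsAsymptoticallyFlat.sqrt_area_le`).

*Monotonicity.* The difference `T - g^AB T_AB` is half the sum of `T(∂_r, k)` and `T(k, ∂_r)` for the
ingoing null vector `k`, hence nonnegative. As `g_AB` is negative definite, the second Einstein equation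
gives `(σ θ₋)_{,r} ≥ σ R⁽²⁾ - σ (ω^A_{,r})_{|A}`. The integral of the right-hand side over a cut is
`-8π` by the theorem of Gauss and Bonnet for a negative definite metric and by the divergence theorem,
so that `∫ σ θ₋ + 8 π r` does not decrease with `r` (`IsRegular.intThetaMinus_mono`). Its limit is
`16 π E - 2 π ⟨n⟩` (`IsAsymptoticallyFlat.tendsto_intThetaMinus`), which is the lower bound of the
energy; it follows from `σ θ₋ = (σ_{,r} + g¹¹ σ_{,r} + 2 σ_{,u}) - σ_{,r} - 2 (σ ω^A)_{,A}` and the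
expansion of `σ`, both uniform over the sphere.

*Integration over the sphere.* Integrals over `S₂` are integrals over the plane of one stereographic
chart. The other chart differs by the inversion `sinv`, and a quantity which is smooth in both charts
decays at infinity (`exists_decay_bound`); this supplies all integrability and uniformity. If two vector
densities agree on the overlap up to `k x / |x|²`, the divergence has the integral `2 π k`
(`integral_div2_of_inversion`). For `σ ω^A` and `σ ω^A_{,r}` one has `k = 0`. The density `σ R⁽²⁾` is the
divergence of `frob`, built from the connection form of the orthonormal frame given by the
symmetric square root of the metric; for it `k = -4` (`frob_of_inversion`), which is the theorem of
Gauss and Bonnet.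

*Expansion of `σ`.* In units of the round metric, the components of `g_AB` are explicit up to bounded
remainders, which determines `σ / σ_s` and its first derivatives (`mass_expansion`). In
`σ_{,r} + g¹¹ σ_{,r} + 2 σ_{,u}` the terms of the order `r` cancel, and the limit exists uniformly over
the sphere.
-/

open scoped ContDiff RealInnerProductSpace

noncomputable section

namespace BondiSachs

open MeasureTheory Filter Topology

/-! ### Partial derivatives on the coordinate plane -/

theorem pd_add {A : Fin 2} {f g : E2 → ℝ} {x : E2} (hf : DifferentiableAt ℝ f x)
    (hg : DifferentiableAt ℝ g x) :
    pd A (fun y => f y + g y) x = pd A f x + pd A g x := by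
  simp [pd, fderiv_fun_add hf hg]

theorem pd_sub {A : Fin 2} {f g : E2 → ℝ} {x : E2} (hf : DifferentiableAt ℝ f x)
    (hg : DifferentiableAt ℝ g x) :
    pd A (fun y => f y - g y) x = pd A f x - pd A g x := by
  simp [pd, fderiv_fun_sub hf hg]

theorem pd_mul {A : Fin 2} {f g : E2 → ℝ} {x : E2} (hf : DifferentiableAt ℝ f x)
    (hg : DifferentiableAt ℝ g x) :
    pd A (fun y => f y * g y) x = pd A f x * g x + f x * pd A g x := by
  simp [pd, fderiv_fun_mul hf hg]; ring

theorem pd_const {A : Fin 2} {c : ℝ} {x : E2} : pd A (fun _ => c) x = 0 := by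
  simp [pd]

theorem pd_comp {A : Fin 2} {f : E2 → ℝ} {φ : ℝ → ℝ} {φ' : ℝ} {x : E2}
    (hφ : HasDerivAt φ φ' (f x)) (hf : DifferentiableAt ℝ f x) :
    pd A (fun y => φ (f y)) x = φ' * pd A f x := by
  have := (hφ.comp_hasFDerivAt x hf.hasFDerivAt).fderiv
  simp only [Function.comp_def] at this
  simp [pd, this]

theorem pd_inv {A : Fin 2} {f : E2 → ℝ} {x : E2} (hf : DifferentiableAt ℝ f x) (h0 : f x ≠ 0) :
    pd A (fun y => (f y)⁻¹) x = -pd A f x / f x ^ 2 := by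
  rw [pd_comp (hasDerivAt_inv h0) hf]; ring

theorem pd_sqrt {A : Fin 2} {f : E2 → ℝ} {x : E2} (hf : DifferentiableAt ℝ f x) (h0 : f x ≠ 0) :
    pd A (fun y => √(f y)) x = pd A f x / (2 * √(f x)) := by
  rw [pd_comp (Real.hasDerivAt_sqrt h0) hf]; ring

theorem pd_coord {A B : Fin 2} {x : E2} :
    pd A (fun y : E2 => y B) x = if B = A then 1 else 0 := by
  have : HasFDerivAt (fun y : E2 => y B) (EuclideanSpace.proj B : E2 →L[ℝ] ℝ) x :=
    (EuclideanSpace.proj B : E2 →L[ℝ] ℝ).hasFDerivAt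
  simp [pd, this.fderiv, PiLp.single_apply]

theorem pd_congr {A : Fin 2} {f g : E2 → ℝ} {x : E2} (h : f =ᶠ[nhds x] g) :
    pd A f x = pd A g x := by
  simp [pd, h.fderiv_eq]

/-- A linear map on the plane is determined by its values on the coordinate vectors. -/
theorem clm_apply_E2 {F : Type*} [NormedAddCommGroup F] [NormedSpace ℝ F] (L : E2 →L[ℝ] F)
    (v : E2) : L v = v 0 • L (EuclideanSpace.single 0 1) + v 1 • L (EuclideanSpace.single 1 1) := by
  rw [← map_smul, ← map_smul, ← map_add]
  congr 1
  ext i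
  fin_cases i <;> simp

/-- Mixed partial derivatives commute. -/
theorem pd_pd_comm {A B : Fin 2} {f : E2 → ℝ} {x : E2} (hf : ContDiffAt ℝ 2 f x) :
    pd A (fun y => pd B f y) x = pd B (fun y => pd A f y) x := by
  have h1 : DifferentiableAt ℝ (fderiv ℝ f) x :=
    (hf.fderiv_right (m := 1) (by norm_num)).differentiableAt (by norm_num)
  have h := hf.isSymmSndFDerivAt (by simp)
  have e : ∀ v w : E2, fderiv ℝ (fun y => fderiv ℝ f y v) x w = fderiv ℝ (fderiv ℝ f) x w v := by
    intro v w
    have := (h1.hasFDerivAt.clm_apply (hasFDerivAt_const v x)).fderiv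
    rw [this]; simp
  simp only [pd, e]
  exact h _ _

/-! ### The inversion which relates the two stereographic charts -/

/-- The square of the Euclidean distance from the origin of the coordinate plane. -/
def rsq (x : E2) : ℝ := x 0 ^ 2 + x 1 ^ 2

theorem rsq_eq (x : E2) : rsq x = ‖x‖ ^ 2 := by
  rw [EuclideanSpace.norm_sq_eq]; simp [rsq]

theorem rsq_nonneg (x : E2) : 0 ≤ rsq x := by unfold rsq; positivity

theorem rsq_pos {x : E2} (hx : x ≠ 0) : 0 < rsq x := by
  rw [rsq_eq]; positivity

theorem contDiff_rsq : ContDiff ℝ ∞ rsq := by unfold rsq; fun_prop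

theorem pd_rsq {A : Fin 2} {x : E2} : pd A rsq x = 2 * x A := by
  have e : rsq = fun y => y 0 * y 0 + y 1 * y 1 := by ext y; simp [rsq]; ring
  rw [e, pd_add (by fun_prop) (by fun_prop), pd_mul (by fun_prop) (by fun_prop),
    pd_mul (by fun_prop) (by fun_prop), pd_coord, pd_coord]
  fin_cases A <;> simp <;> ring

/-- The inversion `x ↦ x / |x|²`, with the value `0` at the origin. It is the transition map between
the two stereographic charts. -/
def sinv (x : E2) : E2 := (rsq x)⁻¹ • x

theorem sinv_apply (x : E2) (A : Fin 2) : sinv x A = (rsq x)⁻¹ * x A := by simp [sinv]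

theorem rsq_sinv (x : E2) : rsq (sinv x) = (rsq x)⁻¹ := by
  by_cases hx : x = 0
  · subst hx; simp [rsq, sinv]
  have := (rsq_pos hx).ne'
  have e : rsq (sinv x) = (rsq x)⁻¹ ^ 2 * rsq x := by
    conv_lhs => rw [rsq, sinv_apply, sinv_apply]
    conv_rhs => arg 2; rw [rsq]
    ring
  rw [e]; field_simp

theorem contDiffAt_sinv {x : E2} (hx : x ≠ 0) : ContDiffAt ℝ ∞ sinv x := by
  unfold sinv
  exact (contDiff_rsq.contDiffAt.inv (rsq_pos hx).ne').smul contDiffAt_id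

/-- The Jacobian matrix `∂_B φ^A` of the inversion; it is symmetric. -/
def jac (x : E2) (A B : Fin 2) : ℝ :=
  (rsq x * (if A = B then 1 else 0) - 2 * x A * x B) / rsq x ^ 2

theorem pd_sinv {x : E2} (hx : x ≠ 0) (A B : Fin 2) : pd B (fun y => sinv y A) x = jac x A B := by
  have h0 := (rsq_pos hx).ne'
  have hd : DifferentiableAt ℝ rsq x := contDiff_rsq.differentiable (by simp) x
  simp only [sinv_apply]
  rw [pd_mul (show DifferentiableAt ℝ (fun y => (rsq y)⁻¹) x from hd.inv h0) (by fun_prop),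
    pd_inv hd h0, pd_rsq, pd_coord, jac]
  field_simp
  split_ifs <;> ring

theorem jac_eq_mul (A B : Fin 2) : (fun y => jac y A B) =
    fun y => ((rsq y * (if A = B then 1 else 0) - 2 * y A * y B)) * ((rsq y)⁻¹ * (rsq y)⁻¹) := by
  ext y
  simp only [jac, div_eq_mul_inv, pow_two, mul_inv]

theorem differentiable_jac_numerator (A B : Fin 2) : Differentiable ℝ
    (fun y : E2 => (rsq y * (if A = B then (1 : ℝ) else 0) - 2 * y A * y B)) := by
  have : Differentiable ℝ rsq := contDiff_rsq.differentiable (by simp)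
  fun_prop

theorem differentiableAt_inv_rsq {x : E2} (hx : x ≠ 0) :
    DifferentiableAt ℝ (fun y => (rsq y)⁻¹) x :=
  (contDiff_rsq.differentiable (by simp) x).inv (rsq_pos hx).ne'

theorem differentiableAt_jac {x : E2} (hx : x ≠ 0) (A B : Fin 2) :
    DifferentiableAt ℝ (fun y => jac y A B) x := by
  rw [jac_eq_mul]
  exact (differentiable_jac_numerator A B x).mul
    ((differentiableAt_inv_rsq hx).mul (differentiableAt_inv_rsq hx))

theorem pd_jac {x : E2} (hx : x ≠ 0) (A B C : Fin 2) : pd C (fun y => jac y A B) x =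
    (2 * x C * (if A = B then 1 else 0) - 2 * (if A = C then 1 else 0) * x B -
      2 * x A * (if B = C then 1 else 0)) / rsq x ^ 2 -
    4 * x C * (rsq x * (if A = B then 1 else 0) - 2 * x A * x B) / rsq x ^ 3 := by
  have h0 := (rsq_pos hx).ne'
  have hr : DifferentiableAt ℝ rsq x := contDiff_rsq.differentiable (by simp) x
  have hri := differentiableAt_inv_rsq hx
  have hri2 : DifferentiableAt ℝ (fun y => (rsq y)⁻¹ * (rsq y)⁻¹) x := hri.mul hri
  rw [jac_eq_mul, pd_mul (differentiable_jac_numerator A B x) hri2, pd_mul hri hri, pd_inv hr h0,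
    pd_rsq, pd_sub (by fun_prop) (by fun_prop), pd_mul (by fun_prop) (by fun_prop),
    pd_mul (by fun_prop) (by fun_prop), pd_mul (by fun_prop) (by fun_prop), pd_const, pd_const,
    pd_rsq, pd_coord, pd_coord]
  field_simp
  ring

theorem fderiv_sinv_single {x : E2} (hx : x ≠ 0) (B C : Fin 2) :
    (fderiv ℝ sinv x (EuclideanSpace.single B 1)) C = jac x C B := by
  rw [← pd_sinv hx, pd]
  have := ((EuclideanSpace.proj C : E2 →L[ℝ] ℝ).hasFDerivAt.comp x
    ((contDiffAt_sinv hx).differentiableAt (by simp)).hasFDerivAt).fderiv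
  simp only [Function.comp_def] at this
  change _ = fderiv ℝ (fun y => (EuclideanSpace.proj C : E2 →L[ℝ] ℝ) (sinv y)) x _
  rw [this]; simp

theorem pd_comp_sinv {x : E2} (hx : x ≠ 0) {f : E2 → ℝ} (hf : DifferentiableAt ℝ f (sinv x))
    (B : Fin 2) :
    pd B (fun y => f (sinv y)) x =
      jac x 0 B * pd 0 f (sinv x) + jac x 1 B * pd 1 f (sinv x) := by
  have := (hf.hasFDerivAt.comp x
    ((contDiffAt_sinv hx).differentiableAt (by simp)).hasFDerivAt).fderiv
  simp only [Function.comp_def] at this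
  rw [pd, this]
  simp only [ContinuousLinearMap.comp_apply]
  rw [clm_apply_E2, fderiv_sinv_single hx, fderiv_sinv_single hx]
  rfl

/-! ### The stereographic parametrizations -/

/-- The other one of the two poles. -/
def Pole.other : Pole → Pole
  | .north => .south
  | .south => .north

theorem stereo_sinv (b : Pole) {x : E2} (hx : x ≠ 0) : stereo b.other (sinv x) = stereo b x := by
  have h0 := (rsq_pos hx).ne'
  have h1 : 1 + rsq x ≠ 0 := by have := rsq_nonneg x; positivity
  have e1 : ∀ (b) (y : E2),
      stereo b y = (1 + rsq y)⁻¹ • !₂[2 * y 0, 2 * y 1, b.height * (rsq y - 1)] := by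
    intro b y; simp [stereo, rsq, add_assoc]
  have e2 : (1 + (rsq x)⁻¹)⁻¹ = rsq x * (1 + rsq x)⁻¹ := by
    rw [show 1 + (rsq x)⁻¹ = (1 + rsq x) * (rsq x)⁻¹ by
      rw [add_mul, one_mul, mul_inv_cancel₀ h0, add_comm], mul_inv, inv_inv, mul_comm]
  rw [e1, e1, rsq_sinv, sinv_apply, sinv_apply, e2]
  ext i
  cases b <;> fin_cases i <;> simp [Pole.other, Pole.height] <;> field_simp

theorem chart_sinv (b : Pole) {x : E2} (hx : x ≠ 0) : chart b.other (sinv x) = chart b x :=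
  Subtype.ext (stereo_sinv b hx)

theorem contDiff_stereo (b : Pole) : ContDiff ℝ ∞ (stereo b) := by
  refine ContDiff.fun_smul (f := fun x : E2 => (1 + x 0 ^ 2 + x 1 ^ 2)⁻¹) ?_ ?_
  · apply ContDiff.inv (by fun_prop)
    intro x; positivity
  · rw [contDiff_euclidean]
    intro i
    fin_cases i <;> simp <;> fun_prop

theorem frame_transform (b : Pole) {x : E2} (hx : x ≠ 0) (A : Fin 2) :
    frame b A x = jac x 0 A • frame b.other 0 (sinv x) + jac x 1 A • frame b.other 1 (sinv x) := by
  have he : stereo b =ᶠ[nhds x] fun y => stereo b.other (sinv y) := by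
    filter_upwards [isOpen_ne.mem_nhds hx] with y hy
    exact (stereo_sinv b hy).symm
  have := (((contDiff_stereo b.other).differentiable (by simp) (sinv x)).hasFDerivAt.comp x
    ((contDiffAt_sinv hx).differentiableAt (by simp)).hasFDerivAt).fderiv
  simp only [Function.comp_def] at this
  rw [frame, he.fderiv_eq, this]
  simp only [ContinuousLinearMap.comp_apply]
  rw [clm_apply_E2, fderiv_sinv_single hx, fderiv_sinv_single hx]
  rfl

/-- The conformal factor `4 / (1 + |x|²)²` of the standard metric in a stereographic chart. -/
def conf (x : E2) : ℝ := 4 / (1 + rsq x) ^ 2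

theorem conf_pos (x : E2) : 0 < conf x := by
  have := rsq_nonneg x; unfold conf; positivity

theorem contDiff_conf : ContDiff ℝ ∞ conf := by
  unfold conf
  refine ContDiff.div (by fun_prop) ?_ ?_
  · exact (contDiff_const.add contDiff_rsq).pow 2
  · intro x; have := rsq_nonneg x; positivity

theorem frame_apply (b : Pole) (A : Fin 2) (x : E2) (i : Fin 3) :
    frame b A x i = pd A (fun y => stereo b y i) x := by
  have := ((EuclideanSpace.proj i : E3 →L[ℝ] ℝ).hasFDerivAt.comp x
    ((contDiff_stereo b).differentiable (by simp) x).hasFDerivAt).fderiv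
  simp only [Function.comp_def] at this
  change _ = fderiv ℝ (fun y => (EuclideanSpace.proj i : E3 →L[ℝ] ℝ) (stereo b y)) x _
  rw [this]; simp [frame]

theorem frame_eq (b : Pole) (A : Fin 2) (x : E2) :
    frame b A x = ((1 + rsq x) ^ 2)⁻¹ •
      !₂[2 * (1 + rsq x) * (if A = 0 then 1 else 0) - 4 * x 0 * x A,
        2 * (1 + rsq x) * (if A = 1 then 1 else 0) - 4 * x 1 * x A, 4 * b.height * x A] := by
  have h1 : 1 + rsq x ≠ 0 := by have := rsq_nonneg x; positivity
  have hd : DifferentiableAt ℝ (fun y => 1 + rsq y) x :=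
    (contDiff_const.add contDiff_rsq).differentiable (by simp : (∞ : ℕ∞ω) ≠ 0) x
  have hi : DifferentiableAt ℝ (fun y => (1 + rsq y)⁻¹) x := hd.inv h1
  have hr : DifferentiableAt ℝ rsq x := contDiff_rsq.differentiable (by simp) x
  have p1 : pd A (fun y => (1 + rsq y)⁻¹) x = -(2 * x A) / (1 + rsq x) ^ 2 := by
    rw [pd_inv hd h1, pd_add (by fun_prop) hr, pd_const, pd_rsq, zero_add]
  have hs : ∀ y, stereo b y = (1 + rsq y)⁻¹ • !₂[2 * y 0, 2 * y 1, b.height * (rsq y - 1)] := by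
    intro y; simp [stereo, rsq, add_assoc]
  have q0 : ∀ B : Fin 2, pd A (fun y => (1 + rsq y)⁻¹ * (2 * y B)) x =
      ((1 + rsq x) ^ 2)⁻¹ * (2 * (1 + rsq x) * (if A = B then 1 else 0) - 4 * x B * x A) := by
    intro B
    rw [pd_mul hi (by fun_prop), p1, pd_mul (by fun_prop) (by fun_prop), pd_const, pd_coord]
    field_simp
    simp only [eq_comm (a := B)]
    split_ifs <;> ring
  have q2 : pd A (fun y => (1 + rsq y)⁻¹ * (b.height * (rsq y - 1))) x =
      ((1 + rsq x) ^ 2)⁻¹ * (4 * b.height * x A) := by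
    rw [pd_mul hi (by fun_prop), p1, pd_mul (by fun_prop) (by fun_prop), pd_const,
      pd_sub hr (by fun_prop), pd_const, pd_rsq]
    field_simp
    ring
  ext i
  rw [frame_apply]
  simp only [hs]
  fin_cases i
  · simpa using q0 0
  · simpa using q0 1
  · simpa using q2

theorem roundComp_eq (b : Pole) (x : E2) :
    roundComp b x = conf x • (1 : Matrix (Fin 2) (Fin 2) ℝ) := by
  have h1 : 1 + rsq x ≠ 0 := by have := rsq_nonneg x; positivity
  have hb : b.height ^ 2 = 1 := by cases b <;> simp [Pole.height]
  ext A B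
  have hr : rsq x = x 0 ^ 2 + x 1 ^ 2 := rfl
  fin_cases A <;> fin_cases B <;>
    simp [roundComp, frame_eq, inner_smul_left, inner_smul_right, PiLp.inner_apply,
      Fin.sum_univ_three, conf] <;> field_simp <;> rw [hr] <;> ring_nf <;> simp only [hb] <;> ring_nf <;> simp

theorem roundDensity_eq (b : Pole) (x : E2) : roundDensity b x = conf x := by
  rw [roundDensity, roundComp_eq, Matrix.det_smul, Matrix.det_one, Fintype.card_fin, mul_one]
  exact Real.sqrt_sq (conf_pos x).le

theorem frame_tangent (b : Pole) (A : Fin 2) (x : E2) : IsTangent (chart b x) (frame b A x) := by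
  have h1 : 1 + rsq x ≠ 0 := by have := rsq_nonneg x; positivity
  have hb : b.height ^ 2 = 1 := by cases b <;> simp [Pole.height]
  have hr : rsq x = x 0 ^ 2 + x 1 ^ 2 := rfl
  have hs : (chart b x : E3) = (1 + rsq x)⁻¹ • !₂[2 * x 0, 2 * x 1, b.height * (rsq x - 1)] := by
    simp [chart, stereo, rsq, add_assoc]
  unfold IsTangent
  rw [hs, frame_eq]
  fin_cases A <;> simp [inner_smul_left, inner_smul_right, PiLp.inner_apply, Fin.sum_univ_three] <;>
    right <;> rw [hr] <;> ring_nf <;> rw [hb] <;> ring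

theorem IsTangent.lincomb {p : S2} {X Y : E3} (hX : IsTangent p X) (hY : IsTangent p Y) (c d : ℝ) :
    IsTangent p (c • X + d • Y) := by
  unfold IsTangent at *
  simp [inner_add_right, inner_smul_right, hX, hY]

theorem norm_sq_frame_lincomb (b : Pole) (x : E2) (c d : ℝ) :
    ‖c • frame b 0 x + d • frame b 1 x‖ ^ 2 = conf x * (c ^ 2 + d ^ 2) := by
  have h := fun A B => congrFun (congrFun (roundComp_eq b x) A) B
  simp only [roundComp, Matrix.of_apply, Matrix.smul_apply, smul_eq_mul] at h
  rw [← real_inner_self_eq_norm_sq]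
  simp only [inner_add_left, inner_add_right, inner_smul_left, inner_smul_right, h]
  simp
  ring

/-! ### Integration over the sphere in a stereographic chart -/

/-- A family of functions on the plane which near infinity is controlled, in terms of the
coordinates of the other chart, by continuous functions decays uniformly: the plane is covered by
the unit disk and by the image of the unit disk under the inversion. -/
theorem exists_decay_bound {α : Type*} [TopologicalSpace α] {K : Set α} (hK : IsCompact K)
    {f g : α → E2 → ℝ}
    (hf : ContinuousOn (fun z : α × E2 => f z.1 z.2) (K ×ˢ Set.univ))
    (hg : ContinuousOn (fun z : α × E2 => g z.1 z.2) (K ×ˢ Set.univ)) (m : ℕ)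
    (h : ∀ k ∈ K, ∀ x ≠ 0, |f k x| ≤ ((rsq x)⁻¹) ^ m * |g k (sinv x)|) :
    ∃ C, 0 ≤ C ∧ ∀ k ∈ K, ∀ x, |f k x| ≤ C * ((1 + rsq x)⁻¹) ^ m := by
  have hKB : IsCompact (K ×ˢ Metric.closedBall (0 : E2) 1) :=
    hK.prod (isCompact_closedBall 0 1)
  obtain ⟨C₁, h₁⟩ := hKB.exists_bound_of_continuousOn
    (hf.mono (Set.prod_mono_right (Set.subset_univ _)))
  obtain ⟨C₂, h₂⟩ := hKB.exists_bound_of_continuousOn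
    (hg.mono (Set.prod_mono_right (Set.subset_univ _)))
  refine ⟨max (max C₁ C₂) 0 * 2 ^ m, by positivity, fun k hk x => ?_⟩
  have hr := rsq_nonneg x
  have hC : 0 ≤ max (max C₁ C₂) 0 := le_max_right _ _
  rw [mul_assoc, ← mul_pow]
  rcases le_total (rsq x) 1 with hx | hx
  · have hb : x ∈ Metric.closedBall (0 : E2) 1 := by
      rw [mem_closedBall_zero_iff]
      rw [rsq_eq] at hx
      exact (sq_le_one_iff₀ (norm_nonneg _)).1 hx
    have h1 := h₁ (k, x) ⟨hk, hb⟩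
    have h2 : 1 ≤ (2 * (1 + rsq x)⁻¹) ^ m := by
      apply one_le_pow₀
      rw [← div_eq_mul_inv, le_div_iff₀ (by positivity)]
      linarith
    calc |f k x| ≤ max (max C₁ C₂) 0 := h1.trans ((le_max_left _ _).trans (le_max_left _ _))
      _ ≤ _ := le_mul_of_one_le_right hC h2
  · have hx0 : x ≠ 0 := by
      rintro rfl
      simp [rsq] at hx
      linarith
    have hb : sinv x ∈ Metric.closedBall (0 : E2) 1 := by
      rw [mem_closedBall_zero_iff, ← sq_le_one_iff₀ (norm_nonneg _), ← rsq_eq, rsq_sinv]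
      exact inv_le_one_of_one_le₀ hx
    have h1 := h₂ (k, sinv x) ⟨hk, hb⟩
    have h2 : ((rsq x)⁻¹) ^ m ≤ (2 * (1 + rsq x)⁻¹) ^ m := by
      apply pow_le_pow_left₀ (by positivity)
      rw [← div_eq_mul_inv, inv_eq_one_div, div_le_div_iff₀ (by positivity) (by positivity)]
      linarith
    calc |f k x| ≤ ((rsq x)⁻¹) ^ m * |g k (sinv x)| := h k hk x hx0
      _ ≤ (2 * (1 + rsq x)⁻¹) ^ m * max (max C₁ C₂) 0 := by
        gcongr
        exact h1.trans ((le_max_right _ _).trans (le_max_left _ _))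
      _ = _ := mul_comm _ _

theorem integrable_inv_one_add_rsq_pow :
    Integrable (fun x : E2 => ((1 + rsq x)⁻¹) ^ 2) := by
  have h := integrable_rpow_neg_one_add_norm_sq (E := E2) (μ := volume) (r := 4) (by simp; norm_num)
  refine h.congr (ae_of_all _ fun x => ?_)
  have hr := rsq_nonneg x
  rw [rsq_eq] at hr
  simp only [rsq_eq]
  rw [show (-4 / 2 : ℝ) = -((2 : ℕ) : ℝ) by norm_num, Real.rpow_neg (by positivity),
    Real.rpow_natCast, inv_pow]

theorem integrable_conf : Integrable conf := by
  refine (integrable_inv_one_add_rsq_pow.const_mul 4).congr (ae_of_all _ fun x => ?_)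
  simp [conf, div_eq_mul_inv]

/-- A continuous function bounded by a multiple of the round density is integrable. -/
theorem integrable_of_le_decay {f : E2 → ℝ} (hf : Continuous f) {C : ℝ}
    (h : ∀ x, |f x| ≤ C * ((1 + rsq x)⁻¹) ^ 2) : Integrable f :=
  (integrable_inv_one_add_rsq_pow.const_mul C).mono' hf.aestronglyMeasurable
    (ae_of_all _ h)

/-- The unit sphere has the area `4π`. -/
theorem integral_conf : ∫ x, conf x = 4 * Real.pi := by
  have h := integral_fun_norm_addHaar (E := E2) (F := ℝ) volume (fun y => 4 / (1 + y ^ 2) ^ 2)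
  have e : ∀ x : E2, conf x = 4 / (1 + ‖x‖ ^ 2) ^ 2 := fun x => by rw [conf, rsq_eq]
  have hI : ∫ y in Set.Ioi (0 : ℝ), y ^ (Module.finrank ℝ E2 - 1) • (4 / (1 + y ^ 2) ^ 2) = 2 := by
    have hd : ∀ y ∈ Set.Ici (0 : ℝ), HasDerivAt (fun y : ℝ => -2 / (1 + y ^ 2))
        (y ^ (Module.finrank ℝ E2 - 1) • (4 / (1 + y ^ 2) ^ 2)) y := by
      intro y _
      have h1 : HasDerivAt (fun y : ℝ => 1 + y ^ 2) (2 * y) y := by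
        simpa using (hasDerivAt_pow 2 y).const_add 1
      have h2 := (hasDerivAt_const y (-2 : ℝ)).div h1 (by positivity)
      refine h2.congr_deriv ?_
      simp
      ring
    have hlim : Tendsto (fun y : ℝ => -2 / (1 + y ^ 2)) atTop (𝓝 0) := by
      apply Tendsto.div_atTop tendsto_const_nhds
      exact tendsto_atTop_add_const_left _ _ (tendsto_pow_atTop (by norm_num))
    rw [integral_Ioi_of_hasDerivAt_of_nonneg' hd ?_ hlim]
    · norm_num
    · intro y hy
      have : (0 : ℝ) < y := hy
      simp only [smul_eq_mul]
      positivity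
  simp only [e]
  rw [h, hI, measureReal_def, EuclideanSpace.volume_ball_fin_two]
  simp [ENNReal.toReal_ofReal Real.pi_pos.le]
  ring

/-- The coordinate divergence `∂_A P^A` of a vector density. -/
def div2 (P : E2 → Fin 2 → ℝ) (x : E2) : ℝ := ∑ A, pd A (fun y => P y A) x

theorem ContDiff.continuous_pd {f : E2 → ℝ} (hf : ContDiff ℝ 1 f) (A : Fin 2) :
    Continuous (pd A f) := by
  unfold pd
  exact (hf.continuous_fderiv (by norm_num)).clm_apply continuous_const

theorem continuous_div2 {P : E2 → Fin 2 → ℝ} (hP : ∀ A, ContDiff ℝ 1 fun x => P x A) :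
    Continuous (div2 P) := by
  unfold div2
  exact continuous_finsetSum _ fun A _ => ContDiff.continuous_pd (hP A) A

/-- A vector density on the plane which decays like `|x|⁻²` has no flux through infinity. -/
theorem integral_div2_eq_zero {P : E2 → Fin 2 → ℝ} (hP : ∀ A, ContDiff ℝ 1 fun x => P x A) {C : ℝ}
    (hC : ∀ A x, |P x A| ≤ C * (1 + rsq x)⁻¹) (hint : Integrable (div2 P)) :
    ∫ x, div2 P x = 0 := by
  let χ : ContDiffBump (0 : E2) := ⟨1, 2, by norm_num, by norm_num⟩
  have hχ : ContDiff ℝ 1 χ := χ.contDiff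
  have hχ0 : HasCompactSupport χ := χ.hasCompactSupport
  -- the cutoff functions at the radius `n + 1`
  let η : ℕ → E2 → ℝ := fun n x => χ ((n + 1 : ℝ)⁻¹ • x)
  have hη : ∀ n, ContDiff ℝ 1 (η n) := fun n => hχ.comp (contDiff_const_smul _)
  have hηc : ∀ n, HasCompactSupport (η n) := fun n => hχ0.comp_smul (by positivity)
  have hpd : ∀ n A x, pd A (η n) x = (n + 1 : ℝ)⁻¹ * pd A χ ((n + 1 : ℝ)⁻¹ • x) := by
    intro n A x
    have h1 := (hχ.differentiable (by norm_num) ((n + 1 : ℝ)⁻¹ • x)).hasFDerivAt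
    have h2 : HasFDerivAt (fun x : E2 => (n + 1 : ℝ)⁻¹ • x)
      ((n + 1 : ℝ)⁻¹ • ContinuousLinearMap.id ℝ E2) x := (hasFDerivAt_id x).fun_const_smul _
    have := (h1.comp x h2).fderiv
    simp only [Function.comp_def] at this
    simp only [pd, η, this]
    simp
  have hbd : ∀ A, ∃ B, ∀ x, |pd A χ x| ≤ B := by
    intro A
    have hc : Continuous (pd A χ) := ContDiff.continuous_pd hχ A
    have hs : HasCompactSupport (pd A χ) := by
      refine (hχ0.fderiv (𝕜 := ℝ)).mono ?_
      intro x hx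
      contrapose! hx
      simp at hx
      simp [pd, hx]
    exact hs.exists_bound_of_continuous hc
  choose B hB using hbd
  have hbp : ∀ n, ∫ x, η n x * div2 P x = -∫ x, ∑ A, pd A (η n) x * P x A := by
    intro n
    have hi1 : ∀ A, Integrable fun x => η n x * pd A (fun y => P y A) x := fun A =>
      ((hη n).continuous.mul (ContDiff.continuous_pd (hP A) A)).integrable_of_hasCompactSupport
        (hηc n).mul_right
    have hi2 : ∀ A, Integrable fun x => pd A (η n) x * P x A := by
      intro A
      refine ((ContDiff.continuous_pd (hη n) A).mul
        (hP A).continuous).integrable_of_hasCompactSupport ?_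
      refine HasCompactSupport.mul_right ?_
      refine ((hηc n).fderiv (𝕜 := ℝ)).mono ?_
      intro x hx
      contrapose! hx
      simp at hx
      simp [pd, hx]
    have hi3 : ∀ A, Integrable fun x => η n x * P x A := fun A =>
      ((hη n).continuous.mul (hP A).continuous).integrable_of_hasCompactSupport
        (hηc n).mul_right
    simp only [div2, Finset.mul_sum]
    rw [integral_finsetSum _ fun A _ => hi1 A, integral_finsetSum _ fun A _ => hi2 A,
      ← Finset.sum_neg_distrib]
    refine Finset.sum_congr rfl fun A _ => ?_
    exact integral_mul_fderiv_eq_neg_fderiv_mul_of_integrable (hi2 A) (hi1 A) (hi3 A)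
      (fun x _ => (hη n).differentiable (by norm_num) x)
      (fun x _ => (hP A).differentiable (by norm_num) x)
  have hinv : Tendsto (fun n : ℕ => (n + 1 : ℝ)⁻¹) atTop (𝓝 0) := by
    simpa [one_div] using tendsto_one_div_add_atTop_nhds_zero_nat (𝕜 := ℝ)
  have hlim1 : Tendsto (fun n => ∫ x, η n x * div2 P x) atTop (𝓝 (∫ x, div2 P x)) := by
    refine tendsto_integral_of_dominated_convergence (fun x => |div2 P x|) ?_ hint.abs ?_ ?_
    · intro n
      exact ((hη n).continuous.mul (continuous_div2 hP)).aestronglyMeasurable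
    · intro n
      refine ae_of_all _ fun x => ?_
      rw [Real.norm_eq_abs, abs_mul, abs_of_nonneg (χ.nonneg)]
      exact mul_le_of_le_one_left (abs_nonneg _) χ.le_one
    · refine ae_of_all _ fun x => ?_
      have h1 : Tendsto (fun n => η n x) atTop (𝓝 1) := by
        have h2 : Tendsto (fun n : ℕ => (n + 1 : ℝ)⁻¹ • x) atTop (𝓝 0) := by
          simpa using hinv.smul_const x
        have h3 := (hχ.continuous.tendsto 0).comp h2
        rwa [χ.one_of_mem_closedBall (by simp [χ])] at h3
      simpa using h1.mul_const (div2 P x)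
  have hlim2 : Tendsto (fun n => ∫ x, ∑ A, pd A (η n) x * P x A) atTop (𝓝 0) := by
    have hdec : Integrable fun x : E2 => 3 * (∑ A, B A) * C * (1 + ‖x‖ ^ 2) ^ (-(3 : ℝ) / 2) :=
      (integrable_rpow_neg_one_add_norm_sq (E := E2) (r := 3) (by simp; norm_num)).const_mul _
    have hB0 : ∀ A, 0 ≤ B A := fun A => (abs_nonneg _).trans (hB A 0)
    rw [← integral_zero E2 ℝ (μ := volume)]
    refine tendsto_integral_of_dominated_convergence _ ?_ hdec ?_ ?_
    · intro n
      exact (continuous_finsetSum _ fun A _ => (ContDiff.continuous_pd (hη n) A).mul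
        (hP A).continuous).aestronglyMeasurable
    · intro n
      refine ae_of_all _ fun x => ?_
      have hr := rsq_nonneg x
      -- on the support of the gradient of the cutoff, `|x| ≤ 2 (n + 1)`
      have key : ∀ A, |pd A (η n) x| ≤ 3 * B A * (1 + rsq x) ^ (-(1 : ℝ) / 2) := by
        intro A
        rw [hpd, abs_mul, abs_of_pos (by positivity)]
        by_cases hz : pd A χ ((n + 1 : ℝ)⁻¹ • x) = 0
        · rw [hz]; simp; have := hB0 A; positivity
        · have hmem : (n + 1 : ℝ)⁻¹ • x ∈ tsupport χ := by
            by_contra hcon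
            apply hz
            have : χ =ᶠ[𝓝 ((n + 1 : ℝ)⁻¹ • x)] fun _ => 0 := notMem_tsupport_iff_eventuallyEq.1 hcon
            rw [pd_congr this, pd_const]
          rw [χ.tsupport_eq, mem_closedBall_zero_iff, norm_smul, Real.norm_of_nonneg (by positivity),
            inv_mul_le_iff₀ (by positivity)] at hmem
          have hmem' : ‖x‖ ≤ (n + 1 : ℝ) * 2 := hmem
          have h1 : (1 + rsq x) ^ ((1 : ℝ) / 2) ≤ 3 * (n + 1) := by
            rw [← Real.sqrt_eq_rpow, Real.sqrt_le_left (by positivity), rsq_eq]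
            have : (0 : ℝ) ≤ n := n.cast_nonneg
            nlinarith [norm_nonneg x]
          have h2 : (n + 1 : ℝ)⁻¹ ≤ 3 * (1 + rsq x) ^ (-(1 : ℝ) / 2) := by
            rw [neg_div, Real.rpow_neg (by positivity), ← div_eq_mul_inv, inv_eq_one_div,
              div_le_div_iff₀ (by positivity) (by positivity)]
            linarith
          calc (n + 1 : ℝ)⁻¹ * |pd A χ ((n + 1 : ℝ)⁻¹ • x)|
              ≤ (3 * (1 + rsq x) ^ (-(1 : ℝ) / 2)) * B A := by
                gcongr
                exact hB A _
            _ = _ := by ring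
      have hpow : (1 + rsq x) ^ (-(1 : ℝ) / 2) * (1 + rsq x)⁻¹ = (1 + ‖x‖ ^ 2) ^ (-(3 : ℝ) / 2) := by
        rw [← rsq_eq, ← Real.rpow_neg_one, ← Real.rpow_add (by positivity)]
        norm_num
      rw [Real.norm_eq_abs, ← hpow]
      calc |∑ A, pd A (η n) x * P x A| ≤ ∑ A, |pd A (η n) x * P x A| :=
            Finset.abs_sum_le_sum_abs _ _
        _ ≤ ∑ A, (3 * B A * (1 + rsq x) ^ (-(1 : ℝ) / 2)) * (C * (1 + rsq x)⁻¹) := by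
            refine Finset.sum_le_sum fun A _ => ?_
            rw [abs_mul]
            exact mul_le_mul (key A) (hC A x) (abs_nonneg _) ((abs_nonneg _).trans (key A))
        _ = _ := by rw [← Finset.sum_mul, ← Finset.sum_mul, ← Finset.mul_sum]; ring
    · refine ae_of_all _ fun x => ?_
      rw [show (0 : ℝ) = ∑ A : Fin 2, 0 * P x A by simp]
      refine tendsto_finsetSum _ fun A _ => Tendsto.mul_const _ ?_
      refine squeeze_zero_norm (a := fun n : ℕ => (n + 1 : ℝ)⁻¹ * B A) ?_ ?_
      · intro n
        rw [hpd, norm_mul, Real.norm_of_nonneg (by positivity)]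
        gcongr
        exact hB A _
      · simpa using hinv.mul_const (B A)
  have h := tendsto_nhds_unique hlim1 (by simpa only [hbp] using hlim2.neg)
  simpa using h

/-- A vector density transforms like a vector times the absolute value of the Jacobian determinant,
which for the inversion amounts to the factor `jac`; its divergence transforms like a density (the
Piola identity). The radial field `x / |x|²` does not contribute, as it is divergence free away from
the origin. -/
theorem div2_of_inversion {P Q : E2 → Fin 2 → ℝ} {k : ℝ} (hQ : ∀ A, ContDiff ℝ 1 fun x => Q x A)
    (h : ∀ x ≠ 0, ∀ A, P x A = jac x A 0 * Q (sinv x) 0 + jac x A 1 * Q (sinv x) 1 +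
      k * (x A * (rsq x)⁻¹)) {x : E2} (hx : x ≠ 0) :
    div2 P x = ((rsq x)⁻¹) ^ 2 * div2 Q (sinv x) := by
  have h0 := (rsq_pos hx).ne'
  have hr : DifferentiableAt ℝ rsq x := contDiff_rsq.differentiable (by simp) x
  have hri : DifferentiableAt ℝ (fun y => (rsq y)⁻¹) x := hr.inv h0
  have hs : DifferentiableAt ℝ sinv x := (contDiffAt_sinv hx).differentiableAt (by simp)
  have hQd : ∀ A, DifferentiableAt ℝ (fun y => Q y A) (sinv x) := fun A =>
    (hQ A).differentiable (by norm_num) _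
  have hQs : ∀ A, DifferentiableAt ℝ (fun y => Q (sinv y) A) x := fun A =>
    DifferentiableAt.comp (g := fun y => Q y A) x (hQd A) hs
  have he : ∀ A, pd A (fun y => P y A) x = pd A (fun y => jac y A 0 * Q (sinv y) 0 +
      jac y A 1 * Q (sinv y) 1 + k * (y A * (rsq y)⁻¹)) x := by
    intro A
    refine pd_congr ?_
    filter_upwards [isOpen_ne.mem_nhds hx] with y hy
    exact h y hy A
  have hd1 : ∀ A B, DifferentiableAt ℝ (fun y => jac y A B * Q (sinv y) B) x := fun A B =>
    (differentiableAt_jac hx A B).mul (hQs B)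
  have hd2 : ∀ A : Fin 2, DifferentiableAt ℝ (fun y : E2 => y A * (rsq y)⁻¹) x := fun A =>
    DifferentiableAt.mul (by fun_prop) hri
  have hd3 : ∀ A, pd A (fun y => P y A) x =
      pd A (fun y => jac y A 0) x * Q (sinv x) 0 + jac x A 0 *
        (jac x 0 A * pd 0 (fun y => Q y 0) (sinv x) + jac x 1 A * pd 1 (fun y => Q y 0) (sinv x)) +
      (pd A (fun y => jac y A 1) x * Q (sinv x) 1 + jac x A 1 *
        (jac x 0 A * pd 0 (fun y => Q y 1) (sinv x) + jac x 1 A * pd 1 (fun y => Q y 1) (sinv x))) +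
      k * (1 * (rsq x)⁻¹ + x A * (-(2 * x A) / rsq x ^ 2)) := by
    intro A
    rw [he, pd_add ((hd1 A 0).fun_add (hd1 A 1)) ((hd2 A).const_mul k), pd_add (hd1 A 0) (hd1 A 1),
      pd_mul (differentiableAt_jac hx A 0) (hQs 0), pd_mul (differentiableAt_jac hx A 1) (hQs 1),
      pd_comp_sinv hx (hQd 0), pd_comp_sinv hx (hQd 1), pd_mul (by fun_prop) (hd2 A), pd_const,
      pd_mul (by fun_prop) hri, pd_coord, pd_inv hr h0, pd_rsq]
    simp
  simp only [div2, Fin.sum_univ_two, hd3, pd_jac hx]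
  simp only [jac]
  simp
  have hrx : rsq x = x 0 ^ 2 + x 1 ^ 2 := rfl
  rw [hrx] at h0 ⊢
  field_simp
  ring

theorem integrable_div2_of_inversion {P Q : E2 → Fin 2 → ℝ} {k : ℝ}
    (hP : ∀ A, ContDiff ℝ 1 fun x => P x A) (hQ : ∀ A, ContDiff ℝ 1 fun x => Q x A)
    (h : ∀ x ≠ 0, ∀ A, P x A = jac x A 0 * Q (sinv x) 0 + jac x A 1 * Q (sinv x) 1 +
      k * (x A * (rsq x)⁻¹)) :
    Integrable (div2 P) := by
  obtain ⟨C, -, hC⟩ := exists_decay_bound (α := Unit) (K := Set.univ) isCompact_univ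
    (f := fun _ => div2 P) (g := fun _ => div2 Q)
    ((continuous_div2 hP).comp continuous_snd).continuousOn
    ((continuous_div2 hQ).comp continuous_snd).continuousOn 2 (by
      intro _ _ x hx
      rw [div2_of_inversion hQ h hx, abs_mul, abs_of_nonneg (by positivity)])
  exact integrable_of_le_decay (continuous_div2 hP) (fun x => hC () trivial x)

theorem abs_jac_le {x : E2} (hx : x ≠ 0) (A B : Fin 2) : |jac x A B| ≤ 3 * (rsq x)⁻¹ := by
  have h0 := rsq_pos hx
  have h1 : |rsq x * (if A = B then 1 else 0) - 2 * x A * x B| ≤ 3 * rsq x := by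
    have hr : rsq x = x 0 ^ 2 + x 1 ^ 2 := rfl
    rw [abs_le, hr]
    fin_cases A <;> fin_cases B <;> simp <;> constructor <;>
      nlinarith [sq_nonneg (x 0 + x 1), sq_nonneg (x 0 - x 1), sq_nonneg (x 0), sq_nonneg (x 1)]
  rw [jac, abs_div, abs_of_pos (by positivity : 0 < rsq x ^ 2), div_le_iff₀ (by positivity)]
  calc _ ≤ 3 * rsq x := h1
    _ = _ := by field_simp

/-- **Divergence theorem on the sphere.** Two vector densities in the two charts which agree on the
overlap up to the flux density `k x / |x|²` of a point source have the total divergence `2 π k`. -/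
theorem integral_div2_of_inversion {P Q : E2 → Fin 2 → ℝ} {k : ℝ}
    (hP : ∀ A, ContDiff ℝ 1 fun x => P x A) (hQ : ∀ A, ContDiff ℝ 1 fun x => Q x A)
    (h : ∀ x ≠ 0, ∀ A, P x A = jac x A 0 * Q (sinv x) 0 + jac x A 1 * Q (sinv x) 1 +
      k * (x A * (rsq x)⁻¹)) :
    ∫ x, div2 P x = 2 * Real.pi * k := by
  have hi := integrable_div2_of_inversion hP hQ h
  -- subtract a smooth vector density with the same flux through infinity; the difference decays
  let V : E2 → Fin 2 → ℝ := fun x A => k * (x A * (1 + rsq x)⁻¹)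
  have hq : ContDiff ℝ 1 fun x => (1 + rsq x)⁻¹ :=
    ContDiff.inv ((contDiff_const.add contDiff_rsq).of_le (by simp))
      (fun x => by have := rsq_nonneg x; positivity)
  have hV : ∀ A, ContDiff ℝ 1 fun x => V x A := fun A =>
    contDiff_const.mul (ContDiff.mul (by fun_prop) hq)
  have hVdiv : ∀ x, div2 V x = k / 2 * conf x := by
    intro x
    have hr : DifferentiableAt ℝ rsq x := contDiff_rsq.differentiable (by simp) x
    have h1 : 1 + rsq x ≠ 0 := by have := rsq_nonneg x; positivity
    have hqd : DifferentiableAt ℝ (fun x => (1 + rsq x)⁻¹) x := hq.differentiable (by norm_num) x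
    have e : ∀ A, pd A (fun y => V y A) x =
        k * (1 * (1 + rsq x)⁻¹ + x A * (-(2 * x A) / (1 + rsq x) ^ 2)) := by
      intro A
      have hm : DifferentiableAt ℝ (fun y : E2 => y A * (1 + rsq y)⁻¹) x :=
        DifferentiableAt.mul (by fun_prop) hqd
      rw [pd_mul (by fun_prop) hm, pd_const, pd_mul (by fun_prop) hqd, pd_coord,
        pd_inv (by fun_prop) h1, pd_add (by fun_prop) hr, pd_const, pd_rsq]
      simp
    simp only [div2, e, Fin.sum_univ_two, conf]
    have hrx : rsq x = x 0 ^ 2 + x 1 ^ 2 := rfl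
    rw [hrx] at h1 ⊢
    field_simp
    ring
  have hVi : Integrable (div2 V) := by
    rw [funext hVdiv]; exact integrable_conf.const_mul _
  have hVint : ∫ x, div2 V x = 2 * Real.pi * k := by
    simp only [hVdiv]
    rw [integral_const_mul, integral_conf]; ring
  have hdd : ∀ x, div2 (fun x A => P x A - V x A) x = div2 P x - div2 V x := by
    intro x
    simp only [div2]
    rw [← Finset.sum_sub_distrib]
    exact Finset.sum_congr rfl fun A _ =>
      pd_sub ((hP A).differentiable (by norm_num) x) ((hV A).differentiable (by norm_num) x)
  have hbound : ∀ A, ∃ C, 0 ≤ C ∧ ∀ u ∈ (Set.univ : Set Unit), ∀ x,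
      |P x A - V x A| ≤ C * ((1 + rsq x)⁻¹) ^ 1 := by
    intro A
    refine exists_decay_bound (α := Unit) isCompact_univ (f := fun _ x => P x A - V x A)
      (g := fun _ y => 3 * (|Q y 0| + |Q y 1|) + |k| * (1 + rsq y)) ?_ ?_ 1 ?_
    · exact (((hP A).continuous.sub (hV A).continuous).comp continuous_snd).continuousOn
    · have := (hQ 0).continuous
      have := (hQ 1).continuous
      have := contDiff_rsq.continuous
      refine Continuous.continuousOn ?_
      fun_prop
    · intro _ _ x hx
      have h0 := rsq_pos hx
      have hxA : |x A| ≤ 1 + rsq x := by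
        have : x A ^ 2 ≤ rsq x := by
          have hr : rsq x = x 0 ^ 2 + x 1 ^ 2 := rfl
          fin_cases A <;> simp [hr] <;> positivity
        rw [abs_le]
        constructor <;> nlinarith [sq_nonneg (x A + 1), sq_nonneg (x A - 1)]
      have e1 : P x A - V x A = jac x A 0 * Q (sinv x) 0 + jac x A 1 * Q (sinv x) 1 +
          k * (x A * (rsq x)⁻¹ * (1 + rsq x)⁻¹) := by
        have : k * (x A * (rsq x)⁻¹ * (1 + rsq x)⁻¹) =
            k * (x A * (rsq x)⁻¹) - k * (x A * (1 + rsq x)⁻¹) := by field_simp; ring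
        rw [h x hx, this]; ring
      have e2 : |k * (x A * (rsq x)⁻¹ * (1 + rsq x)⁻¹)| ≤ (rsq x)⁻¹ * |k| := by
        rw [abs_mul, abs_mul, abs_mul, abs_of_pos (inv_pos.2 h0),
          abs_of_pos (by positivity : 0 < (1 + rsq x)⁻¹)]
        have : |x A| * (1 + rsq x)⁻¹ ≤ 1 := by
          rw [← div_eq_mul_inv, div_le_one (by positivity)]; exact hxA
        calc |k| * (|x A| * (rsq x)⁻¹ * (1 + rsq x)⁻¹)
            = (rsq x)⁻¹ * |k| * (|x A| * (1 + rsq x)⁻¹) := by ring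
          _ ≤ (rsq x)⁻¹ * |k| * 1 := by gcongr
          _ = _ := mul_one _
      have e3 : ∀ B, |jac x A B * Q (sinv x) B| ≤ 3 * (rsq x)⁻¹ * |Q (sinv x) B| := by
        intro B
        rw [abs_mul]
        gcongr
        exact abs_jac_le hx A B
      have h8 : 0 ≤ 3 * (|Q (sinv x) 0| + |Q (sinv x) 1|) + |k| * (1 + rsq (sinv x)) := by
        have := rsq_nonneg (sinv x)
        positivity
      rw [e1, pow_one, abs_of_nonneg h8]
      have h4 := abs_add_three (jac x A 0 * Q (sinv x) 0) (jac x A 1 * Q (sinv x) 1)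
        (k * (x A * (rsq x)⁻¹ * (1 + rsq x)⁻¹))
      have h5 : 0 ≤ (rsq x)⁻¹ * (|k| * rsq (sinv x)) := by
        have := rsq_nonneg (sinv x); positivity
      have h6 := e3 0
      have h7 := e3 1
      calc _ ≤ _ := h4
        _ ≤ 3 * (rsq x)⁻¹ * |Q (sinv x) 0| + 3 * (rsq x)⁻¹ * |Q (sinv x) 1| + (rsq x)⁻¹ * |k| := by
          gcongr
        _ ≤ _ := by linarith
  choose C hC0 hC using hbound
  have hzero := integral_div2_eq_zero (P := fun x A => P x A - V x A)
    (fun A => (hP A).sub (hV A)) (C := max (C 0) (C 1)) (by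
      intro A x
      refine (hC A () trivial x).trans ?_
      rw [pow_one]
      have := rsq_nonneg x
      gcongr
      fin_cases A
      · exact le_max_left _ _
      · exact le_max_right _ _) (by rw [funext hdd]; exact hi.sub hVi)
  simp only [hdd] at hzero
  rw [integral_sub hi hVi, hVint] at hzero
  linarith

/-! ### Two-dimensional metrics: divergence and curvature as coordinate divergences -/

theorem det_symm2 (a b c : ℝ) : (!![a, b; b, c] : Matrix (Fin 2) (Fin 2) ℝ).det = a * c - b * b := by
  simp [Matrix.det_fin_two]

theorem inv_symm2 {a b c : ℝ} (A B : Fin 2) :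
    (!![a, b; b, c] : Matrix (Fin 2) (Fin 2) ℝ)⁻¹ A B =
      (a * c - b * b)⁻¹ * (!![c, -b; -b, a] : Matrix (Fin 2) (Fin 2) ℝ) A B := by
  rw [Matrix.inv_def, det_symm2, Matrix.adjugate_fin_two]
  simp

/-- For the volume density `σ` of a metric, `σ V^A_{|A} = ∂_A (σ V^A)`. -/
theorem density_mul_divergence {a b c : E2 → ℝ} {V : E2 → Fin 2 → ℝ} {x : E2}
    (ha : DifferentiableAt ℝ a x) (hb : DifferentiableAt ℝ b x) (hc : DifferentiableAt ℝ c x)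
    (hV : ∀ A, DifferentiableAt ℝ (fun y => V y A) x) (hd : 0 < a x * c x - b x * b x) :
    √(a x * c x - b x * b x) * divergence (fun y => !![a y, b y; b y, c y]) V x =
      div2 (fun y A => √(a y * c y - b y * b y) * V y A) x := by
  have hdd : DifferentiableAt ℝ (fun y => a y * c y - b y * b y) x := by fun_prop
  have hσ := Real.sqrt_pos.2 hd
  have hsd : DifferentiableAt ℝ (fun y => √(a y * c y - b y * b y)) x := hdd.sqrt hd.ne'
  have e : ∀ A, pd A (fun y => √(a y * c y - b y * b y) * V y A) x =
      (pd A a x * c x + a x * pd A c x - (pd A b x * b x + b x * pd A b x)) /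
        (2 * √(a x * c x - b x * b x)) * V x A +
      √(a x * c x - b x * b x) * pd A (fun y => V y A) x := by
    intro A
    rw [pd_mul hsd (hV A), pd_sqrt hdd hd.ne', pd_sub (by fun_prop) (by fun_prop), pd_mul ha hc,
      pd_mul hb hb]
  simp only [div2, e, divergence, christoffel, Fin.sum_univ_two, inv_symm2]
  obtain ⟨σ, hσd⟩ : ∃ σ, σ = √(a x * c x - b x * b x) := ⟨_, rfl⟩
  have hσ2 : a x * c x - b x * b x = σ ^ 2 := by rw [hσd, Real.sq_sqrt hd.le]
  rw [← hσd] at hσ ⊢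
  rw [hσ2]
  simp
  field_simp
  ring

/-- The numerator in Brioschi's formula for the Ricci scalar of a metric, whose denominator is
`(a c - b²)²`. The arguments are the components `a, b, c` and their partial derivatives. -/
def brioschi (a b c a₀ a₁ b₀ b₁ c₀ c₁ a₁₁ b₀₁ c₀₀ : ℝ) : ℝ :=
  2 * ((-a₁₁ / 2 + b₀₁ - c₀₀ / 2) * (a * c - b * b)
    - a₀ / 2 * ((b₁ - c₀ / 2) * c - b * (c₁ / 2))
    + (b₀ - a₁ / 2) * ((b₁ - c₀ / 2) * b - a * (c₁ / 2))
    + a₁ / 2 * (a₁ / 2 * c - b * (c₀ / 2)) - c₀ / 2 * (a₁ / 2 * b - a * (c₀ / 2)))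

theorem scalarCurv_eq {a b c : E2 → ℝ} (ha : ContDiff ℝ 2 a) (hb : ContDiff ℝ 2 b)
    (hc : ContDiff ℝ 2 c) {x : E2} (hd : a x * c x - b x * b x ≠ 0) :
    scalarCurv (fun y => !![a y, b y; b y, c y]) x =
      brioschi (a x) (b x) (c x) (pd 0 a x) (pd 1 a x) (pd 0 b x) (pd 1 b x) (pd 0 c x) (pd 1 c x)
        (pd 1 (fun y => pd 1 a y) x) (pd 0 (fun y => pd 1 b y) x) (pd 0 (fun y => pd 0 c y) x) /
        (a x * c x - b x * b x) ^ 2 := by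
  have h1 : ∀ {f : E2 → ℝ}, ContDiff ℝ 2 f → ∀ A, DifferentiableAt ℝ (fun y => pd A f y) x := by
    intro f hf A
    have : ContDiff ℝ 1 (fderiv ℝ f) := hf.fderiv_right (by norm_num)
    exact ((this.clm_apply contDiff_const).differentiable (by norm_num)) x
  have h0 : ∀ {f : E2 → ℝ}, ContDiff ℝ 2 f → DifferentiableAt ℝ f x := fun hf =>
    hf.differentiable (by norm_num) x
  have a0 := h0 ha
  have b0 := h0 hb
  have c0 := h0 hc
  have a1 := h1 ha
  have b1 := h1 hb
  have c1 := h1 hc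
  have hdd : DifferentiableAt ℝ (fun y => a y * c y - b y * b y) x := by fun_prop
  have hdp : ∀ i, pd i (fun y => (a y * c y - b y * b y)⁻¹) x =
      -(pd i a x * c x + a x * pd i c x - (pd i b x * b x + b x * pd i b x)) /
        (a x * c x - b x * b x) ^ 2 := by
    intro i
    rw [pd_inv hdd hd, pd_sub (by fun_prop) (by fun_prop), pd_mul a0 c0, pd_mul b0 b0]
  obtain ⟨κ, hκ⟩ : ∃ κ : E2 → ℝ, κ = fun y => (a y * c y - b y * b y)⁻¹ := ⟨_, rfl⟩
  have hκd : DifferentiableAt ℝ κ x := by rw [hκ]; exact hdd.inv hd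
  rw [← hκ] at hdp
  have hκx : κ x = (a x * c x - b x * b x)⁻¹ := by rw [hκ]
  obtain ⟨h, hh⟩ : ∃ h, h = fun y => !![a y, b y; b y, c y] := ⟨_, rfl⟩
  have Γ000 : christoffel h 0 0 0 =
      fun y => κ y * (1 / 2 * (c y * pd 0 a y - b y * (2 * pd 0 b y - pd 1 a y))) := by
    ext y; simp [hh, christoffel, inv_symm2, hκ]; ring
  have Γ001 : christoffel h 0 0 1 =
      fun y => κ y * (1 / 2 * (c y * pd 1 a y - b y * pd 0 c y)) := by
    ext y; simp [hh, christoffel, inv_symm2, hκ]; ring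
  have Γ010 : christoffel h 0 1 0 =
      fun y => κ y * (1 / 2 * (c y * pd 1 a y - b y * pd 0 c y)) := by
    ext y; simp [hh, christoffel, inv_symm2, hκ]; ring
  have Γ011 : christoffel h 0 1 1 =
      fun y => κ y * (1 / 2 * (c y * (2 * pd 1 b y - pd 0 c y) - b y * pd 1 c y)) := by
    ext y; simp [hh, christoffel, inv_symm2, hκ]; ring
  have Γ100 : christoffel h 1 0 0 =
      fun y => κ y * (1 / 2 * (a y * (2 * pd 0 b y - pd 1 a y) - b y * pd 0 a y)) := by
    ext y; simp [hh, christoffel, inv_symm2, hκ]; ring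
  have Γ101 : christoffel h 1 0 1 =
      fun y => κ y * (1 / 2 * (a y * pd 0 c y - b y * pd 1 a y)) := by
    ext y; simp [hh, christoffel, inv_symm2, hκ]; ring
  have Γ110 : christoffel h 1 1 0 =
      fun y => κ y * (1 / 2 * (a y * pd 0 c y - b y * pd 1 a y)) := by
    ext y; simp [hh, christoffel, inv_symm2, hκ]; ring
  have Γ111 : christoffel h 1 1 1 =
      fun y => κ y * (1 / 2 * (a y * pd 1 c y - b y * (2 * pd 1 b y - pd 0 c y))) := by
    ext y; simp [hh, christoffel, inv_symm2, hκ]; ring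
  have hinv : ∀ A B, (h x)⁻¹ A B = κ x * (!![c x, -b x; -b x, a x] : Matrix _ _ ℝ) A B := by
    intro A B; rw [hh, hκx]; exact inv_symm2 A B
  rw [← hh]
  simp only [scalarCurv, ricci, Fin.sum_univ_two, Γ000, Γ001, Γ010, Γ011, Γ100, Γ101, Γ110, Γ111,
    hinv]
  simp (disch := fun_prop) only [pd_mul, pd_sub, pd_const, hdp]
  have s2 : pd 1 (fun y => pd 0 b y) x = pd 0 (fun y => pd 1 b y) x := pd_pd_comm hb.contDiffAt
  obtain ⟨D, hD⟩ : ∃ D, D = a x * c x - b x * b x := ⟨_, rfl⟩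
  rw [← hD] at hd hκx ⊢
  rw [s2, hκx, brioschi]
  simp only [Matrix.of_apply, Matrix.cons_val', Matrix.cons_val_zero, Matrix.cons_val_one,
    Matrix.cons_val_fin_one]
  field_simp
  rw [hD]
  ring

/-- The first component of the vector density whose divergence is the curvature density; see
`frob`. -/
def frob0 (a b c : E2 → ℝ) (x : E2) : ℝ :=
  (√(a x * c x - b x * b x))⁻¹ * (pd 1 b x - pd 0 c x -
    (b x * (pd 1 a x - pd 1 c x) - (a x - c x) * pd 1 b x) *
      (2 * √(a x * c x - b x * b x) - (a x + c x))⁻¹)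

/-- The second component of the vector density whose divergence is the curvature density; see
`frob`. -/
def frob1 (a b c : E2 → ℝ) (x : E2) : ℝ :=
  (√(a x * c x - b x * b x))⁻¹ * (pd 0 b x - pd 1 a x +
    (b x * (pd 0 a x - pd 0 c x) - (a x - c x) * pd 0 b x) *
      (2 * √(a x * c x - b x * b x) - (a x + c x))⁻¹)

/-- The vector density `P` with `∂_A P^A = σ R` for a negative definite metric with the components
`a, b, c`. It is (twice, and up to a rotation by a right angle) the connection form of the
orthonormal frame which arises from the coordinate frame by means of the symmetric square root of
the matrix of the metric. As this square root is compatible with rotations and dilatations, the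
density transforms under conformal changes of coordinates up to a term which does not depend on
the metric. -/
def frob (a b c : E2 → ℝ) (x : E2) : Fin 2 → ℝ := ![frob0 a b c x, frob1 a b c x]

theorem density_mul_scalarCurv {a b c : E2 → ℝ} (ha : ContDiff ℝ 2 a) (hb : ContDiff ℝ 2 b)
    (hc : ContDiff ℝ 2 c) {x : E2} (hd : 0 < a x * c x - b x * b x) (ht : a x + c x < 0) :
    √(a x * c x - b x * b x) * scalarCurv (fun y => !![a y, b y; b y, c y]) x =
      div2 (frob a b c) x := by
  have h1 : ∀ {f : E2 → ℝ}, ContDiff ℝ 2 f → ∀ A, DifferentiableAt ℝ (fun y => pd A f y) x := by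
    intro f hf A
    have : ContDiff ℝ 1 (fderiv ℝ f) := hf.fderiv_right (by norm_num)
    exact ((this.clm_apply contDiff_const).differentiable (by norm_num)) x
  have h0 : ∀ {f : E2 → ℝ}, ContDiff ℝ 2 f → DifferentiableAt ℝ f x := fun hf =>
    hf.differentiable (by norm_num) x
  have a0 := h0 ha
  have b0 := h0 hb
  have c0 := h0 hc
  have a1 := h1 ha
  have b1 := h1 hb
  have c1 := h1 hc
  have hdd : DifferentiableAt ℝ (fun y => a y * c y - b y * b y) x := by fun_prop
  obtain ⟨σ, hσ⟩ : ∃ σ : E2 → ℝ, σ = fun y => √(a y * c y - b y * b y) := ⟨_, rfl⟩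
  have hσd : DifferentiableAt ℝ σ x := by rw [hσ]; exact hdd.sqrt hd.ne'
  have hσ0 : 0 < σ x := by rw [hσ]; exact Real.sqrt_pos.2 hd
  have hσ2 : σ x ^ 2 = a x * c x - b x * b x := by rw [hσ]; exact Real.sq_sqrt hd.le
  have hσp : ∀ i, pd i σ x =
      (pd i a x * c x + a x * pd i c x - (pd i b x * b x + b x * pd i b x)) / (2 * σ x) := by
    intro i
    rw [hσ, pd_sqrt hdd hd.ne', pd_sub (by fun_prop) (by fun_prop), pd_mul a0 c0, pd_mul b0 b0]
  obtain ⟨s, hs⟩ : ∃ s : E2 → ℝ, s = fun y => (σ y)⁻¹ := ⟨_, rfl⟩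
  have hsd : DifferentiableAt ℝ s x := by rw [hs]; exact hσd.inv hσ0.ne'
  have hsp : ∀ i, pd i s x = -pd i σ x / σ x ^ 2 := by
    intro i; rw [hs, pd_inv hσd hσ0.ne']
  have hτ0 : 2 * σ x - (a x + c x) ≠ 0 := by
    have : 0 < 2 * σ x - (a x + c x) := by linarith
    exact this.ne'
  have hτd : DifferentiableAt ℝ (fun y => 2 * σ y - (a y + c y)) x := by fun_prop
  obtain ⟨t, htt⟩ : ∃ t : E2 → ℝ, t = fun y => (2 * σ y - (a y + c y))⁻¹ := ⟨_, rfl⟩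
  have htd : DifferentiableAt ℝ t x := by rw [htt]; exact hτd.inv hτ0
  have htp : ∀ i, pd i t x =
      -(2 * pd i σ x - (pd i a x + pd i c x)) / (2 * σ x - (a x + c x)) ^ 2 := by
    intro i
    rw [htt, pd_inv hτd hτ0, pd_sub (by fun_prop) (by fun_prop), pd_add a0 c0,
      pd_mul (by fun_prop) hσd, pd_const, zero_mul, zero_add]
  have e0 : (fun y => frob a b c y 0) = fun y => s y * (pd 1 b y - pd 0 c y -
      (b y * (pd 1 a y - pd 1 c y) - (a y - c y) * pd 1 b y) * t y) := by
    ext y; simp [frob, frob0, hs, htt, hσ]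
  have e1 : (fun y => frob a b c y 1) = fun y => s y * (pd 0 b y - pd 1 a y +
      (b y * (pd 0 a y - pd 0 c y) - (a y - c y) * pd 0 b y) * t y) := by
    ext y; simp [frob, frob1, hs, htt, hσ]
  have s1 : pd 1 (fun y => pd 0 a y) x = pd 0 (fun y => pd 1 a y) x := pd_pd_comm ha.contDiffAt
  have s2 : pd 1 (fun y => pd 0 b y) x = pd 0 (fun y => pd 1 b y) x := pd_pd_comm hb.contDiffAt
  have s3 : pd 1 (fun y => pd 0 c y) x = pd 0 (fun y => pd 1 c y) x := pd_pd_comm hc.contDiffAt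
  have hσx : √(a x * c x - b x * b x) = σ x := by rw [hσ]
  have hsx : s x = (σ x)⁻¹ := by rw [hs]
  have htx : t x = (2 * σ x - (a x + c x))⁻¹ := by rw [htt]
  rw [scalarCurv_eq ha hb hc hd.ne', hσx, ← hσ2, brioschi]
  simp only [div2, Fin.sum_univ_two, e0, e1]
  simp (disch := fun_prop) only [pd_mul, pd_sub, pd_add, hsp, htp, hσp, s1, s2, s3]
  rw [hsx, htx]
  obtain ⟨τ, hτ⟩ : ∃ τ, τ = 2 * σ x - (a x + c x) := ⟨_, rfl⟩
  rw [← hτ] at hτ0 ⊢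
  field_simp
  rw [hτ]
  -- the two sides are polynomials in `σ`, and equal modulo the relation `σ² = a c - b²`
  linear_combination (norm := (simp only [brioschi]; ring))
    (2 * (-((pd 0 (fun y => pd 1 b y) x - pd 0 (fun y => pd 0 c y) x +
        (pd 0 (fun y => pd 1 b y) x - pd 1 (fun y => pd 1 a y) x)) * (2 * σ x - (a x + c x)) ^ 2 -
      2 * (pd 0 b x * (pd 1 a x - pd 1 c x) - pd 1 b x * (pd 0 a x - pd 0 c x)) *
        (2 * σ x - (a x + c x)) -
      (b x * (pd 1 a x - pd 1 c x) - (a x - c x) * pd 1 b x) * (pd 0 a x + pd 0 c x) +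
      (b x * (pd 0 a x - pd 0 c x) - (a x - c x) * pd 0 b x) * (pd 1 a x + pd 1 c x)) +
    4 * (brioschi (a x) (b x) (c x) (pd 0 a x) (pd 1 a x) (pd 0 b x) (pd 1 b x) (pd 0 c x)
        (pd 1 c x) (pd 1 (fun y => pd 1 a y) x) (pd 0 (fun y => pd 1 b y) x)
        (pd 0 (fun y => pd 0 c y) x) +
      1 / 2 * ((pd 0 a x * c x + a x * pd 0 c x - 2 * b x * pd 0 b x) * (pd 1 b x - pd 0 c x) +
        (pd 1 a x * c x + a x * pd 1 c x - 2 * b x * pd 1 b x) * (pd 0 b x - pd 1 a x)) -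
      (a x * c x - b x * b x) * (pd 0 (fun y => pd 1 b y) x - pd 0 (fun y => pd 0 c y) x +
        (pd 0 (fun y => pd 1 b y) x - pd 1 (fun y => pd 1 a y) x))))) * hσ2

/-- The change of `frob` under the inversion. The last term, which does not depend on the metric, is
the rotation of the coordinate frame of one chart against that of the other; it is what makes the
total curvature a topological invariant. -/
theorem frob_of_inversion {a b c a' b' c' : E2 → ℝ} (ha : ContDiff ℝ 1 a) (hb : ContDiff ℝ 1 b)
    (hc : ContDiff ℝ 1 c)
    (h1 : ∀ x ≠ 0, a' x = jac x 0 0 ^ 2 * a (sinv x) + 2 * jac x 0 0 * jac x 0 1 * b (sinv x) +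
      jac x 0 1 ^ 2 * c (sinv x))
    (h2 : ∀ x ≠ 0, b' x = jac x 0 0 * jac x 0 1 * a (sinv x) +
      (jac x 0 1 ^ 2 - jac x 0 0 ^ 2) * b (sinv x) - jac x 0 0 * jac x 0 1 * c (sinv x))
    (h3 : ∀ x ≠ 0, c' x = jac x 0 1 ^ 2 * a (sinv x) - 2 * jac x 0 0 * jac x 0 1 * b (sinv x) +
      jac x 0 0 ^ 2 * c (sinv x)) {x : E2} (hx : x ≠ 0)
    (hd : 0 < a (sinv x) * c (sinv x) - b (sinv x) * b (sinv x))
    (ht : a (sinv x) + c (sinv x) < 0) (A : Fin 2) :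
    frob a' b' c' x A = jac x A 0 * frob a b c (sinv x) 0 + jac x A 1 * frob a b c (sinv x) 1 +
      (-4) * (x A * (rsq x)⁻¹) := by
  have h0 := rsq_pos hx
  have hs : DifferentiableAt ℝ sinv x := (contDiffAt_sinv hx).differentiableAt (by simp)
  have hda : DifferentiableAt ℝ a (sinv x) := ha.differentiable (by norm_num) _
  have hdb : DifferentiableAt ℝ b (sinv x) := hb.differentiable (by norm_num) _
  have hdc : DifferentiableAt ℝ c (sinv x) := hc.differentiable (by norm_num) _
  obtain ⟨α, hα⟩ : ∃ α : E2 → ℝ, α = fun y => a (sinv y) := ⟨_, rfl⟩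
  obtain ⟨β, hβ⟩ : ∃ β : E2 → ℝ, β = fun y => b (sinv y) := ⟨_, rfl⟩
  obtain ⟨γ, hγ⟩ : ∃ γ : E2 → ℝ, γ = fun y => c (sinv y) := ⟨_, rfl⟩
  obtain ⟨p, hp⟩ : ∃ p : E2 → ℝ, p = fun y => jac y 0 0 := ⟨_, rfl⟩
  obtain ⟨q, hq⟩ : ∃ q : E2 → ℝ, q = fun y => jac y 0 1 := ⟨_, rfl⟩
  have hαd : DifferentiableAt ℝ α x := by rw [hα]; exact DifferentiableAt.comp x hda hs
  have hβd : DifferentiableAt ℝ β x := by rw [hβ]; exact DifferentiableAt.comp x hdb hs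
  have hγd : DifferentiableAt ℝ γ x := by rw [hγ]; exact DifferentiableAt.comp x hdc hs
  have hpd : DifferentiableAt ℝ p x := by rw [hp]; exact differentiableAt_jac hx 0 0
  have hqd : DifferentiableAt ℝ q x := by rw [hq]; exact differentiableAt_jac hx 0 1
  have j10 : jac x 1 0 = q x := by simp [hq, jac]; ring
  have j11 : jac x 1 1 = -p x := by simp [hp, jac, rsq]; ring
  have j00 : jac x 0 0 = p x := by rw [hp]
  have j01 : jac x 0 1 = q x := by rw [hq]
  have hrx : rsq x = x 0 ^ 2 + x 1 ^ 2 := rfl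
  -- with `m = x⁰ / |x|²`, `n = x¹ / |x|²`, the function `p - i q` of `z` is `-1 / z²`, and
  -- `m - i n` is `1 / z`
  obtain ⟨m, hm⟩ : ∃ m, m = x 0 * (rsq x)⁻¹ := ⟨_, rfl⟩
  obtain ⟨n, hn⟩ : ∃ n, n = x 1 * (rsq x)⁻¹ := ⟨_, rfl⟩
  have p0 : pd 0 p x = -2 * (p x * m - q x * n) := by
    rw [hm, hn, ← j00, ← j01, hp, pd_jac hx]; simp [jac]; rw [hrx] at h0 ⊢; field_simp; ring
  have q0 : pd 0 q x = -2 * (p x * n + q x * m) := by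
    rw [hm, hn, ← j00, ← j01, hq, pd_jac hx]; simp [jac]; rw [hrx] at h0 ⊢; field_simp; ring
  have p1 : pd 1 p x = -2 * (p x * n + q x * m) := by
    rw [hm, hn, ← j00, ← j01, hp, pd_jac hx]; simp [jac]; rw [hrx] at h0 ⊢; field_simp; ring
  have q1 : pd 1 q x = 2 * (p x * m - q x * n) := by
    rw [hm, hn, ← j00, ← j01, hq, pd_jac hx]; simp [jac]; rw [hrx] at h0 ⊢; field_simp; ring
  have hne : ∀ᶠ y in nhds x, y ≠ 0 := isOpen_ne.mem_nhds hx
  have ea : a' =ᶠ[nhds x] fun y => p y * p y * α y + 2 * p y * q y * β y + q y * q y * γ y := by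
    filter_upwards [hne] with y hy; rw [h1 y hy, hp, hq, hα, hβ, hγ]; ring
  have eb : b' =ᶠ[nhds x] fun y => p y * q y * α y + (q y * q y - p y * p y) * β y -
      p y * q y * γ y := by
    filter_upwards [hne] with y hy; rw [h2 y hy, hp, hq, hα, hβ, hγ]; ring
  have ec : c' =ᶠ[nhds x] fun y => q y * q y * α y - 2 * p y * q y * β y + p y * p y * γ y := by
    filter_upwards [hne] with y hy; rw [h3 y hy, hp, hq, hα, hβ, hγ]; ring
  have da : ∀ i, pd i a' x = _ := fun i => pd_congr ea
  have db : ∀ i, pd i b' x = _ := fun i => pd_congr eb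
  have dc : ∀ i, pd i c' x = _ := fun i => pd_congr ec
  simp (disch := fun_prop) only [pd_mul, pd_sub, pd_add, pd_const] at da db dc
  have dα : ∀ i, pd i α x = jac x 0 i * pd 0 a (sinv x) + jac x 1 i * pd 1 a (sinv x) := by
    intro i; rw [hα, pd_comp_sinv hx hda]
  have dβ : ∀ i, pd i β x = jac x 0 i * pd 0 b (sinv x) + jac x 1 i * pd 1 b (sinv x) := by
    intro i; rw [hβ, pd_comp_sinv hx hdb]
  have dγ : ∀ i, pd i γ x = jac x 0 i * pd 0 c (sinv x) + jac x 1 i * pd 1 c (sinv x) := by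
    intro i; rw [hγ, pd_comp_sinv hx hdc]
  have va := ea.eq_of_nhds
  have vb := eb.eq_of_nhds
  have vc := ec.eq_of_nhds
  have vα : α x = a (sinv x) := by rw [hα]
  have vβ : β x = b (sinv x) := by rw [hβ]
  have vγ : γ x = c (sinv x) := by rw [hγ]
  simp only [dα, dβ, dγ, vα, vβ, vγ] at da db dc va vb vc
  have hlam : 0 < p x ^ 2 + q x ^ 2 := by
    have : p x ^ 2 + q x ^ 2 = ((rsq x)⁻¹) ^ 2 := by
      rw [← j00, ← j01]; simp [jac]; rw [hrx] at h0 ⊢; field_simp; ring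
    rw [this]; positivity
  have hdet : √(a' x * c' x - b' x * b' x) = (p x ^ 2 + q x ^ 2) *
      √(a (sinv x) * c (sinv x) - b (sinv x) * b (sinv x)) := by
    have : a' x * c' x - b' x * b' x = (p x ^ 2 + q x ^ 2) ^ 2 *
        (a (sinv x) * c (sinv x) - b (sinv x) * b (sinv x)) := by
      rw [va, vb, vc]; ring
    rw [this, Real.sqrt_mul (by positivity), Real.sqrt_sq hlam.le]
  have htr : a' x + c' x = (p x ^ 2 + q x ^ 2) * (a (sinv x) + c (sinv x)) := by
    rw [va, vc]; ring
  have hσ0 := Real.sqrt_pos.2 hd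
  have hσ2 := Real.sq_sqrt hd.le
  obtain ⟨L, hL⟩ : ∃ L, L = p x ^ 2 + q x ^ 2 := ⟨_, rfl⟩
  obtain ⟨σ, hσ⟩ : ∃ σ, σ = √(a (sinv x) * c (sinv x) - b (sinv x) * b (sinv x)) := ⟨_, rfl⟩
  obtain ⟨τ, hτ⟩ : ∃ τ, τ = 2 * σ - (a (sinv x) + c (sinv x)) := ⟨_, rfl⟩
  rw [← hL] at hlam hdet htr
  rw [← hσ] at hσ0 hσ2 hdet
  have hτ0 : 0 < τ := by rw [hτ]; linarith
  have hτN : 2 * (L * σ) - L * (a (sinv x) + c (sinv x)) = L * τ := by rw [hτ]; ring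
  have e0 : frob a' b' c' x 0 = p x * frob a b c (sinv x) 0 + q x * frob a b c (sinv x) 1 +
      (-4) * m := by
    simp only [frob, frob0, frob1, Matrix.cons_val_zero, Matrix.cons_val_one, hdet, htr, ← hσ]
    simp only [da, db, dc, va, vb, vc, p0, p1, q0, q1, j00, j01, j10, j11]
    rw [hτN, ← hτ]
    field_simp
    rw [hτ, hL]
    linear_combination (8 * m * (p x ^ 2 + q x ^ 2) ^ 2) * hσ2
  have e1 : frob a' b' c' x 1 = q x * frob a b c (sinv x) 0 + -p x * frob a b c (sinv x) 1 +
      (-4) * n := by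
    simp only [frob, frob0, frob1, Matrix.cons_val_zero, Matrix.cons_val_one, hdet, htr, ← hσ]
    simp only [da, db, dc, va, vb, vc, p0, p1, q0, q1, j00, j01, j10, j11]
    rw [hτN, ← hτ]
    field_simp
    rw [hτ, hL]
    linear_combination (8 * n * (p x ^ 2 + q x ^ 2) ^ 2) * hσ2
  fin_cases A
  · rw [← j00, ← j01, hm] at e0; exact e0
  · rw [← j11, ← j10, hn] at e1; exact e1

/-! ### Smooth functions of `u`, `r` and the angular coordinates -/

/-- The coordinate domain `(u₀, u₁) × (r₀, ∞) × ℝ²`. -/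
def dom (u₀ u₁ r₀ : ℝ) : Set (ℝ × ℝ × E2) := Set.Ioo u₀ u₁ ×ˢ Set.Ioi r₀ ×ˢ Set.univ

/-- Smoothness of a function of `u`, `r` and the angular coordinates on the coordinate domain. -/
def Sm (u₀ u₁ r₀ : ℝ) (f : ℝ → ℝ → E2 → ℝ) : Prop :=
  ContDiffOn ℝ ∞ (fun z : ℝ × ℝ × E2 => f z.1 z.2.1 z.2.2) (dom u₀ u₁ r₀)

theorem isOpen_dom (u₀ u₁ r₀ : ℝ) : IsOpen (dom u₀ u₁ r₀) :=
  isOpen_Ioo.prod (isOpen_Ioi.prod isOpen_univ)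

theorem mem_dom {u₀ u₁ r₀ u r : ℝ} {x : E2} (hu : u ∈ Set.Ioo u₀ u₁) (hr : r₀ < r) :
    (u, r, x) ∈ dom u₀ u₁ r₀ := ⟨hu, hr, trivial⟩

namespace Sm

variable {u₀ u₁ r₀ : ℝ} {f g : ℝ → ℝ → E2 → ℝ}

theorem add (hf : Sm u₀ u₁ r₀ f) (hg : Sm u₀ u₁ r₀ g) :
    Sm u₀ u₁ r₀ fun u r x => f u r x + g u r x := ContDiffOn.add hf hg

theorem sub (hf : Sm u₀ u₁ r₀ f) (hg : Sm u₀ u₁ r₀ g) :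
    Sm u₀ u₁ r₀ fun u r x => f u r x - g u r x := ContDiffOn.sub hf hg

theorem mul (hf : Sm u₀ u₁ r₀ f) (hg : Sm u₀ u₁ r₀ g) :
    Sm u₀ u₁ r₀ fun u r x => f u r x * g u r x := ContDiffOn.mul hf hg

theorem const (c : ℝ) : Sm u₀ u₁ r₀ fun _ _ _ => c := contDiffOn_const

theorem sum {ι : Type*} {s : Finset ι} {F : ι → ℝ → ℝ → E2 → ℝ}
    (h : ∀ i ∈ s, Sm u₀ u₁ r₀ (F i)) : Sm u₀ u₁ r₀ fun u r x => ∑ i ∈ s, F i u r x :=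
  ContDiffOn.sum h

theorem inv (hf : Sm u₀ u₁ r₀ f)
    (h0 : ∀ u ∈ Set.Ioo u₀ u₁, ∀ r > r₀, ∀ x, f u r x ≠ 0) :
    Sm u₀ u₁ r₀ fun u r x => (f u r x)⁻¹ :=
  ContDiffOn.inv hf fun _ hz => h0 _ hz.1 _ hz.2.1 _

theorem sqrt (hf : Sm u₀ u₁ r₀ f)
    (h0 : ∀ u ∈ Set.Ioo u₀ u₁, ∀ r > r₀, ∀ x, f u r x ≠ 0) :
    Sm u₀ u₁ r₀ fun u r x => √(f u r x) :=
  ContDiffOn.sqrt hf fun _ hz => h0 _ hz.1 _ hz.2.1 _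

theorem log (hf : Sm u₀ u₁ r₀ f)
    (h0 : ∀ u ∈ Set.Ioo u₀ u₁, ∀ r > r₀, ∀ x, f u r x ≠ 0) :
    Sm u₀ u₁ r₀ fun u r x => Real.log (f u r x) :=
  ContDiffOn.log hf fun _ hz => h0 _ hz.1 _ hz.2.1 _

theorem congr (hf : Sm u₀ u₁ r₀ f)
    (h : ∀ u ∈ Set.Ioo u₀ u₁, ∀ r > r₀, ∀ x, g u r x = f u r x) : Sm u₀ u₁ r₀ g :=
  ContDiffOn.congr hf fun _ hz => h _ hz.1 _ hz.2.1 _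

theorem contDiffAt (hf : Sm u₀ u₁ r₀ f) {u r : ℝ} (hu : u ∈ Set.Ioo u₀ u₁) (hr : r₀ < r) (x : E2) :
    ContDiffAt ℝ ∞ (fun z : ℝ × ℝ × E2 => f z.1 z.2.1 z.2.2) (u, r, x) :=
  ContDiffOn.contDiffAt hf ((isOpen_dom _ _ _).mem_nhds (mem_dom hu hr))

theorem hasFDerivAt (hf : Sm u₀ u₁ r₀ f) {u r : ℝ} (hu : u ∈ Set.Ioo u₀ u₁) (hr : r₀ < r) (x : E2) :
    HasFDerivAt (fun z : ℝ × ℝ × E2 => f z.1 z.2.1 z.2.2)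
      (fderiv ℝ (fun z : ℝ × ℝ × E2 => f z.1 z.2.1 z.2.2) (u, r, x)) (u, r, x) :=
  ((hf.contDiffAt hu hr x).differentiableAt (by simp)).hasFDerivAt

theorem hasDerivAt_r_aux (hf : Sm u₀ u₁ r₀ f) {u r : ℝ} (hu : u ∈ Set.Ioo u₀ u₁) (hr : r₀ < r)
    (x : E2) : HasDerivAt (fun r' => f u r' x)
      (fderiv ℝ (fun z : ℝ × ℝ × E2 => f z.1 z.2.1 z.2.2) (u, r, x) (0, 1, 0)) r := by
  have h2 : HasDerivAt (fun r' : ℝ => ((u, r', x) : ℝ × ℝ × E2)) (0, 1, 0) r :=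
    (hasDerivAt_const r u).prodMk ((hasDerivAt_id r).prodMk (hasDerivAt_const r x))
  exact (hf.hasFDerivAt hu hr x).comp_hasDerivAt r h2

theorem hasDerivAt_u_aux (hf : Sm u₀ u₁ r₀ f) {u r : ℝ} (hu : u ∈ Set.Ioo u₀ u₁) (hr : r₀ < r)
    (x : E2) : HasDerivAt (fun u' => f u' r x)
      (fderiv ℝ (fun z : ℝ × ℝ × E2 => f z.1 z.2.1 z.2.2) (u, r, x) (1, 0, 0)) u := by
  have h2 : HasDerivAt (fun u' : ℝ => ((u', r, x) : ℝ × ℝ × E2)) (1, 0, 0) u :=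
    (hasDerivAt_id u).prodMk ((hasDerivAt_const u r).prodMk (hasDerivAt_const u x))
  exact (hf.hasFDerivAt hu hr x).comp_hasDerivAt u h2

theorem hasDerivAt_r (hf : Sm u₀ u₁ r₀ f) {u r : ℝ} (hu : u ∈ Set.Ioo u₀ u₁) (hr : r₀ < r)
    (x : E2) : HasDerivAt (fun r' => f u r' x) (deriv (fun r' => f u r' x) r) r :=
  (hf.hasDerivAt_r_aux hu hr x).differentiableAt.hasDerivAt

theorem hasDerivAt_u (hf : Sm u₀ u₁ r₀ f) {u r : ℝ} (hu : u ∈ Set.Ioo u₀ u₁) (hr : r₀ < r)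
    (x : E2) : HasDerivAt (fun u' => f u' r x) (deriv (fun u' => f u' r x) u) u :=
  (hf.hasDerivAt_u_aux hu hr x).differentiableAt.hasDerivAt

theorem slice (hf : Sm u₀ u₁ r₀ f) {u r : ℝ} (hu : u ∈ Set.Ioo u₀ u₁) (hr : r₀ < r) :
    ContDiff ℝ ∞ (f u r) := by
  rw [contDiff_iff_contDiffAt]
  intro x
  have h2 : ContDiffAt ℝ ∞ (fun y : E2 => ((u, r, y) : ℝ × ℝ × E2)) x := by fun_prop
  exact ContDiffAt.comp (g := fun z : ℝ × ℝ × E2 => f z.1 z.2.1 z.2.2) x (hf.contDiffAt hu hr x) h2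

theorem continuousOn (hf : Sm u₀ u₁ r₀ f) {u : ℝ} (hu : u ∈ Set.Ioo u₀ u₁) :
    ContinuousOn (fun z : ℝ × E2 => f u z.1 z.2) (Set.Ioi r₀ ×ˢ Set.univ) := by
  have h2 : ContinuousOn (fun z : ℝ × E2 => ((u, z.1, z.2) : ℝ × ℝ × E2))
      (Set.Ioi r₀ ×ˢ Set.univ) := by fun_prop
  exact (ContDiffOn.continuousOn hf).comp h2 fun z hz => mem_dom hu hz.1

theorem fderiv_apply (hf : Sm u₀ u₁ r₀ f) (v : ℝ × ℝ × E2) :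
    ContDiffOn ℝ ∞ (fun z => fderiv ℝ (fun z : ℝ × ℝ × E2 => f z.1 z.2.1 z.2.2) z v)
      (dom u₀ u₁ r₀) := by
  have h : ContDiffOn ℝ ∞ (fderiv ℝ (fun z : ℝ × ℝ × E2 => f z.1 z.2.1 z.2.2)) (dom u₀ u₁ r₀) :=
    ContDiffOn.fderiv_of_isOpen hf (isOpen_dom _ _ _) (by simp)
  exact h.clm_apply contDiffOn_const

theorem deriv_r (hf : Sm u₀ u₁ r₀ f) : Sm u₀ u₁ r₀ fun u r x => deriv (fun r' => f u r' x) r :=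
  ContDiffOn.congr (hf.fderiv_apply (0, 1, 0)) fun z hz =>
    (hf.hasDerivAt_r_aux hz.1 hz.2.1 z.2.2).deriv

theorem deriv_u (hf : Sm u₀ u₁ r₀ f) : Sm u₀ u₁ r₀ fun u r x => deriv (fun u' => f u' r x) u :=
  ContDiffOn.congr (hf.fderiv_apply (1, 0, 0)) fun z hz =>
    (hf.hasDerivAt_u_aux hz.1 hz.2.1 z.2.2).deriv

theorem pd (hf : Sm u₀ u₁ r₀ f) (A : Fin 2) : Sm u₀ u₁ r₀ fun u r x => pd A (f u r) x := by
  refine ContDiffOn.congr (hf.fderiv_apply (0, 0, EuclideanSpace.single A 1)) fun z hz => ?_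
  have h2 : HasFDerivAt (fun y : E2 => ((z.1, z.2.1, y) : ℝ × ℝ × E2))
      ((0 : E2 →L[ℝ] ℝ).prod ((0 : E2 →L[ℝ] ℝ).prod (ContinuousLinearMap.id ℝ E2))) z.2.2 :=
    (hasFDerivAt_const _ _).prodMk ((hasFDerivAt_const _ _).prodMk (hasFDerivAt_id _))
  have h3 := ((hf.hasFDerivAt hz.1 hz.2.1 z.2.2).comp z.2.2 h2).fderiv
  simp only [Function.comp_def] at h3
  change fderiv ℝ (f z.1 z.2.1) z.2.2 (EuclideanSpace.single A 1) = _
  exact congrArg (fun L : E2 →L[ℝ] ℝ => L (EuclideanSpace.single A 1)) h3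

end Sm

/-! ### The components of the metric -/

namespace BSMetric

variable {g : BSMetric} {u₀ u₁ r₀ : ℝ}

/-- The component `g_22`. -/
def ha (g : BSMetric) (b : Pole) (u r : ℝ) (x : E2) : ℝ := g.h b u r x 0 0

/-- The component `g_23`. -/
def hb (g : BSMetric) (b : Pole) (u r : ℝ) (x : E2) : ℝ := g.h b u r x 0 1

/-- The component `g_33`. -/
def hc (g : BSMetric) (b : Pole) (u r : ℝ) (x : E2) : ℝ := g.h b u r x 1 1

/-- The determinant `g_22 g_33 - g_23²`. -/
def hd (g : BSMetric) (b : Pole) (u r : ℝ) (x : E2) : ℝ :=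
  g.ha b u r x * g.hc b u r x - g.hb b u r x * g.hb b u r x

/-- The components `ω_A`. -/
def omc (g : BSMetric) (b : Pole) (A : Fin 2) (u r : ℝ) (x : E2) : ℝ := covecComp b (g.om u r) x A

theorem IsRegular.h_eq (hg : g.IsRegular u₀ u₁ r₀) {u r : ℝ} (hu : u ∈ Set.Ioo u₀ u₁) (hr : r₀ < r)
    (b : Pole) (x : E2) :
    g.h b u r x = !![g.ha b u r x, g.hb b u r x; g.hb b u r x, g.hc b u r x] := by
  have hs : g.h b u r x 1 0 = g.h b u r x 0 1 :=
    hg.symm u hu r hr (chart b x) _ _ (frame_tangent b 1 x) (frame_tangent b 0 x)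
  ext A B
  fin_cases A <;> fin_cases B <;> simp [ha, hb, hc, hs]

theorem frame_lincomb_ne_zero (b : Pole) (x : E2) {c d : ℝ} (h : c ≠ 0 ∨ d ≠ 0) :
    c • frame b 0 x + d • frame b 1 x ≠ 0 := by
  intro h0
  have h1 := norm_sq_frame_lincomb b x c d
  rw [h0, norm_zero] at h1
  have h2 : 0 < c ^ 2 + d ^ 2 := by
    rcases h with h | h
    · have := sq_nonneg d; positivity
    · have := sq_nonneg c; positivity
  have h3 := mul_pos (conf_pos x) h2
  rw [← h1] at h3
  norm_num at h3

theorem IsRegular.quad_neg (hg : g.IsRegular u₀ u₁ r₀) {u r : ℝ} (hu : u ∈ Set.Ioo u₀ u₁)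
    (hr : r₀ < r) (b : Pole) (x : E2) {c d : ℝ} (h : c ≠ 0 ∨ d ≠ 0) :
    c ^ 2 * g.ha b u r x + 2 * c * d * g.hb b u r x + d ^ 2 * g.hc b u r x < 0 := by
  have h1 := hg.neg u hu r hr (chart b x) _
    ((frame_tangent b 0 x).lincomb (frame_tangent b 1 x) c d) (frame_lincomb_ne_zero b x h)
  have hs : g.h b u r x 1 0 = g.h b u r x 0 1 :=
    hg.symm u hu r hr (chart b x) _ _ (frame_tangent b 1 x) (frame_tangent b 0 x)
  simp only [BSMetric.h, bilinComp, Matrix.of_apply] at hs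
  simp only [map_add, map_smul, add_apply, smul_apply, smul_eq_mul, hs] at h1
  simp only [ha, hb, hc, BSMetric.h, bilinComp, Matrix.of_apply]
  linarith

theorem IsRegular.ha_neg (hg : g.IsRegular u₀ u₁ r₀) {u r : ℝ} (hu : u ∈ Set.Ioo u₀ u₁)
    (hr : r₀ < r) (b : Pole) (x : E2) : g.ha b u r x < 0 := by
  simpa using hg.quad_neg hu hr b x (c := 1) (d := 0) (by simp)

theorem IsRegular.hc_neg (hg : g.IsRegular u₀ u₁ r₀) {u r : ℝ} (hu : u ∈ Set.Ioo u₀ u₁)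
    (hr : r₀ < r) (b : Pole) (x : E2) : g.hc b u r x < 0 := by
  simpa using hg.quad_neg hu hr b x (c := 0) (d := 1) (by simp)

theorem IsRegular.hd_pos (hg : g.IsRegular u₀ u₁ r₀) {u r : ℝ} (hu : u ∈ Set.Ioo u₀ u₁)
    (hr : r₀ < r) (b : Pole) (x : E2) : 0 < g.hd b u r x := by
  have h1 := hg.ha_neg hu hr b x
  have h2 := hg.quad_neg hu hr b x (c := -g.hb b u r x) (d := g.ha b u r x) (Or.inr h1.ne)
  have h3 : g.ha b u r x * g.hd b u r x < 0 := by rw [hd]; linarith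
  nlinarith

theorem IsRegular.density_eq (hg : g.IsRegular u₀ u₁ r₀) {u r : ℝ} (hu : u ∈ Set.Ioo u₀ u₁)
    (hr : r₀ < r) (b : Pole) (x : E2) : g.density b u r x = √(g.hd b u r x) := by
  rw [density, hg.h_eq hu hr, det_symm2, hd]

theorem IsRegular.density_pos (hg : g.IsRegular u₀ u₁ r₀) {u r : ℝ} (hu : u ∈ Set.Ioo u₀ u₁)
    (hr : r₀ < r) (b : Pole) (x : E2) : 0 < g.density b u r x := by
  rw [hg.density_eq hu hr]; exact Real.sqrt_pos.2 (hg.hd_pos hu hr b x)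

theorem IsRegular.omUp_eq (hg : g.IsRegular u₀ u₁ r₀) {u r : ℝ} (hu : u ∈ Set.Ioo u₀ u₁)
    (hr : r₀ < r) (b : Pole) (x : E2) :
    g.omUp b u r x 0 = (g.hd b u r x)⁻¹ *
        (g.hc b u r x * g.omc b 0 u r x - g.hb b u r x * g.omc b 1 u r x) ∧
      g.omUp b u r x 1 = (g.hd b u r x)⁻¹ *
        (g.ha b u r x * g.omc b 1 u r x - g.hb b u r x * g.omc b 0 u r x) := by
  constructor <;>
  · simp only [omUp, hg.h_eq hu hr, Fin.sum_univ_two, inv_symm2, hd, omc]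
    simp
    ring

theorem IsRegular.sm_ha (hg : g.IsRegular u₀ u₁ r₀) (b : Pole) : Sm u₀ u₁ r₀ (g.ha b) :=
  hg.smooth_ang b 0 0

theorem IsRegular.sm_hb (hg : g.IsRegular u₀ u₁ r₀) (b : Pole) : Sm u₀ u₁ r₀ (g.hb b) :=
  hg.smooth_ang b 0 1

theorem IsRegular.sm_hc (hg : g.IsRegular u₀ u₁ r₀) (b : Pole) : Sm u₀ u₁ r₀ (g.hc b) :=
  hg.smooth_ang b 1 1

theorem IsRegular.sm_omc (hg : g.IsRegular u₀ u₁ r₀) (b : Pole) (A : Fin 2) :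
    Sm u₀ u₁ r₀ (g.omc b A) := hg.smooth_om b A

theorem IsRegular.sm_hd (hg : g.IsRegular u₀ u₁ r₀) (b : Pole) : Sm u₀ u₁ r₀ (g.hd b) :=
  ((hg.sm_ha b).mul (hg.sm_hc b)).sub ((hg.sm_hb b).mul (hg.sm_hb b))

theorem IsRegular.sm_density (hg : g.IsRegular u₀ u₁ r₀) (b : Pole) :
    Sm u₀ u₁ r₀ (g.density b) :=
  ((hg.sm_hd b).sqrt fun _ hu _ hr x => (hg.hd_pos hu hr b x).ne').congr
    fun _ hu _ hr x => hg.density_eq hu hr b x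

theorem IsRegular.sm_omUp (hg : g.IsRegular u₀ u₁ r₀) (b : Pole) (A : Fin 2) :
    Sm u₀ u₁ r₀ (fun u r x => g.omUp b u r x A) := by
  have hi := (hg.sm_hd b).inv fun _ hu _ hr x => (hg.hd_pos hu hr b x).ne'
  fin_cases A
  · exact (hi.mul (((hg.sm_hc b).mul (hg.sm_omc b 0)).sub
      ((hg.sm_hb b).mul (hg.sm_omc b 1)))).congr fun _ hu _ hr x => (hg.omUp_eq hu hr b x).1
  · exact (hi.mul (((hg.sm_ha b).mul (hg.sm_omc b 1)).sub
      ((hg.sm_hb b).mul (hg.sm_omc b 0)))).congr fun _ hu _ hr x => (hg.omUp_eq hu hr b x).2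

theorem IsRegular.sm_g11Up (hg : g.IsRegular u₀ u₁ r₀) (b : Pole) :
    Sm u₀ u₁ r₀ (fun u r x => g.g11Up b u r x) := by
  have h0 : Sm u₀ u₁ r₀ (fun u r x => g.g00 u r (chart b x)) := hg.smooth_g00 b
  unfold g11Up
  exact (Sm.sum fun A _ => (hg.sm_omUp b A).mul (hg.sm_omc b A)).sub h0

/-- The vector density `σ ω^A`. -/
def omDens (g : BSMetric) (b : Pole) (u r : ℝ) (x : E2) (A : Fin 2) : ℝ :=
  g.density b u r x * g.omUp b u r x A

/-- The vector density `σ ω^A_{,r}`. -/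
def omRDens (g : BSMetric) (b : Pole) (u r : ℝ) (x : E2) (A : Fin 2) : ℝ :=
  g.density b u r x * deriv (fun r' => g.omUp b u r' x A) r

theorem IsRegular.sm_omDens (hg : g.IsRegular u₀ u₁ r₀) (b : Pole) (A : Fin 2) :
    Sm u₀ u₁ r₀ (fun u r x => g.omDens b u r x A) :=
  (hg.sm_density b).mul (hg.sm_omUp b A)

theorem IsRegular.sm_omRDens (hg : g.IsRegular u₀ u₁ r₀) (b : Pole) (A : Fin 2) :
    Sm u₀ u₁ r₀ (fun u r x => g.omRDens b u r x A) :=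
  (hg.sm_density b).mul (hg.sm_omUp b A).deriv_r

/-- The vector density whose divergence is `σ R⁽²⁾`. -/
def curvDens (g : BSMetric) (b : Pole) (u r : ℝ) : E2 → Fin 2 → ℝ :=
  frob (g.ha b u r) (g.hb b u r) (g.hc b u r)

theorem IsRegular.sm_curvDens (hg : g.IsRegular u₀ u₁ r₀) (b : Pole) (A : Fin 2) :
    Sm u₀ u₁ r₀ (fun u r x => g.curvDens b u r x A) := by
  have ha := hg.sm_ha b
  have hb := hg.sm_hb b
  have hc := hg.sm_hc b
  have hs : Sm u₀ u₁ r₀ (fun u r x => √(g.hd b u r x)) :=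
    (hg.sm_hd b).sqrt fun _ hu _ hr x => (hg.hd_pos hu hr b x).ne'
  have hs' := hs.inv fun _ hu _ hr x => (Real.sqrt_pos.2 (hg.hd_pos hu hr b x)).ne'
  have ht := (((Sm.const 2).mul hs).sub (ha.add hc)).inv fun u hu r hr x => by
    have h1 := hg.ha_neg hu hr b x
    have h2 := hg.hc_neg hu hr b x
    have h3 := Real.sqrt_nonneg (g.hd b u r x)
    have : 0 < 2 * √(g.hd b u r x) - (g.ha b u r x + g.hc b u r x) := by linarith
    exact this.ne'
  fin_cases A
  · exact hs'.mul (((hb.pd 1).sub (hc.pd 0)).sub (((hb.mul ((ha.pd 1).sub (hc.pd 1))).sub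
      ((ha.sub hc).mul (hb.pd 1))).mul ht))
  · exact hs'.mul (((hb.pd 0).sub (ha.pd 1)).add (((hb.mul ((ha.pd 0).sub (hc.pd 0))).sub
      ((ha.sub hc).mul (hb.pd 0))).mul ht))

end BSMetric

/-! ### Change of the chart -/

theorem jac_one_zero (x : E2) : jac x 1 0 = jac x 0 1 := by simp [jac]; ring

theorem jac_one_one (x : E2) : jac x 1 1 = -jac x 0 0 := by
  simp only [jac, rsq]; simp; ring

theorem jac_sq {x : E2} (hx : x ≠ 0) : jac x 0 0 ^ 2 + jac x 0 1 ^ 2 = ((rsq x)⁻¹) ^ 2 := by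
  have h0 := rsq_pos hx
  have hrx : rsq x = x 0 ^ 2 + x 1 ^ 2 := rfl
  simp [jac]
  rw [hrx] at h0 ⊢
  field_simp
  ring

theorem covecComp_transform (b : Pole) (w : S2 → Covec) {x : E2} (hx : x ≠ 0) (A : Fin 2) :
    covecComp b w x A = jac x 0 A * covecComp b.other w (sinv x) 0 +
      jac x 1 A * covecComp b.other w (sinv x) 1 := by
  simp only [covecComp, frame_transform b hx, chart_sinv b hx, map_add, map_smul, smul_eq_mul]

theorem bilinComp_transform (b : Pole) (w : S2 → Bilin) {x : E2} (hx : x ≠ 0) (A B : Fin 2) :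
    bilinComp b w x A B =
      jac x 0 A * (jac x 0 B * bilinComp b.other w (sinv x) 0 0 +
        jac x 1 B * bilinComp b.other w (sinv x) 0 1) +
      jac x 1 A * (jac x 0 B * bilinComp b.other w (sinv x) 1 0 +
        jac x 1 B * bilinComp b.other w (sinv x) 1 1) := by
  simp only [bilinComp, Matrix.of_apply, frame_transform b hx, chart_sinv b hx, map_add, map_smul,
    add_apply, smul_apply, smul_eq_mul]
  ring

namespace BSMetric

variable {g : BSMetric} {u₀ u₁ r₀ u r : ℝ}

theorem omc_transform (b : Pole) {x : E2} (hx : x ≠ 0) :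
    g.omc b 0 u r x = jac x 0 0 * g.omc b.other 0 u r (sinv x) +
        jac x 0 1 * g.omc b.other 1 u r (sinv x) ∧
      g.omc b 1 u r x = jac x 0 1 * g.omc b.other 0 u r (sinv x) -
        jac x 0 0 * g.omc b.other 1 u r (sinv x) := by
  constructor
  · simp only [omc, covecComp_transform b _ hx, jac_one_zero]
  · simp only [omc, covecComp_transform b _ hx, jac_one_one]; ring

theorem IsRegular.h_transform (hg : g.IsRegular u₀ u₁ r₀) (hu : u ∈ Set.Ioo u₀ u₁) (hr : r₀ < r)
    (b : Pole) {x : E2} (hx : x ≠ 0) :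
    g.ha b u r x = jac x 0 0 ^ 2 * g.ha b.other u r (sinv x) +
        2 * jac x 0 0 * jac x 0 1 * g.hb b.other u r (sinv x) +
        jac x 0 1 ^ 2 * g.hc b.other u r (sinv x) ∧
      g.hb b u r x = jac x 0 0 * jac x 0 1 * g.ha b.other u r (sinv x) +
        (jac x 0 1 ^ 2 - jac x 0 0 ^ 2) * g.hb b.other u r (sinv x) -
        jac x 0 0 * jac x 0 1 * g.hc b.other u r (sinv x) ∧
      g.hc b u r x = jac x 0 1 ^ 2 * g.ha b.other u r (sinv x) -
        2 * jac x 0 0 * jac x 0 1 * g.hb b.other u r (sinv x) +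
        jac x 0 0 ^ 2 * g.hc b.other u r (sinv x) := by
  have hs : g.h b.other u r (sinv x) 1 0 = g.h b.other u r (sinv x) 0 1 := by
    rw [hg.h_eq hu hr]; simp
  simp only [h] at hs
  refine ⟨?_, ?_, ?_⟩ <;>
  · simp only [ha, hb, hc, h, bilinComp_transform b _ hx, hs, jac_one_zero, jac_one_one]
    ring

theorem IsRegular.hd_transform (hg : g.IsRegular u₀ u₁ r₀) (hu : u ∈ Set.Ioo u₀ u₁) (hr : r₀ < r)
    (b : Pole) {x : E2} (hx : x ≠ 0) :
    g.hd b u r x = (((rsq x)⁻¹) ^ 2) ^ 2 * g.hd b.other u r (sinv x) := by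
  obtain ⟨h1, h2, h3⟩ := hg.h_transform hu hr b hx
  rw [← jac_sq hx, hd, hd, h1, h2, h3]
  ring

theorem IsRegular.density_transform (hg : g.IsRegular u₀ u₁ r₀) (hu : u ∈ Set.Ioo u₀ u₁)
    (hr : r₀ < r) (b : Pole) {x : E2} (hx : x ≠ 0) :
    g.density b u r x = ((rsq x)⁻¹) ^ 2 * g.density b.other u r (sinv x) := by
  rw [hg.density_eq hu hr, hg.density_eq hu hr, hg.hd_transform hu hr b hx,
    Real.sqrt_mul (by positivity), Real.sqrt_sq (by positivity)]

theorem IsRegular.omUp_transform (hg : g.IsRegular u₀ u₁ r₀) (hu : u ∈ Set.Ioo u₀ u₁)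
    (hr : r₀ < r) (b : Pole) {x : E2} (hx : x ≠ 0) (A : Fin 2) :
    g.omUp b u r x A = rsq x ^ 2 * (jac x A 0 * g.omUp b.other u r (sinv x) 0 +
      jac x A 1 * g.omUp b.other u r (sinv x) 1) := by
  have h0 := rsq_pos hx
  obtain ⟨h1, h2, h3⟩ := hg.h_transform hu hr b hx
  obtain ⟨w0, w1⟩ := omc_transform (g := g) (u := u) (r := r) b hx
  obtain ⟨e0, e1⟩ := hg.omUp_eq hu hr b x
  obtain ⟨f0, f1⟩ := hg.omUp_eq hu hr b.other (sinv x)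
  have hj := jac_sq hx
  have hρ : (((rsq x)⁻¹ ^ 2) ^ 2)⁻¹ * (jac x 0 0 ^ 2 + jac x 0 1 ^ 2) = rsq x ^ 2 := by
    rw [hj]; field_simp
  fin_cases A
  · simp only [Fin.zero_eta]
    rw [e0, f0, f1, hg.hd_transform hu hr b hx, h3, h2, w0, w1, ← hρ, mul_inv]
    ring
  · simp only [Fin.mk_one]
    rw [e1, f0, f1, hg.hd_transform hu hr b hx, h1, h2, w0, w1, ← hρ, mul_inv, jac_one_zero,
      jac_one_one]
    ring

theorem IsRegular.g11Up_transform (hg : g.IsRegular u₀ u₁ r₀) (hu : u ∈ Set.Ioo u₀ u₁)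
    (hr : r₀ < r) (b : Pole) {x : E2} (hx : x ≠ 0) :
    g.g11Up b u r x = g.g11Up b.other u r (sinv x) := by
  have h0 := rsq_pos hx
  obtain ⟨w0, w1⟩ := omc_transform (g := g) (u := u) (r := r) b hx
  have hρ : rsq x ^ 2 * (jac x 0 0 ^ 2 + jac x 0 1 ^ 2) = 1 := by
    rw [jac_sq hx]; field_simp
  simp only [omc] at w0 w1
  simp only [g11Up, Fin.sum_univ_two, hg.omUp_transform hu hr b hx, w0, w1, jac_one_zero,
    jac_one_one, chart_sinv b hx]
  linear_combination (g.omUp b.other u r (sinv x) 0 * covecComp b.other (g.om u r) (sinv x) 0 +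
    g.omUp b.other u r (sinv x) 1 * covecComp b.other (g.om u r) (sinv x) 1) * hρ

theorem IsRegular.omDens_transform (hg : g.IsRegular u₀ u₁ r₀) (hu : u ∈ Set.Ioo u₀ u₁)
    (hr : r₀ < r) (b : Pole) {x : E2} (hx : x ≠ 0) (A : Fin 2) :
    g.omDens b u r x A = jac x A 0 * g.omDens b.other u r (sinv x) 0 +
      jac x A 1 * g.omDens b.other u r (sinv x) 1 := by
  have h0 := rsq_pos hx
  simp only [omDens, hg.density_transform hu hr b hx, hg.omUp_transform hu hr b hx A]
  field_simp

theorem IsRegular.omRDens_transform (hg : g.IsRegular u₀ u₁ r₀) (hu : u ∈ Set.Ioo u₀ u₁)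
    (hr : r₀ < r) (b : Pole) {x : E2} (hx : x ≠ 0) (A : Fin 2) :
    g.omRDens b u r x A = jac x A 0 * g.omRDens b.other u r (sinv x) 0 +
      jac x A 1 * g.omRDens b.other u r (sinv x) 1 := by
  have h0 := rsq_pos hx
  have hd : deriv (fun r' => g.omUp b u r' x A) r = rsq x ^ 2 *
      (jac x A 0 * deriv (fun r' => g.omUp b.other u r' (sinv x) 0) r +
        jac x A 1 * deriv (fun r' => g.omUp b.other u r' (sinv x) 1) r) := by
    have he : (fun r' => g.omUp b u r' x A) =ᶠ[𝓝 r] fun r' => rsq x ^ 2 *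
        (jac x A 0 * g.omUp b.other u r' (sinv x) 0 +
          jac x A 1 * g.omUp b.other u r' (sinv x) 1) := by
      filter_upwards [Ioi_mem_nhds hr] with r' hr'
      exact hg.omUp_transform hu hr' b hx A
    rw [he.deriv_eq]
    exact ((((hg.sm_omUp b.other 0).hasDerivAt_r hu hr (sinv x)).const_mul _).add
      (((hg.sm_omUp b.other 1).hasDerivAt_r hu hr (sinv x)).const_mul _)).const_mul _ |>.deriv
  simp only [omRDens, hg.density_transform hu hr b hx, hd]
  field_simp

theorem IsRegular.curvDens_transform (hg : g.IsRegular u₀ u₁ r₀) (hu : u ∈ Set.Ioo u₀ u₁)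
    (hr : r₀ < r) (b : Pole) {x : E2} (hx : x ≠ 0) (A : Fin 2) :
    g.curvDens b u r x A = jac x A 0 * g.curvDens b.other u r (sinv x) 0 +
      jac x A 1 * g.curvDens b.other u r (sinv x) 1 + (-4) * (x A * (rsq x)⁻¹) := by
  have h1 : (1 : ℕ∞ω) ≤ ∞ := by simp
  refine frob_of_inversion (((hg.sm_ha b.other).slice hu hr).of_le h1)
    (((hg.sm_hb b.other).slice hu hr).of_le h1) (((hg.sm_hc b.other).slice hu hr).of_le h1)
    (fun y hy => (hg.h_transform hu hr b hy).1) (fun y hy => (hg.h_transform hu hr b hy).2.1)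
    (fun y hy => (hg.h_transform hu hr b hy).2.2) hx (hg.hd_pos hu hr b.other (sinv x)) ?_ A
  have h2 := hg.ha_neg hu hr b.other (sinv x)
  have h3 := hg.hc_neg hu hr b.other (sinv x)
  linarith

/-- The density `g¹¹ σ_{,r} + 2 σ_{,u}`, which differs from `σ θ₋` by a divergence. -/
def expDens (g : BSMetric) (b : Pole) (u r : ℝ) (x : E2) : ℝ :=
  g.g11Up b u r x * deriv (fun r' => g.density b u r' x) r +
    2 * deriv (fun u' => g.density b u' r x) u

theorem IsRegular.sm_expDens (hg : g.IsRegular u₀ u₁ r₀) (b : Pole) :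
    Sm u₀ u₁ r₀ (g.expDens b) :=
  ((hg.sm_g11Up b).mul (hg.sm_density b).deriv_r).add ((Sm.const 2).mul (hg.sm_density b).deriv_u)

theorem IsRegular.expDens_transform (hg : g.IsRegular u₀ u₁ r₀) (hu : u ∈ Set.Ioo u₀ u₁)
    (hr : r₀ < r) (b : Pole) {x : E2} (hx : x ≠ 0) :
    g.expDens b u r x = ((rsq x)⁻¹) ^ 2 * g.expDens b.other u r (sinv x) := by
  have h1 : deriv (fun r' => g.density b u r' x) r =
      ((rsq x)⁻¹) ^ 2 * deriv (fun r' => g.density b.other u r' (sinv x)) r := by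
    have he : (fun r' => g.density b u r' x) =ᶠ[𝓝 r]
        fun r' => ((rsq x)⁻¹) ^ 2 * g.density b.other u r' (sinv x) := by
      filter_upwards [Ioi_mem_nhds hr] with r' hr'
      exact hg.density_transform hu hr' b hx
    rw [he.deriv_eq]
    exact (((hg.sm_density b.other).hasDerivAt_r hu hr (sinv x)).const_mul _).deriv
  have h2 : deriv (fun u' => g.density b u' r x) u =
      ((rsq x)⁻¹) ^ 2 * deriv (fun u' => g.density b.other u' r (sinv x)) u := by
    have he : (fun u' => g.density b u' r x) =ᶠ[𝓝 u]
        fun u' => ((rsq x)⁻¹) ^ 2 * g.density b.other u' r (sinv x) := by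
      filter_upwards [isOpen_Ioo.mem_nhds hu] with u' hu'
      exact hg.density_transform hu' hr b hx
    rw [he.deriv_eq]
    exact (((hg.sm_density b.other).hasDerivAt_u hu hr (sinv x)).const_mul _).deriv
  rw [expDens, expDens, h1, h2, hg.g11Up_transform hu hr b hx]
  ring

end BSMetric

/-- A continuous density on the sphere is integrable. -/
theorem integrable_of_inversion {f f' : E2 → ℝ} (hf : Continuous f) (hf' : Continuous f')
    (h : ∀ x ≠ 0, f x = ((rsq x)⁻¹) ^ 2 * f' (sinv x)) : Integrable f := by
  obtain ⟨C, -, hC⟩ := exists_decay_bound (α := Unit) (K := Set.univ) isCompact_univ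
    (f := fun _ => f) (g := fun _ => f') (hf.comp continuous_snd).continuousOn
    (hf'.comp continuous_snd).continuousOn 2 (by
      intro _ _ x hx
      rw [h x hx, abs_mul, abs_of_nonneg (by positivity)])
  exact integrable_of_le_decay hf fun x => hC () trivial x

namespace BSMetric

variable {g : BSMetric} {u₀ u₁ r₀ u r : ℝ}

theorem IsRegular.integrable_density (hg : g.IsRegular u₀ u₁ r₀) (hu : u ∈ Set.Ioo u₀ u₁)
    (hr : r₀ < r) (b : Pole) : Integrable (g.density b u r) :=
  integrable_of_inversion ((hg.sm_density b).slice hu hr).continuous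
    ((hg.sm_density b.other).slice hu hr).continuous fun _ hx => hg.density_transform hu hr b hx

theorem IsRegular.integrable_expDens (hg : g.IsRegular u₀ u₁ r₀) (hu : u ∈ Set.Ioo u₀ u₁)
    (hr : r₀ < r) (b : Pole) : Integrable (g.expDens b u r) :=
  integrable_of_inversion ((hg.sm_expDens b).slice hu hr).continuous
    ((hg.sm_expDens b.other).slice hu hr).continuous fun _ hx => hg.expDens_transform hu hr b hx

theorem Sm.slice_one {f : ℝ → ℝ → E2 → ℝ} (hf : Sm u₀ u₁ r₀ f) (hu : u ∈ Set.Ioo u₀ u₁)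
    (hr : r₀ < r) : ContDiff ℝ 1 (f u r) := (hf.slice hu hr).of_le (by simp)

theorem IsRegular.integrable_div2_omDens (hg : g.IsRegular u₀ u₁ r₀) (hu : u ∈ Set.Ioo u₀ u₁)
    (hr : r₀ < r) (b : Pole) : Integrable (div2 (g.omDens b u r)) :=
  integrable_div2_of_inversion (k := 0) (fun A => Sm.slice_one (hg.sm_omDens b A) hu hr)
    (fun A => Sm.slice_one (hg.sm_omDens b.other A) hu hr)
    (fun _ hx A => by rw [hg.omDens_transform hu hr b hx A]; ring)

theorem IsRegular.integral_div2_omDens (hg : g.IsRegular u₀ u₁ r₀) (hu : u ∈ Set.Ioo u₀ u₁)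
    (hr : r₀ < r) (b : Pole) : ∫ x, div2 (g.omDens b u r) x = 0 := by
  rw [integral_div2_of_inversion (k := 0) (fun A => Sm.slice_one (hg.sm_omDens b A) hu hr)
    (fun A => Sm.slice_one (hg.sm_omDens b.other A) hu hr)
    (fun _ hx A => by rw [hg.omDens_transform hu hr b hx A]; ring), mul_zero]

/-- The vector density whose divergence is the part of `(σ θ₋)_{,r}` which does not depend on the
matter: `∂_A` of it is `σ R⁽²⁾ - σ (ω^A_{,r})_{|A}`. -/
def sourceDens (g : BSMetric) (b : Pole) (u r : ℝ) (x : E2) (A : Fin 2) : ℝ :=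
  g.curvDens b u r x A - g.omRDens b u r x A

theorem IsRegular.sm_sourceDens (hg : g.IsRegular u₀ u₁ r₀) (b : Pole) (A : Fin 2) :
    Sm u₀ u₁ r₀ (fun u r x => g.sourceDens b u r x A) :=
  (hg.sm_curvDens b A).sub (hg.sm_omRDens b A)

theorem IsRegular.sourceDens_transform (hg : g.IsRegular u₀ u₁ r₀) (hu : u ∈ Set.Ioo u₀ u₁)
    (hr : r₀ < r) (b : Pole) {x : E2} (hx : x ≠ 0) (A : Fin 2) :
    g.sourceDens b u r x A = jac x A 0 * g.sourceDens b.other u r (sinv x) 0 +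
      jac x A 1 * g.sourceDens b.other u r (sinv x) 1 + (-4) * (x A * (rsq x)⁻¹) := by
  simp only [sourceDens, hg.curvDens_transform hu hr b hx A, hg.omRDens_transform hu hr b hx A]
  ring

/-- The Gauss–Bonnet theorem, together with the divergence theorem. The sign is due to the metric
`g_AB` being negative definite. -/
theorem IsRegular.integral_div2_sourceDens (hg : g.IsRegular u₀ u₁ r₀) (hu : u ∈ Set.Ioo u₀ u₁)
    (hr : r₀ < r) (b : Pole) : ∫ x, div2 (g.sourceDens b u r) x = -(8 * Real.pi) := by
  rw [integral_div2_of_inversion (fun A => Sm.slice_one (hg.sm_sourceDens b A) hu hr)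
    (fun A => Sm.slice_one (hg.sm_sourceDens b.other A) hu hr)
    (fun _ hx A => hg.sourceDens_transform hu hr b hx A)]
  ring

theorem IsRegular.sm_div2_sourceDens (hg : g.IsRegular u₀ u₁ r₀) (b : Pole) :
    Sm u₀ u₁ r₀ (fun u r x => div2 (g.sourceDens b u r) x) :=
  Sm.sum fun A _ => (hg.sm_sourceDens b A).pd A

theorem IsRegular.div2_sourceDens_bound (hg : g.IsRegular u₀ u₁ r₀) (hu : u ∈ Set.Ioo u₀ u₁)
    {r₁ r₂ : ℝ} (hr : r₀ < r₁) (b : Pole) :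
    ∃ C, ∀ r ∈ Set.Icc r₁ r₂, ∀ x, |div2 (g.sourceDens b u r) x| ≤ C * ((1 + rsq x)⁻¹) ^ 2 := by
  have hsub : Set.Icc r₁ r₂ ×ˢ (Set.univ : Set E2) ⊆ Set.Ioi r₀ ×ˢ Set.univ :=
    Set.prod_mono_left fun s hs => lt_of_lt_of_le hr hs.1
  obtain ⟨C, -, hC⟩ := exists_decay_bound (isCompact_Icc (a := r₁) (b := r₂))
    (f := fun s x => div2 (g.sourceDens b u s) x) (g := fun s x => div2 (g.sourceDens b.other u s) x)
    (((hg.sm_div2_sourceDens b).continuousOn hu).mono hsub)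
    (((hg.sm_div2_sourceDens b.other).continuousOn hu).mono hsub) 2 (by
      intro s hs x hx
      have hs' : r₀ < s := lt_of_lt_of_le hr hs.1
      rw [div2_of_inversion (fun A => Sm.slice_one (hg.sm_sourceDens b.other A) hu hs')
        (fun _ hx A => hg.sourceDens_transform hu hs' b hx A) hx, abs_mul,
        abs_of_nonneg (by positivity)])
  exact ⟨C, hC⟩

/-- `σ θ₋ = g¹¹ σ_{,r} + 2 σ_{,u} - 2 ∂_A (σ ω^A)`. -/
theorem IsRegular.density_mul_thetaMinus (hg : g.IsRegular u₀ u₁ r₀) (hu : u ∈ Set.Ioo u₀ u₁)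
    (hr : r₀ < r) (b : Pole) (x : E2) :
    g.density b u r x * g.thetaMinus b u r x =
      g.expDens b u r x - 2 * div2 (g.omDens b u r) x := by
  have hσ := hg.density_pos hu hr b x
  have h1 : deriv (fun r' => Real.log (g.density b u r' x)) r =
      deriv (fun r' => g.density b u r' x) r / g.density b u r x :=
    (((hg.sm_density b).hasDerivAt_r hu hr x).log hσ.ne').deriv
  have h2 : deriv (fun u' => Real.log (g.density b u' r x)) u =
      deriv (fun u' => g.density b u' r x) u / g.density b u r x :=
    (((hg.sm_density b).hasDerivAt_u hu hr x).log hσ.ne').deriv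
  have hdiff : ∀ {f : ℝ → ℝ → E2 → ℝ}, Sm u₀ u₁ r₀ f → DifferentiableAt ℝ (f u r) x := fun hf =>
    (hf.slice hu hr).differentiable (by simp) x
  have h3 : g.density b u r x * divergence (g.h b u r) (g.omUp b u r) x =
      div2 (g.omDens b u r) x := by
    have hh : g.h b u r = fun y => !![g.ha b u r y, g.hb b u r y; g.hb b u r y, g.hc b u r y] :=
      funext fun y => hg.h_eq hu hr b y
    have hD : g.omDens b u r = fun y A =>
        √(g.ha b u r y * g.hc b u r y - g.hb b u r y * g.hb b u r y) * g.omUp b u r y A := by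
      ext y A
      rw [omDens, hg.density_eq hu hr, hd]
    rw [hh, hD, hg.density_eq hu hr, hd]
    exact density_mul_divergence (hdiff (hg.sm_ha b)) (hdiff (hg.sm_hb b)) (hdiff (hg.sm_hc b))
      (fun A => hdiff (hg.sm_omUp b A)) (hg.hd_pos hu hr b x)
  rw [thetaMinus, h1, h2, ← h3, expDens]
  field_simp

theorem IsRegular.density_mul_source (hg : g.IsRegular u₀ u₁ r₀) (hu : u ∈ Set.Ioo u₀ u₁)
    (hr : r₀ < r) (b : Pole) (x : E2) :
    g.density b u r x * (scalarCurv (g.h b u r) x -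
      divergence (g.h b u r) (fun y A => deriv (fun r' => g.omUp b u r' y A) r) x) =
      div2 (g.sourceDens b u r) x := by
  have hdiff : ∀ {f : ℝ → ℝ → E2 → ℝ}, Sm u₀ u₁ r₀ f → DifferentiableAt ℝ (f u r) x := fun hf =>
    (hf.slice hu hr).differentiable (by simp) x
  have hC2 : ∀ {f : ℝ → ℝ → E2 → ℝ}, Sm u₀ u₁ r₀ f → ContDiff ℝ 2 (f u r) := fun hf =>
    contDiff_infty.1 (hf.slice hu hr) 2
  have hh : g.h b u r = fun y => !![g.ha b u r y, g.hb b u r y; g.hb b u r y, g.hc b u r y] :=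
    funext fun y => hg.h_eq hu hr b y
  have hD : g.omRDens b u r = fun y A =>
      √(g.ha b u r y * g.hc b u r y - g.hb b u r y * g.hb b u r y) *
        deriv (fun r' => g.omUp b u r' y A) r := by
    ext y A
    rw [omRDens, hg.density_eq hu hr, hd]
  have h1 := density_mul_divergence (hdiff (hg.sm_ha b)) (hdiff (hg.sm_hb b))
    (hdiff (hg.sm_hc b)) (fun A => hdiff (hg.sm_omUp b A).deriv_r) (hg.hd_pos hu hr b x)
  rw [← hD, ← hh] at h1
  have ht : g.ha b u r x + g.hc b u r x < 0 := by
    have h2 := hg.ha_neg hu hr b x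
    have h3 := hg.hc_neg hu hr b x
    linarith
  have h2 := density_mul_scalarCurv (hC2 (hg.sm_ha b)) (hC2 (hg.sm_hb b))
    (hC2 (hg.sm_hc b)) (hg.hd_pos hu hr b x) ht
  rw [← hh] at h2
  have h3 : div2 (g.sourceDens b u r) x = div2 (g.curvDens b u r) x - div2 (g.omRDens b u r) x := by
    simp only [div2]
    rw [← Finset.sum_sub_distrib]
    exact Finset.sum_congr rfl fun A _ =>
      pd_sub (hdiff (hg.sm_curvDens b A)) (hdiff (hg.sm_omRDens b A))
  rw [h3, ← h1, hg.density_eq hu hr, hd, mul_sub, h2]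
  rfl

theorem IsRegular.sm_density_mul_thetaMinus (hg : g.IsRegular u₀ u₁ r₀) (b : Pole) :
    Sm u₀ u₁ r₀ (fun u r x => g.density b u r x * g.thetaMinus b u r x) :=
  ((hg.sm_expDens b).sub ((Sm.const 2).mul (Sm.sum fun A _ => (hg.sm_omDens b A).pd A))).congr
    fun _ hu _ hr x => hg.density_mul_thetaMinus hu hr b x

theorem IsRegular.integrable_density_mul_thetaMinus (hg : g.IsRegular u₀ u₁ r₀)
    (hu : u ∈ Set.Ioo u₀ u₁) (hr : r₀ < r) (b : Pole) :
    Integrable (fun x => g.density b u r x * g.thetaMinus b u r x) := by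
  simp only [hg.density_mul_thetaMinus hu hr b]
  exact (hg.integrable_expDens hu hr b).sub ((hg.integrable_div2_omDens hu hr b).const_mul 2)

theorem IsRegular.intThetaMinus_eq (hg : g.IsRegular u₀ u₁ r₀)
    (hu : u ∈ Set.Ioo u₀ u₁) (hr : r₀ < r) :
    g.intThetaMinus u r = ∫ x, g.expDens Pole.north u r x := by
  simp only [intThetaMinus, hg.density_mul_thetaMinus hu hr Pole.north]
  rw [integral_sub (hg.integrable_expDens hu hr _)
    ((hg.integrable_div2_omDens hu hr _).const_mul 2), integral_const_mul,
    hg.integral_div2_omDens hu hr, mul_zero, sub_zero]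

end BSMetric

/-! ### The dominant energy condition -/

/-- By continuity the dominant energy condition extends to limits of future directed timelike
vectors. -/
theorem DominantEnergy.nonneg_of_limit {g : BSMetric} {T : Tensor4} {u r : ℝ} {p : S2}
    (hT : DominantEnergy g T u r p) {v v' w w' : ℝ × ℝ × E3}
    (hv : ∀ᶠ ε : ℝ in 𝓝[>] 0, g.IsFutureTimelike u r p (v + ε • v'))
    (hw : ∀ᶠ ε : ℝ in 𝓝[>] 0, g.IsFutureTimelike u r p (w + ε • w')) :
    0 ≤ T u r p v w := by
  have hc : Continuous fun ε : ℝ => T u r p (v + ε • v') (w + ε • w') := by fun_prop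
  have hl : Tendsto (fun ε : ℝ => T u r p (v + ε • v') (w + ε • w')) (𝓝[>] 0)
      (𝓝 (T u r p v w)) := by
    have := (hc.tendsto 0).mono_left (nhdsWithin_le_nhds (s := Set.Ioi 0))
    simpa using this
  refine ge_of_tendsto hl ?_
  filter_upwards [hv, hw] with ε h1 h2
  exact hT _ _ h1 h2

/-- The null vector `∂_r` is a limit of future directed timelike vectors. -/
theorem BSMetric.isFutureTimelike_outgoing (g : BSMetric) (u r : ℝ) (p : S2) :
    ∀ᶠ ε : ℝ in 𝓝[>] 0, g.IsFutureTimelike u r p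
      (((0, 1, 0) : ℝ × ℝ × E3) + ε • ((1, 0, 0) : ℝ × ℝ × E3)) := by
  have hc : Continuous fun ε : ℝ => g.g00 u r p * ε + 2 := by fun_prop
  have h0 : ∀ᶠ ε : ℝ in 𝓝[>] 0, 0 < g.g00 u r p * ε + 2 := by
    refine nhdsWithin_le_nhds ((hc.tendsto 0).eventually (lt_mem_nhds ?_))
    norm_num
  filter_upwards [h0, self_mem_nhdsWithin] with ε h1 h2
  have h2' : 0 < ε := h2
  refine ⟨by simp [IsTangent], ?_, by simpa using h2'⟩
  have := mul_pos h2' h1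
  simp [BSMetric.inner4]
  linarith

namespace BSMetric

variable {g : BSMetric} {u₀ u₁ r₀ u r : ℝ}

/-- The future directed null vector `2 ∂_u + g¹¹ ∂_r - 2 ω^A ∂_A` orthogonal to the cuts. -/
def ingoing (g : BSMetric) (b : Pole) (u r : ℝ) (x : E2) : ℝ × ℝ × E3 :=
  (2, g.g11Up b u r x,
    (-2 * g.omUp b u r x 0) • frame b 0 x + (-2 * g.omUp b u r x 1) • frame b 1 x)

theorem IsRegular.inner4_ingoing (hg : g.IsRegular u₀ u₁ r₀) (hu : u ∈ Set.Ioo u₀ u₁) (hr : r₀ < r)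
    (b : Pole) (x : E2) :
    g.inner4 u r (chart b x) (g.ingoing b u r x) (g.ingoing b u r x) = 0 := by
  have hs : g.h b u r x 1 0 = g.h b u r x 0 1 := by rw [hg.h_eq hu hr]; simp
  have hd := (hg.hd_pos hu hr b x).ne'
  obtain ⟨e0, e1⟩ := hg.omUp_eq hu hr b x
  have l0 : g.ha b u r x * g.omUp b u r x 0 + g.hb b u r x * g.omUp b u r x 1 =
      g.omc b 0 u r x := by
    rw [e0, e1]; field_simp; rw [BSMetric.hd]; ring
  have l1 : g.hb b u r x * g.omUp b u r x 0 + g.hc b u r x * g.omUp b u r x 1 =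
      g.omc b 1 u r x := by
    rw [e0, e1]; field_simp; rw [BSMetric.hd]; ring
  simp only [BSMetric.h, bilinComp, Matrix.of_apply] at hs
  simp only [ha, hb, hc, omc, covecComp, BSMetric.h, bilinComp, Matrix.of_apply] at l0 l1
  simp only [inner4, ingoing, map_add, map_smul, add_apply, smul_apply, smul_eq_mul, g11Up,
    Fin.sum_univ_two, covecComp, hs]
  linear_combination (4 * g.omUp b u r x 0) * l0 + (4 * g.omUp b u r x 1) * l1

theorem IsRegular.isFutureTimelike_ingoing (hg : g.IsRegular u₀ u₁ r₀) (hu : u ∈ Set.Ioo u₀ u₁)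
    (hr : r₀ < r) (b : Pole) (x : E2) :
    ∀ᶠ ε : ℝ in 𝓝[>] 0, g.IsFutureTimelike u r (chart b x)
      (g.ingoing b u r x + ε • ((0, 1, 0) : ℝ × ℝ × E3)) := by
  filter_upwards [self_mem_nhdsWithin] with ε h2
  have h2' : 0 < ε := h2
  have h0 := hg.inner4_ingoing hu hr b x
  refine ⟨?_, ?_, by simp [ingoing]⟩
  · have := (frame_tangent b 0 x).lincomb (frame_tangent b 1 x) (-2 * g.omUp b u r x 0)
      (-2 * g.omUp b u r x 1)
    simpa [ingoing] using this
  · have e : g.inner4 u r (chart b x) (g.ingoing b u r x + ε • ((0, 1, 0) : ℝ × ℝ × E3))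
        (g.ingoing b u r x + ε • ((0, 1, 0) : ℝ × ℝ × E3)) =
        g.inner4 u r (chart b x) (g.ingoing b u r x) (g.ingoing b u r x) + 4 * ε := by
      simp [inner4, ingoing]
      ring
    rw [e, h0]
    linarith

theorem IsRegular.inv_inner4 (hg : g.IsRegular u₀ u₁ r₀) (hu : u ∈ Set.Ioo u₀ u₁) (hr : r₀ < r)
    (b : Pole) (x : E2) :
    (Matrix.of fun k l => g.inner4 u r (chart b x) (frame4 b x k) (frame4 b x l))⁻¹ =
      !![0, 1, 0, 0; 1, g.g11Up b u r x, -g.omUp b u r x 0, -g.omUp b u r x 1;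
        0, -g.omUp b u r x 0, (g.h b u r x)⁻¹ 0 0, (g.h b u r x)⁻¹ 0 1;
        0, -g.omUp b u r x 1, (g.h b u r x)⁻¹ 1 0, (g.h b u r x)⁻¹ 1 1] := by
  have hd := (hg.hd_pos hu hr b x).ne'
  have hdet : g.ha b u r x * g.hc b u r x - g.hb b u r x * g.hb b u r x = g.hd b u r x := rfl
  obtain ⟨e0, e1⟩ := hg.omUp_eq hu hr b x
  have hG : (Matrix.of fun k l => g.inner4 u r (chart b x) (frame4 b x k) (frame4 b x l)) =
      !![g.g00 u r (chart b x), 1, g.omc b 0 u r x, g.omc b 1 u r x;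
        1, 0, 0, 0;
        g.omc b 0 u r x, 0, g.ha b u r x, g.hb b u r x;
        g.omc b 1 u r x, 0, g.hb b u r x, g.hc b u r x] := by
    have hs : g.h b u r x 1 0 = g.h b u r x 0 1 := by rw [hg.h_eq hu hr]; simp
    simp only [BSMetric.h, bilinComp, Matrix.of_apply] at hs
    ext i j
    fin_cases i <;> fin_cases j <;>
      simp [inner4, frame4, omc, covecComp, ha, hb, hc, BSMetric.h, bilinComp, hs]
  rw [hG, hg.h_eq hu hr]
  refine Matrix.inv_eq_right_inv ?_
  simp only [inv_symm2, hdet, g11Up, Fin.sum_univ_two, e0, e1]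
  ext i j
  fin_cases i <;> fin_cases j <;>
    simp [Matrix.mul_apply, Fin.sum_univ_four, ← omc.eq_def] <;> field_simp <;>
    simp only [← hdet] <;> ring

end BSMetric

namespace BSMetric

variable {g : BSMetric} {u₀ u₁ r₀ u r : ℝ}

/-- `2 (T - g^AB T_AB) = T(∂_r, k) + T(k, ∂_r)` for the ingoing null vector `k`. -/
theorem IsRegular.trace4_sub_trace2 (hg : g.IsRegular u₀ u₁ r₀) (hu : u ∈ Set.Ioo u₀ u₁)
    (hr : r₀ < r) (T : Tensor4) (b : Pole) (x : E2) :
    2 * (trace4 g T b u r x - trace2 g T b u r x) =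
      T u r (chart b x) (0, 1, 0) (g.ingoing b u r x) +
        T u r (chart b x) (g.ingoing b u r x) (0, 1, 0) := by
  have hk : g.ingoing b u r x = (2 : ℝ) • ((1, 0, 0) : ℝ × ℝ × E3) +
      g.g11Up b u r x • ((0, 1, 0) : ℝ × ℝ × E3) +
      (-2 * g.omUp b u r x 0) • ((0, 0, frame b 0 x) : ℝ × ℝ × E3) +
      (-2 * g.omUp b u r x 1) • ((0, 0, frame b 1 x) : ℝ × ℝ × E3) := by
    simp [ingoing]
  rw [hk, trace4, trace2, hg.inv_inner4 hu hr]
  simp only [map_add, map_smul, add_apply, smul_apply, smul_eq_mul, Fin.sum_univ_two,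
    Fin.sum_univ_four, frame4]
  simp
  ring

theorem IsRegular.trace_nonneg (hg : g.IsRegular u₀ u₁ r₀) (hu : u ∈ Set.Ioo u₀ u₁)
    (hr : r₀ < r) {T : Tensor4} (b : Pole) (x : E2) (hT : DominantEnergy g T u r (chart b x)) :
    0 ≤ trace4 g T b u r x - trace2 g T b u r x := by
  have h1 := hT.nonneg_of_limit (g.isFutureTimelike_outgoing u r (chart b x))
    (hg.isFutureTimelike_ingoing hu hr b x)
  have h2 := hT.nonneg_of_limit (hg.isFutureTimelike_ingoing hu hr b x)
    (g.isFutureTimelike_outgoing u r (chart b x))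
  have h3 := hg.trace4_sub_trace2 hu hr T b x
  linarith

/-! ### Focusing of the outgoing null rays -/

/-- The discriminant of a quadratic form with respect to a definite one is nonnegative. -/
theorem four_mul_det_mul_det_le {a b c a' b' c' : ℝ} (hd : 0 < a * c - b * b) :
    4 * (a * c - b * b) * (a' * c' - b' * b') ≤ (a' * c + a * c' - 2 * b * b') ^ 2 := by
  have ha : a ≠ 0 := by rintro rfl; nlinarith [sq_nonneg b]
  have e : a ^ 2 * ((a' * c + a * c' - 2 * b * b') ^ 2 -
      4 * (a * c - b * b) * (a' * c' - b' * b')) =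
      (a * (a * c' - c * a') - 2 * b * (a * b' - b * a')) ^ 2 +
        4 * (a * c - b * b) * (a * b' - b * a') ^ 2 := by ring
  have h : 0 ≤ a ^ 2 * ((a' * c + a * c' - 2 * b * b') ^ 2 -
      4 * (a * c - b * b) * (a' * c' - b' * b')) := by rw [e]; positivity
  have := nonneg_of_mul_nonneg_right h (by positivity)
  linarith

/-- The Raychaudhuri inequality `(ln σ)_{,rr} ≤ - (ln σ)_{,r}² / 2`. It omits the energy density `T₁₁`
and the square of the shear, which is the discriminant in `four_mul_det_mul_det_le`. -/
theorem IsRegular.raychaudhuri (hg : g.IsRegular u₀ u₁ r₀) (hu : u ∈ Set.Ioo u₀ u₁)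
    (hr : r₀ < r) {T : Tensor4} (b : Pole) (x : E2) (hT : DominantEnergy g T u r (chart b x))
    (hE : EinsteinRR g T b u r x) :
    iteratedDeriv 2 (fun r' => Real.log (g.density b u r' x)) r ≤
      -(deriv (fun r' => Real.log (g.density b u r' x)) r) ^ 2 / 2 := by
  have hT0 := hT.nonneg_of_limit (g.isFutureTimelike_outgoing u r (chart b x))
    (g.isFutureTimelike_outgoing u r (chart b x))
  have hd := hg.hd_pos hu hr b x
  have hda := (hg.sm_ha b).hasDerivAt_r hu hr x
  have hdb := (hg.sm_hb b).hasDerivAt_r hu hr x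
  have hdc := (hg.sm_hc b).hasDerivAt_r hu hr x
  obtain ⟨a', ha'⟩ : ∃ a', a' = deriv (fun r' => g.ha b u r' x) r := ⟨_, rfl⟩
  obtain ⟨b', hb'⟩ : ∃ b', b' = deriv (fun r' => g.hb b u r' x) r := ⟨_, rfl⟩
  obtain ⟨c', hc'⟩ : ∃ c', c' = deriv (fun r' => g.hc b u r' x) r := ⟨_, rfl⟩
  rw [← ha'] at hda
  rw [← hb'] at hdb
  rw [← hc'] at hdc
  have hdd : HasDerivAt (fun r' => g.hd b u r' x)
      (a' * g.hc b u r x + g.ha b u r x * c' - 2 * g.hb b u r x * b') r :=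
    ((hda.mul hdc).sub (hdb.mul hdb)).congr_deriv (by ring)
  obtain ⟨d', hd'⟩ : ∃ d', d' = a' * g.hc b u r x + g.ha b u r x * c' - 2 * g.hb b u r x * b' :=
    ⟨_, rfl⟩
  rw [← hd'] at hdd
  have hnear : ∀ᶠ r' in 𝓝 r, r₀ < r' := Ioi_mem_nhds hr
  have hL : deriv (fun r' => Real.log (g.density b u r' x)) r = d' / (2 * g.hd b u r x) := by
    have he : (fun r' => Real.log (g.density b u r' x)) =ᶠ[𝓝 r]
        fun r' => Real.log (g.hd b u r' x) / 2 := by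
      filter_upwards [hnear] with r' hr'
      rw [hg.density_eq hu hr', Real.log_sqrt (hg.hd_pos hu hr' b x).le]
    rw [he.deriv_eq, ((hdd.log hd.ne').div_const 2).deriv]
    field_simp
  have hh : ∀ A B, deriv (fun r' => g.h b u r' x A B) r =
      (!![a', b'; b', c'] : Matrix (Fin 2) (Fin 2) ℝ) A B := by
    intro A B
    have he : (fun r' => g.h b u r' x A B) =ᶠ[𝓝 r] fun r' =>
        (!![g.ha b u r' x, g.hb b u r' x; g.hb b u r' x, g.hc b u r' x] :
          Matrix (Fin 2) (Fin 2) ℝ) A B := by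
      filter_upwards [hnear] with r' hr'
      rw [hg.h_eq hu hr']
    rw [he.deriv_eq]
    fin_cases A <;> fin_cases B
    · exact hda.deriv
    · exact hdb.deriv
    · exact hdb.deriv
    · exact hdc.deriv
  have hi : ∀ A B, deriv (fun r' => (g.h b u r' x)⁻¹ A B) r =
      -d' / g.hd b u r x ^ 2 * (!![g.hc b u r x, -g.hb b u r x; -g.hb b u r x, g.ha b u r x] :
        Matrix (Fin 2) (Fin 2) ℝ) A B +
      (g.hd b u r x)⁻¹ * (!![c', -b'; -b', a'] : Matrix (Fin 2) (Fin 2) ℝ) A B := by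
    intro A B
    have he : (fun r' => (g.h b u r' x)⁻¹ A B) =ᶠ[𝓝 r] fun r' => (g.hd b u r' x)⁻¹ *
        (!![g.hc b u r' x, -g.hb b u r' x; -g.hb b u r' x, g.ha b u r' x] :
          Matrix (Fin 2) (Fin 2) ℝ) A B := by
      filter_upwards [hnear] with r' hr'
      rw [hg.h_eq hu hr', inv_symm2, BSMetric.hd]
    rw [he.deriv_eq]
    fin_cases A <;> fin_cases B
    · exact ((hdd.inv hd.ne').mul hdc).deriv
    · exact ((hdd.inv hd.ne').mul hdb.neg).deriv
    · exact ((hdd.inv hd.ne').mul hdb.neg).deriv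
    · exact ((hdd.inv hd.ne').mul hda).deriv
  have hdisc := four_mul_det_mul_det_le (a' := a') (b' := b') (c' := c') hd
  rw [← hd', show g.ha b u r x * g.hc b u r x - g.hb b u r x * g.hb b u r x = g.hd b u r x from rfl]
    at hdisc
  -- the quadratic expression in the derivatives of `g_AB`, in terms of the determinant
  unfold EinsteinRR at hE
  simp only [Fin.sum_univ_two, hh, hi] at hE
  simp at hE
  have hsum : a' * (-d' / g.hd b u r x ^ 2 * g.hc b u r x + (g.hd b u r x)⁻¹ * c') +
      b' * (-(-d' / g.hd b u r x ^ 2 * g.hb b u r x) + -((g.hd b u r x)⁻¹ * b')) +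
      (b' * (-(-d' / g.hd b u r x ^ 2 * g.hb b u r x) + -((g.hd b u r x)⁻¹ * b')) +
      c' * (-d' / g.hd b u r x ^ 2 * g.ha b u r x + (g.hd b u r x)⁻¹ * a')) =
      (2 * g.hd b u r x * (a' * c' - b' * b') - d' ^ 2) / g.hd b u r x ^ 2 := by
    field_simp
    rw [hd']
    ring
  rw [hsum] at hE
  have hfin : (2 * g.hd b u r x * (a' * c' - b' * b') - d' ^ 2) / g.hd b u r x ^ 2 ≤
      -(d' ^ 2 / 2) / g.hd b u r x ^ 2 := by
    gcongr
    linarith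
  have e2 : -(d' / (2 * g.hd b u r x)) ^ 2 / 2 = 4⁻¹ * (-(d' ^ 2 / 2) / g.hd b u r x ^ 2) := by
    field_simp
    norm_num
  rw [hL, e2]
  linarith

/-- The square root of the area density is a concave function along the outgoing null rays. -/
theorem IsRegular.concaveOn_sqrt_density (hg : g.IsRegular u₀ u₁ r₀) (hu : u ∈ Set.Ioo u₀ u₁)
    {T : Tensor4} (b : Pole) (x : E2) (hT : ∀ r > r₀, DominantEnergy g T u r (chart b x))
    (hE : ∀ r > r₀, EinsteinRR g T b u r x) :
    ConcaveOn ℝ (Set.Ioi r₀) fun r => √(g.density b u r x) := by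
  have hlog : Sm u₀ u₁ r₀ (fun u r x => Real.log (g.density b u r x)) :=
    (hg.sm_density b).log fun _ hu _ hr x => (hg.density_pos hu hr b x).ne'
  obtain ⟨L, hL⟩ : ∃ L : ℝ → ℝ, L = fun r => Real.log (g.density b u r x) := ⟨_, rfl⟩
  have h1 : ∀ r > r₀, HasDerivAt L (deriv L r) r := by
    intro r hr; rw [hL]; exact hlog.hasDerivAt_r hu hr x
  have h2 : ∀ r > r₀, HasDerivAt (deriv L) (deriv (deriv L) r) r := by
    intro r hr
    have := hlog.deriv_r.hasDerivAt_r hu hr x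
    rw [hL]
    exact this
  have hexp : ConcaveOn ℝ (Set.Ioi r₀) fun r => Real.exp (L r / 2) := by
    have e1 : ∀ r > r₀, HasDerivAt (fun r => Real.exp (L r / 2))
        (Real.exp (L r / 2) * (deriv L r / 2)) r := fun r hr => ((h1 r hr).div_const 2).exp
    have e2 : ∀ r > r₀, HasDerivAt (fun r => Real.exp (L r / 2) * (deriv L r / 2))
        (Real.exp (L r / 2) * (deriv L r / 2) * (deriv L r / 2) +
          Real.exp (L r / 2) * (deriv (deriv L) r / 2)) r := fun r hr =>
      (e1 r hr).mul ((h2 r hr).div_const 2)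
    have e3 : ∀ r > r₀, deriv (fun r => Real.exp (L r / 2)) =ᶠ[𝓝 r]
        fun r => Real.exp (L r / 2) * (deriv L r / 2) := by
      intro r hr
      filter_upwards [Ioi_mem_nhds hr] with r' hr'
      exact (e1 r' hr').deriv
    refine concaveOn_of_deriv2_nonpos' (convex_Ioi r₀) ?_ ?_ ?_
    · intro r hr
      exact (e1 r hr).differentiableAt.differentiableWithinAt
    · intro r hr
      exact ((e2 r hr).congr_of_eventuallyEq (e3 r hr)).differentiableAt.differentiableWithinAt
    · intro r hr
      have e4 : deriv^[2] (fun r => Real.exp (L r / 2)) r =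
          Real.exp (L r / 2) * (deriv L r / 2) * (deriv L r / 2) +
            Real.exp (L r / 2) * (deriv (deriv L) r / 2) := by
        simp only [Function.iterate_succ, Function.iterate_zero, Function.comp_apply, id]
        rw [(e3 r hr).deriv_eq]
        exact (e2 r hr).deriv
      have h3 := hg.raychaudhuri hu hr b x (hT r hr) (hE r hr)
      rw [iteratedDeriv_succ, iteratedDeriv_one, ← hL] at h3
      rw [e4]
      have h4 := Real.exp_pos (L r / 2)
      nlinarith
  refine hexp.congr fun r hr => ?_
  simp only [hL]
  rw [Real.exp_half, Real.exp_log (hg.density_pos hu hr b x)]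

/-! ### Monotonicity of the integrated ingoing expansion -/

/-- `(σ θ₋)_{,r} ≥ σ R⁽²⁾ - σ (ω^A_{,r})_{|A}`: the matter term is nonnegative, and so is the
quadratic term in `ω^A_{,r}`, because `g_AB` is negative definite. -/
theorem IsRegular.div2_sourceDens_le (hg : g.IsRegular u₀ u₁ r₀) (hu : u ∈ Set.Ioo u₀ u₁)
    (hr : r₀ < r) {T : Tensor4} (b : Pole) (x : E2) (hT : DominantEnergy g T u r (chart b x))
    (hE : EinsteinTrace g T b u r x) :
    div2 (g.sourceDens b u r) x ≤
      deriv (fun r' => g.density b u r' x * g.thetaMinus b u r' x) r := by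
  have hσ := hg.density_pos hu hr b x
  have htr := hg.trace_nonneg hu hr b x hT
  have hq : ∑ A, ∑ B, g.h b u r x A B * deriv (fun r' => g.omUp b u r' x A) r *
        deriv (fun r' => g.omUp b u r' x B) r ≤ 0 := by
    rw [hg.h_eq hu hr]
    simp only [Fin.sum_univ_two]
    by_cases h0 : deriv (fun r' => g.omUp b u r' x 0) r ≠ 0 ∨
        deriv (fun r' => g.omUp b u r' x 1) r ≠ 0
    · have := hg.quad_neg hu hr b x h0
      simp
      linarith
    · push Not at h0
      simp [h0.1, h0.2]
  unfold EinsteinTrace at hE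
  rw [← hg.density_mul_source hu hr b x]
  have e : deriv (fun r' => g.density b u r' x * g.thetaMinus b u r' x) r =
      g.density b u r x * ((g.density b u r x)⁻¹ *
        deriv (fun r' => g.density b u r' x * g.thetaMinus b u r' x) r) := by
    field_simp
  rw [e]
  gcongr
  linarith

/-- The function `∫ σ θ₋ + 8 π r` is nondecreasing along the null surface: the pointwise inequality
`IsRegular.div2_sourceDens_le` is integrated over `r` and over the sphere. -/
theorem IsRegular.intThetaMinus_mono (hg : g.IsRegular u₀ u₁ r₀) (hu : u ∈ Set.Ioo u₀ u₁)
    {T : Tensor4} (hT : ∀ r > r₀, ∀ p, DominantEnergy g T u r p)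
    (hE : ∀ r > r₀, ∀ b x, EinsteinTrace g T b u r x) {r₁ r₂ : ℝ} (h1 : r₀ < r₁) (h12 : r₁ ≤ r₂) :
    g.intThetaMinus u r₁ + 8 * Real.pi * r₁ ≤ g.intThetaMinus u r₂ + 8 * Real.pi * r₂ := by
  have h2 : r₀ < r₂ := lt_of_lt_of_le h1 h12
  obtain ⟨b, hb⟩ : ∃ b, b = Pole.north := ⟨_, rfl⟩
  obtain ⟨C, hC⟩ := hg.div2_sourceDens_bound hu (r₂ := r₂) h1 b
  have hsub : Set.Icc r₁ r₂ ⊆ Set.Ioi r₀ := fun s hs => lt_of_lt_of_le h1 hs.1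
  have hfc : ContinuousOn (fun z : ℝ × E2 => div2 (g.sourceDens b u z.1) z.2)
      (Set.Icc r₁ r₂ ×ˢ Set.univ) :=
    ((hg.sm_div2_sourceDens b).continuousOn hu).mono (Set.prod_mono_left hsub)
  have hpt : ∀ x, ∫ r in r₁..r₂, div2 (g.sourceDens b u r) x ≤
      g.density b u r₂ x * g.thetaMinus b u r₂ x - g.density b u r₁ x * g.thetaMinus b u r₁ x := by
    intro x
    have hQ := hg.sm_density_mul_thetaMinus b
    have hslice : ∀ {f : ℝ → ℝ → E2 → ℝ}, Sm u₀ u₁ r₀ f →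
        ContinuousOn (fun r => f u r x) (Set.Icc r₁ r₂) := by
      intro f hf
      exact (hf.continuousOn hu).comp (f := fun r : ℝ => (r, x)) (by fun_prop)
        fun s hs => ⟨hsub hs, trivial⟩
    have hi1 : IntervalIntegrable (fun r => div2 (g.sourceDens b u r) x) volume r₁ r₂ :=
      (hslice (hg.sm_div2_sourceDens b)).intervalIntegrable_of_Icc h12
    have hi2 : IntervalIntegrable
        (deriv fun r' => g.density b u r' x * g.thetaMinus b u r' x) volume r₁ r₂ :=
      (hslice hQ.deriv_r).intervalIntegrable_of_Icc h12
    rw [← intervalIntegral.integral_eq_sub_of_hasDerivAt (a := r₁) (b := r₂)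
      (f := fun r' => g.density b u r' x * g.thetaMinus b u r' x)
      (f' := deriv fun r' => g.density b u r' x * g.thetaMinus b u r' x) ?_ hi2]
    · refine intervalIntegral.integral_mono_on h12 hi1 hi2 fun s hs => ?_
      exact hg.div2_sourceDens_le hu (hsub hs) b x (hT s (hsub hs) _) (hE s (hsub hs) b x)
    · intro s hs
      rw [Set.uIcc_of_le h12] at hs
      exact hQ.hasDerivAt_r hu (hsub hs) x
  have hprod : Integrable (Function.uncurry fun r x => div2 (g.sourceDens b u r) x)
      ((volume.restrict (Set.uIoc r₁ r₂)).prod volume) := by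
    rw [Set.uIoc_of_le h12]
    have hms : MeasurableSet (Set.Ioc r₁ r₂ ×ˢ (Set.univ : Set E2)) :=
      measurableSet_Ioc.prod MeasurableSet.univ
    have hrestr : (volume.restrict (Set.Ioc r₁ r₂)).prod (volume : Measure E2) =
        ((volume : Measure ℝ).prod (volume : Measure E2)).restrict
          (Set.Ioc r₁ r₂ ×ˢ Set.univ) := by
      rw [← Measure.prod_restrict, Measure.restrict_univ]
    have hdom : Integrable (fun z : ℝ × E2 => C * ((1 + rsq z.2)⁻¹) ^ 2)
        ((volume.restrict (Set.Ioc r₁ r₂)).prod volume) :=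
      (integrable_inv_one_add_rsq_pow.const_mul C).comp_snd _
    refine hdom.mono' ?_ ?_
    · rw [hrestr]
      exact (hfc.mono (Set.prod_mono_left Set.Ioc_subset_Icc_self)).aestronglyMeasurable hms
    · rw [hrestr]
      refine (ae_restrict_iff' hms).2 (ae_of_all _ fun z hz => ?_)
      exact hC z.1 (Set.Ioc_subset_Icc_self hz.1) z.2
  have hswap := intervalIntegral_integral_swap hprod
  have hleft : ∫ r in r₁..r₂, ∫ x, div2 (g.sourceDens b u r) x = -(8 * Real.pi) * (r₂ - r₁) := by
    rw [intervalIntegral.integral_congr (g := fun _ => -(8 * Real.pi))]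
    · simp; ring
    · intro s hs
      rw [Set.uIcc_of_le h12] at hs
      exact hg.integral_div2_sourceDens hu (hsub hs) b
  have hint : Integrable fun x => ∫ r in r₁..r₂, div2 (g.sourceDens b u r) x := by
    have := hprod.integral_prod_right
    rw [Set.uIoc_of_le h12] at this
    simpa only [intervalIntegral.integral_of_le h12, Function.uncurry_apply_pair] using this
  have hI1 := hg.integrable_density_mul_thetaMinus hu h1 b
  have hI2 := hg.integrable_density_mul_thetaMinus hu h2 b
  have hmain := integral_mono hint (hI2.sub hI1) hpt
  simp only [Pi.sub_apply] at hmain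
  rw [integral_sub hI2 hI1, ← hswap, hleft] at hmain
  simp only [intThetaMinus, ← hb]
  linarith

end BSMetric

/-! ### Algebra of the asymptotic expansions -/

/-- The function `f` is eventually bounded along the filter `l`. Below, `l` describes `r → ∞`
uniformly in the other variables. -/
def Bdd {α : Type*} (l : Filter α) (f : α → ℝ) : Prop := ∃ C, ∀ᶠ z in l, |f z| ≤ C

namespace Bdd

variable {α : Type*} {l : Filter α} {f g : α → ℝ}

theorem const (c : ℝ) : Bdd l fun _ => c := ⟨|c|, Eventually.of_forall fun _ => le_rfl⟩

theorem add (hf : Bdd l f) (hg : Bdd l g) : Bdd l fun z => f z + g z := by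
  obtain ⟨C, hC⟩ := hf
  obtain ⟨D, hD⟩ := hg
  refine ⟨C + D, ?_⟩
  filter_upwards [hC, hD] with z h1 h2
  exact (abs_add_le _ _).trans (add_le_add h1 h2)

theorem neg (hf : Bdd l f) : Bdd l fun z => -f z := by
  obtain ⟨C, hC⟩ := hf
  exact ⟨C, by simpa using hC⟩

theorem sub (hf : Bdd l f) (hg : Bdd l g) : Bdd l fun z => f z - g z := by
  simpa only [sub_eq_add_neg] using hf.add hg.neg

theorem mul (hf : Bdd l f) (hg : Bdd l g) : Bdd l fun z => f z * g z := by
  obtain ⟨C, hC⟩ := hf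
  obtain ⟨D, hD⟩ := hg
  refine ⟨C * D, ?_⟩
  filter_upwards [hC, hD] with z h1 h2
  rw [abs_mul]
  exact mul_le_mul h1 h2 (abs_nonneg _) ((abs_nonneg _).trans h1)

theorem congr (hf : Bdd l f) (h : ∀ᶠ z in l, g z = f z) : Bdd l g := by
  obtain ⟨C, hC⟩ := hf
  refine ⟨C, ?_⟩
  filter_upwards [hC, h] with z h1 h2
  rwa [h2]

theorem inv_of_half_le (h : ∀ᶠ z in l, 1 / 2 ≤ f z) : Bdd l fun z => (f z)⁻¹ := by
  refine ⟨2, ?_⟩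
  filter_upwards [h] with z hz
  have : 0 < f z := by linarith
  rw [abs_of_pos (inv_pos.2 this), inv_le_comm₀ this (by norm_num)]
  linarith

theorem eventually_abs_le (hf : Bdd l f) {t : α → ℝ} (ht : Tendsto t l (𝓝 0)) {ε : ℝ}
    (hε : 0 < ε) : ∀ᶠ z in l, |f z * t z| ≤ ε := by
  obtain ⟨C, hC⟩ := hf
  have h1 : Tendsto (fun z => |C| * |t z|) l (𝓝 0) := by simpa using ht.abs.const_mul |C|
  filter_upwards [hC, h1.eventually (gt_mem_nhds hε)] with z h2 h3
  rw [abs_mul]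
  exact (mul_le_mul_of_nonneg_right (h2.trans (le_abs_self C)) (abs_nonneg _)).trans h3.le

end Bdd

section Expansion

variable {α : Type*} {l : Filter α} {r : α → ℝ}

theorem bdd_inv (hr : Tendsto r l atTop) : Bdd l fun z => (r z)⁻¹ :=
  Bdd.inv_of_half_le (hr.eventually_ge_atTop (1 / 2))

/-- The expansion of the square root of `r⁴ (1 + n / r + O(r⁻²))`, in the form
`s = r² y`, `y = 1 + n / (2 r) + O(r⁻²)`. -/
theorem sqrt_expansion (hr : Tendsto r l atTop) {y n W : α → ℝ} (hn : Bdd l n) (hW : Bdd l W)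
    (hy0 : ∀ᶠ z in l, 0 < y z)
    (hy : ∀ᶠ z in l, y z * y z = 1 + n z * (r z)⁻¹ + (r z)⁻¹ ^ 2 * W z) :
    Bdd l (fun z => (y z)⁻¹) ∧
      ∃ W', Bdd l W' ∧ ∀ᶠ z in l, y z = 1 + n z * (r z)⁻¹ / 2 + (r z)⁻¹ ^ 2 * W' z := by
  have ht := tendsto_inv_atTop_zero.comp hr
  have hb := bdd_inv hr
  have h1 := hn.eventually_abs_le ht (ε := 1 / 4) (by norm_num)
  have h2 := (hb.mul hW).eventually_abs_le ht (ε := 1 / 4) (by norm_num)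
  simp only [Function.comp_apply] at h1 h2
  have hden : ∀ᶠ z in l, 1 / 2 ≤ y z + 1 + n z * (r z)⁻¹ / 2 := by
    filter_upwards [hy0, h1] with z a1 a2
    have := (abs_le.1 a2).1
    linarith
  refine ⟨Bdd.inv_of_half_le ?_, fun z => (W z - n z * n z * (1 / 4)) *
    (y z + 1 + n z * (r z)⁻¹ / 2)⁻¹, ?_, ?_⟩
  · filter_upwards [hy0, hy, h1, h2] with z a0 a1 a2 a3
    have e1 := (abs_le.1 a2).1
    have e2 := (abs_le.1 a3).1
    have e3 : (r z)⁻¹ ^ 2 * W z = (r z)⁻¹ * W z * (r z)⁻¹ := by ring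
    nlinarith
  · exact (hW.sub ((hn.mul hn).mul (Bdd.const _))).mul (Bdd.inv_of_half_le hden)
  · filter_upwards [hden, hy] with z a1 a2
    have a3 : y z + 1 + n z * (r z)⁻¹ / 2 ≠ 0 := by
      have : 0 < y z + 1 + n z * (r z)⁻¹ / 2 := by linarith
      exact this.ne'
    have e : y z - (1 + n z * (r z)⁻¹ / 2) = (r z)⁻¹ ^ 2 * (W z - n z * n z * (1 / 4)) *
        (y z + 1 + n z * (r z)⁻¹ / 2)⁻¹ := by
      rw [eq_mul_inv_iff_mul_eq₀ a3]
      linear_combination a2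
    linear_combination e

set_option maxHeartbeats 1600000 in
/-- The expansion of the mass aspect quotient. Here `a, b, c` are the components of `g_AB` divided by
the conformal factor of the round metric, `s` is `σ / σ_s`, and the indices `r` and `u` stand for
derivatives. The functions `P, Q, U, G` are the bounded remainders in the expansions of the
components, of their derivatives and of `g₀₀`. With `t = 1 / r`, the powers of `t` times the
determinant and its derivatives are polynomials in `t` and bounded functions, and the relations
`s² = a c - b²` and its derivatives are solved for `s`, `s_{,r}` and `s_{,u}`. -/
theorem mass_expansion (hr : Tendsto r l atTop)
    {a b c ar br cr au bu cu n₀ n₁ n₂ m₀ m₁ m₂ n₀u n₁u n₂u m₀u m₁u m₂u : α → ℝ}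
    {P₀ P₁ P₂ Q₀ Q₁ Q₂ U₀ U₁ U₂ w₀ w₁ M G s sr su g11 : α → ℝ}
    (hn₀ : Bdd l n₀) (hn₁ : Bdd l n₁) (hn₂ : Bdd l n₂) (hm₀ : Bdd l m₀) (hm₁ : Bdd l m₁)
    (hm₂ : Bdd l m₂) (hn₀u : Bdd l n₀u) (hn₁u : Bdd l n₁u) (hn₂u : Bdd l n₂u) (hm₀u : Bdd l m₀u)
    (hm₁u : Bdd l m₁u) (hm₂u : Bdd l m₂u) (hP₀ : Bdd l P₀) (hP₁ : Bdd l P₁) (hP₂ : Bdd l P₂)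
    (hQ₀ : Bdd l Q₀) (hQ₁ : Bdd l Q₁) (hQ₂ : Bdd l Q₂) (hU₀ : Bdd l U₀) (hU₁ : Bdd l U₁)
    (hU₂ : Bdd l U₂) (hw₀ : Bdd l w₀) (hw₁ : Bdd l w₁) (hM : Bdd l M) (hG : Bdd l G)
    (ha : ∀ᶠ z in l, a z = -r z ^ 2 + n₀ z * r z + m₀ z + (r z)⁻¹ * P₀ z)
    (hb : ∀ᶠ z in l, b z = n₁ z * r z + m₁ z + (r z)⁻¹ * P₁ z)
    (hc : ∀ᶠ z in l, c z = -r z ^ 2 + n₂ z * r z + m₂ z + (r z)⁻¹ * P₂ z)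
    (har : ∀ᶠ z in l, ar z = -2 * r z + n₀ z + (r z)⁻¹ ^ 2 * Q₀ z)
    (hbr : ∀ᶠ z in l, br z = n₁ z + (r z)⁻¹ ^ 2 * Q₁ z)
    (hcr : ∀ᶠ z in l, cr z = -2 * r z + n₂ z + (r z)⁻¹ ^ 2 * Q₂ z)
    (hau : ∀ᶠ z in l, au z = n₀u z * r z + m₀u z + (r z)⁻¹ * U₀ z)
    (hbu : ∀ᶠ z in l, bu z = n₁u z * r z + m₁u z + (r z)⁻¹ * U₁ z)
    (hcu : ∀ᶠ z in l, cu z = n₂u z * r z + m₂u z + (r z)⁻¹ * U₂ z)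
    (hs0 : ∀ᶠ z in l, 0 < s z) (hs : ∀ᶠ z in l, s z * s z = a z * c z - b z * b z)
    (hsr : ∀ᶠ z in l, 2 * s z * sr z = ar z * c z + a z * cr z - 2 * b z * br z)
    (hsu : ∀ᶠ z in l, 2 * s z * su z = au z * c z + a z * cu z - 2 * b z * bu z)
    (hg11 : ∀ᶠ z in l, g11 z = (s z * s z)⁻¹ *
        (c z * w₀ z * w₀ z - 2 * b z * w₀ z * w₁ z + a z * w₁ z * w₁ z) -
      (1 + 1 / 2 * -(n₀u z + n₂u z) - 2 * M z * (r z)⁻¹ + (r z)⁻¹ ^ 2 * G z)) :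
    Bdd l (fun z => s z - (r z ^ 2 + -(n₀ z + n₂ z) * r z / 2)) ∧
    Bdd l (fun z => (sr z - (2 * r z + -(n₀ z + n₂ z) / 2)) * r z) ∧
    Bdd l (fun z => (sr z + g11 z * sr z + 2 * su z -
      (4 * M z + (-m₀u z - m₂u z + n₂ z * n₀u z + n₀ z * n₂u z - 2 * n₁ z * n₁u z) -
        3 / 4 * ((n₀ z + n₂ z) * (n₀u z + n₂u z)))) * r z) := by
  have ht := bdd_inv hr
  have hr0 : ∀ᶠ z in l, 0 < r z := hr.eventually_gt_atTop 0
  obtain ⟨t, htd⟩ : ∃ t : α → ℝ, t = fun z => (r z)⁻¹ := ⟨_, rfl⟩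
  rw [← htd] at ht
  have htz : ∀ z, (r z)⁻¹ = t z := fun z => by rw [htd]
  have hrt : ∀ᶠ z in l, r z * t z = 1 := by
    filter_upwards [hr0] with z hz
    rw [← htz, mul_inv_cancel₀ hz.ne']
  simp only [htz] at ha hb hc har hbr hcr hau hbu hcu hg11
  obtain ⟨A, hA⟩ : ∃ A : α → ℝ, A = fun z => m₀ z + t z * P₀ z := ⟨_, rfl⟩
  obtain ⟨B, hB⟩ : ∃ B : α → ℝ, B = fun z => m₁ z + t z * P₁ z := ⟨_, rfl⟩
  obtain ⟨C, hC⟩ : ∃ C : α → ℝ, C = fun z => m₂ z + t z * P₂ z := ⟨_, rfl⟩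
  have hAb : Bdd l A := by rw [hA]; exact hm₀.add (ht.mul hP₀)
  have hBb : Bdd l B := by rw [hB]; exact hm₁.add (ht.mul hP₁)
  have hCb : Bdd l C := by rw [hC]; exact hm₂.add (ht.mul hP₂)
  obtain ⟨n, hnd⟩ : ∃ n : α → ℝ, n = fun z => -(n₀ z + n₂ z) := ⟨_, rfl⟩
  have hnb : Bdd l n := by rw [hnd]; exact (hn₀.add hn₂).neg
  obtain ⟨nu, hnud⟩ : ∃ nu : α → ℝ, nu = fun z => -(n₀u z + n₂u z) := ⟨_, rfl⟩
  have hnub : Bdd l nu := by rw [hnud]; exact (hn₀u.add hn₂u).neg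
  obtain ⟨k, hkd⟩ : ∃ k : α → ℝ, k = fun z =>
    -m₀u z - m₂u z + n₂ z * n₀u z + n₀ z * n₂u z - 2 * n₁ z * n₁u z := ⟨_, rfl⟩
  have hkb : Bdd l k := by
    rw [hkd]
    exact ((((hm₀u.neg).sub hm₂u).add (hn₂.mul hn₀u)).add (hn₀.mul hn₂u)).sub
      (((Bdd.const 2).mul hn₁).mul hn₁u)
  -- the determinant and its derivatives
  obtain ⟨W₁, hW₁b, hW₁⟩ : ∃ W, Bdd l W ∧ ∀ᶠ z in l, (a z * c z - b z * b z) * t z ^ 4 =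
      1 + n z * t z + t z ^ 2 * W z := by
    refine ⟨fun z => n₀ z * n₂ z - A z - C z - n₁ z * n₁ z +
      t z * (n₀ z * C z + n₂ z * A z - 2 * n₁ z * B z) + t z * t z * (A z * C z - B z * B z), ?_, ?_⟩
    · exact ((((hn₀.mul hn₂).sub hAb).sub hCb).sub (hn₁.mul hn₁)).add
        (ht.mul (((hn₀.mul hCb).add (hn₂.mul hAb)).sub (((Bdd.const 2).mul hn₁).mul hBb)))
        |>.add ((ht.mul ht).mul ((hAb.mul hCb).sub (hBb.mul hBb)))
    · filter_upwards [ha, hb, hc, hrt, hr0] with z e1 e2 e3 e4 e5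
      have e6 : t z = (r z)⁻¹ := (htz z).symm
      rw [e1, e2, e3, hA, hB, hC, hnd]
      simp only [e6]
      field_simp
      ring
  have ha2b : Bdd l fun z => t z * t z * a z := by
    have h : Bdd l fun z => -1 + n₀ z * t z + t z * t z * A z := by
      (repeat' first
        | assumption
        | exact Bdd.const _
        | apply Bdd.add
        | apply Bdd.sub
        | apply Bdd.neg
        | apply Bdd.mul)
    refine h.congr ?_
    filter_upwards [ha, hr0] with z e1 e5
    have e6 : t z = (r z)⁻¹ := (htz z).symm
    rw [e1, hA]
    simp only [e6]
    field_simp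
    ring
  have hb2b : Bdd l fun z => t z * t z * b z := by
    have h : Bdd l fun z => n₁ z * t z + t z * t z * B z := by
      (repeat' first
        | assumption
        | exact Bdd.const _
        | apply Bdd.add
        | apply Bdd.sub
        | apply Bdd.neg
        | apply Bdd.mul)
    refine h.congr ?_
    filter_upwards [hb, hr0] with z e1 e5
    have e6 : t z = (r z)⁻¹ := (htz z).symm
    rw [e1, hB]
    simp only [e6]
    field_simp
    ring
  have hc2b : Bdd l fun z => t z * t z * c z := by
    have h : Bdd l fun z => -1 + n₂ z * t z + t z * t z * C z := by
      (repeat' first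
        | assumption
        | exact Bdd.const _
        | apply Bdd.add
        | apply Bdd.sub
        | apply Bdd.neg
        | apply Bdd.mul)
    refine h.congr ?_
    filter_upwards [hc, hr0] with z e1 e5
    have e6 : t z = (r z)⁻¹ := (htz z).symm
    rw [e1, hC]
    simp only [e6]
    field_simp
    ring
  obtain ⟨W₃, hW₃b, hW₃⟩ : ∃ W, Bdd l W ∧ ∀ᶠ z in l,
      (ar z * c z + a z * cr z - 2 * b z * br z) * t z ^ 3 =
      4 + 3 * n z * t z + t z ^ 2 * W z := by
    refine ⟨fun z => -2 * C z + n₀ z * n₂ z + n₀ z * C z * t z +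
      t z * Q₀ z * (-1 + n₂ z * t z + t z * t z * C z) +
      (-2 * A z + n₀ z * n₂ z + n₂ z * A z * t z +
        t z * Q₂ z * (-1 + n₀ z * t z + t z * t z * A z)) -
      2 * (n₁ z + B z * t z) * (n₁ z + t z * t z * Q₁ z), ?_, ?_⟩
    · (repeat' first
        | assumption
        | exact Bdd.const _
        | apply Bdd.add
        | apply Bdd.sub
        | apply Bdd.neg
        | apply Bdd.mul)
    · filter_upwards [ha, hb, hc, har, hbr, hcr, hr0] with z e1 e2 e3 f1 f2 f3 e5
      have e6 : t z = (r z)⁻¹ := (htz z).symm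
      rw [e1, e2, e3, f1, f2, f3, hA, hB, hC, hnd]
      simp only [e6]
      field_simp
      ring
  obtain ⟨W₅, hW₅b, hW₅⟩ : ∃ W, Bdd l W ∧ ∀ᶠ z in l,
      (au z * c z + a z * cu z - 2 * b z * bu z) * t z ^ 3 =
      nu z + k z * t z + t z ^ 2 * W z := by
    refine ⟨fun z =>
      n₀u z * C z + m₀u z * n₂ z - U₀ z + t z * (m₀u z * C z + U₀ z * n₂ z) +
        t z * t z * (U₀ z * C z) +
      (n₂u z * A z + m₂u z * n₀ z - U₂ z + t z * (m₂u z * A z + U₂ z * n₀ z) +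
        t z * t z * (U₂ z * A z)) -
      2 * (n₁ z * m₁u z + B z * n₁u z + t z * (n₁ z * U₁ z + B z * m₁u z) +
        t z * t z * (B z * U₁ z)), ?_, ?_⟩
    · (repeat' first
        | assumption
        | exact Bdd.const _
        | apply Bdd.add
        | apply Bdd.sub
        | apply Bdd.neg
        | apply Bdd.mul)
    · filter_upwards [ha, hb, hc, hau, hbu, hcu, hr0] with z e1 e2 e3 f1 f2 f3 e5
      have e6 : t z = (r z)⁻¹ := (htz z).symm
      rw [e1, e2, e3, f1, f2, f3, hA, hB, hC, hnud, hkd]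
      simp only [e6]
      field_simp
      ring
  -- the rescaled density `y = s / r²`
  obtain ⟨y, hyd⟩ : ∃ y : α → ℝ, y = fun z => s z * t z ^ 2 := ⟨_, rfl⟩
  have hy0 : ∀ᶠ z in l, 0 < y z := by
    filter_upwards [hs0, hr0] with z e1 e2
    rw [hyd]
    have : 0 < t z := by rw [← htz]; positivity
    positivity
  obtain ⟨hYb, W₂, hW₂b, hW₂⟩ := sqrt_expansion hr (y := y) hnb hW₁b hy0 (by
    filter_upwards [hW₁, hs] with z e1 e2
    rw [htz, ← e1, ← e2, hyd]
    ring)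
  obtain ⟨Y, hYd⟩ : ∃ Y : α → ℝ, Y = fun z => (y z)⁻¹ := ⟨_, rfl⟩
  rw [← hYd] at hYb
  have hyY : ∀ᶠ z in l, y z * Y z = 1 := by
    filter_upwards [hy0] with z e1
    rw [hYd]
    exact mul_inv_cancel₀ e1.ne'
  simp only [htz] at hW₂
  obtain ⟨W₄, hW₄d⟩ : ∃ W : α → ℝ, W = fun z =>
    (W₃ z - n z * n z * (1 / 2) - 4 * W₂ z - n z * t z * W₂ z) * Y z * (1 / 2) := ⟨_, rfl⟩
  have hW₄b : Bdd l W₄ := by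
    rw [hW₄d]
    (repeat' first
        | assumption
        | exact Bdd.const _
        | apply Bdd.add
        | apply Bdd.sub
        | apply Bdd.neg
        | apply Bdd.mul)
  have hW₄ : ∀ᶠ z in l, sr z = 2 * r z + n z / 2 + t z * W₄ z := by
    filter_upwards [hW₃, hW₂, hyY, hsr, hrt] with z e1 e2 e3 e4 e5
    have e6 : y z * W₄ z =
        (W₃ z - n z * n z * (1 / 2) - 4 * W₂ z - n z * t z * W₂ z) * (1 / 2) := by
      rw [hW₄d]
      linear_combination
        (W₃ z - n z * n z * (1 / 2) - 4 * W₂ z - n z * t z * W₂ z) * (1 / 2) * e3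
    have e7 : 2 * y z * (sr z * t z) = 4 + 3 * n z * t z + t z ^ 2 * W₃ z := by
      rw [← e1, ← e4, hyd]
      ring
    have e8 : y z * (sr z * t z) = y z * (2 + n z * t z / 2 + t z ^ 2 * W₄ z) := by
      linear_combination e7 / 2 - t z ^ 2 * e6 - (2 + n z * t z / 2) * e2
    have e9 : sr z * t z = 2 + n z * t z / 2 + t z ^ 2 * W₄ z := by
      linear_combination Y z * e8 - (sr z * t z - (2 + n z * t z / 2 + t z ^ 2 * W₄ z)) * e3
    linear_combination r z * e9 + (n z / 2 + t z * W₄ z - sr z) * e5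
  obtain ⟨p, hpd⟩ : ∃ p : α → ℝ, p = fun z => k z * (1 / 2) - n z * nu z * (1 / 4) := ⟨_, rfl⟩
  have hpb : Bdd l p := by
    rw [hpd]
    (repeat' first
        | assumption
        | exact Bdd.const _
        | apply Bdd.add
        | apply Bdd.sub
        | apply Bdd.neg
        | apply Bdd.mul)
  obtain ⟨W₆, hW₆d⟩ : ∃ W : α → ℝ, W = fun z =>
    (W₅ z - n z * p z - W₂ z * nu z - 2 * t z * W₂ z * p z) * Y z * (1 / 2) := ⟨_, rfl⟩
  have hW₆b : Bdd l W₆ := by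
    rw [hW₆d]
    (repeat' first
        | assumption
        | exact Bdd.const _
        | apply Bdd.add
        | apply Bdd.sub
        | apply Bdd.neg
        | apply Bdd.mul)
  have hW₆ : ∀ᶠ z in l, su z = r z * nu z / 2 + p z + t z * W₆ z := by
    filter_upwards [hW₅, hW₂, hyY, hsu, hrt] with z e1 e2 e3 e4 e5
    have e6 : y z * W₆ z =
        (W₅ z - n z * p z - W₂ z * nu z - 2 * t z * W₂ z * p z) * (1 / 2) := by
      rw [hW₆d]
      linear_combination
        (W₅ z - n z * p z - W₂ z * nu z - 2 * t z * W₂ z * p z) * (1 / 2) * e3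
    have e7 : 2 * y z * (su z * t z) = nu z + k z * t z + t z ^ 2 * W₅ z := by
      rw [← e1, ← e4, hyd]
      ring
    have e10 : 2 * p z + n z * nu z / 2 = k z := by rw [hpd]; ring
    have e8 : y z * (su z * t z) = y z * (nu z / 2 + t z * p z + t z ^ 2 * W₆ z) := by
      linear_combination e7 / 2 - t z ^ 2 * e6 - (nu z / 2 + t z * p z) * e2 - t z / 2 * e10
    have e9 : su z * t z = nu z / 2 + t z * p z + t z ^ 2 * W₆ z := by
      linear_combination Y z * e8 - (su z * t z - (nu z / 2 + t z * p z + t z ^ 2 * W₆ z)) * e3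
    linear_combination r z * e9 + (p z + t z * W₆ z - su z) * e5
  -- the component `g¹¹`
  obtain ⟨V, hVd⟩ : ∃ V : α → ℝ, V = fun z => Y z * Y z * (t z * t z * c z * w₀ z * w₀ z -
      2 * (t z * t z * b z) * w₀ z * w₁ z + t z * t z * a z * w₁ z * w₁ z) - G z := ⟨_, rfl⟩
  have hVb : Bdd l V := by
    rw [hVd]
    (repeat' first
        | assumption
        | exact Bdd.const _
        | apply Bdd.add
        | apply Bdd.sub
        | apply Bdd.neg
        | apply Bdd.mul)
  have hV : ∀ᶠ z in l, g11 z = -1 - nu z / 2 + 2 * M z * t z + t z ^ 2 * V z := by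
    filter_upwards [hg11, hrt, hs0, hr0] with z e1 e2 e3 e4
    have e6 : t z = (r z)⁻¹ := (htz z).symm
    rw [e1, hVd, hYd, hyd, hnud]
    simp only [e6]
    field_simp
    ring
  refine ⟨hW₂b.congr ?_, hW₄b.congr ?_, ?_⟩
  · filter_upwards [hW₂, hrt] with z e1 e2
    have e3 : s z * t z ^ 2 = 1 + n z * t z / 2 + t z ^ 2 * W₂ z := by rw [← e1, hyd]
    rw [hnd] at e3
    linear_combination r z ^ 2 * e3 +
      (W₂ z * (r z * t z + 1) - s z * (r z * t z + 1) - (n₀ z + n₂ z) * r z / 2) * e2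
  · filter_upwards [hW₄, hrt] with z e1 e2
    rw [e1, hnd]
    linear_combination W₄ z * e2
  · have h : Bdd l fun z => 2 * V z + n z * M z + n z * V z * t z * (1 / 2) +
        W₄ z * (-(nu z * (1 / 2)) + 2 * M z * t z + t z * t z * V z) + 2 * W₆ z := by
      (repeat' first
        | assumption
        | exact Bdd.const _
        | apply Bdd.add
        | apply Bdd.sub
        | apply Bdd.neg
        | apply Bdd.mul)
    refine h.congr ?_
    filter_upwards [hW₄, hW₆, hV, hrt] with z e1 e2 e3 e4
    have e5 : 2 * p z + n z * nu z / 2 = k z := by rw [hpd]; ring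
    rw [hkd] at e5
    have e7 : n z * nu z = (n₀ z + n₂ z) * (n₀u z + n₂u z) := by rw [hnd, hnud]; ring
    have e8 : sr z + g11 z * sr z + 2 * su z =
        4 * M z + 2 * p z - n z * nu z / 4 + t z * (2 * V z + n z * M z +
          n z * V z * t z * (1 / 2) +
          W₄ z * (-(nu z * (1 / 2)) + 2 * M z * t z + t z * t z * V z) + 2 * W₆ z) := by
      rw [e1, e2, e3]
      linear_combination (4 * M z + 2 * t z * V z) * e4
    rw [e8]
    linear_combination r z * e5 - 3 / 4 * r z * e7 + (2 * V z + n z * M z +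
          n z * V z * t z * (1 / 2) +
          W₄ z * (-(nu z * (1 / 2)) + 2 * M z * t z + t z * t z * V z) + 2 * W₆ z) * e4

end Expansion

/-! ### Bounds for the coefficients of the expansions -/

theorem sqrt_conf (x : E2) : √(conf x) = 2 * (1 + rsq x)⁻¹ := by
  have h := rsq_nonneg x
  have e : conf x = (2 * (1 + rsq x)⁻¹) ^ 2 := by
    rw [conf]
    field_simp
    norm_num
  rw [e, Real.sqrt_sq (by positivity)]

theorem conf_eq (x : E2) : conf x = 4 * ((1 + rsq x)⁻¹) ^ 2 := by
  rw [conf, div_eq_mul_inv, inv_pow]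

/-- A continuous function on the sphere is bounded. -/
theorem exists_bound_of_scalar {f f' : E2 → ℝ} (hf : Continuous f) (hf' : Continuous f')
    (h : ∀ x ≠ 0, f x = f' (sinv x)) : ∃ C, ∀ x, |f x| ≤ C := by
  obtain ⟨C, -, hC⟩ := exists_decay_bound (α := Unit) (K := Set.univ) isCompact_univ
    (f := fun _ => f) (g := fun _ => f') (hf.comp continuous_snd).continuousOn
    (hf'.comp continuous_snd).continuousOn 0 (by
      intro _ _ x hx
      simp [h x hx])
  exact ⟨C, fun x => by simpa using hC () trivial x⟩

/-- A continuous field of covectors on the sphere is bounded. -/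
theorem exists_bound_of_covec {f f' : Fin 2 → E2 → ℝ} (hf : ∀ A, Continuous (f A))
    (hf' : ∀ A, Continuous (f' A))
    (h : ∀ x ≠ 0, ∀ A, f A x = jac x 0 A * f' 0 (sinv x) + jac x 1 A * f' 1 (sinv x)) (A : Fin 2) :
    ∃ C, ∀ x, |f A x / √(conf x)| ≤ C := by
  obtain ⟨C, -, hC⟩ := exists_decay_bound (α := Unit) (K := Set.univ) isCompact_univ
    (f := fun _ => f A) (g := fun _ y => 3 * (|f' 0 y| + |f' 1 y|))
    ((hf A).comp continuous_snd).continuousOn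
    (((((hf' 0).abs.add (hf' 1).abs).const_mul 3).comp continuous_snd).continuousOn) 1 (by
      intro _ _ x hx
      have hj := fun B => abs_jac_le hx B A
      rw [h x hx A, pow_one, abs_of_nonneg (a := 3 * _) (by positivity)]
      calc _ ≤ |jac x 0 A| * |f' 0 (sinv x)| + |jac x 1 A| * |f' 1 (sinv x)| := by
            rw [← abs_mul, ← abs_mul]; exact abs_add_le _ _
        _ ≤ 3 * (rsq x)⁻¹ * |f' 0 (sinv x)| + 3 * (rsq x)⁻¹ * |f' 1 (sinv x)| := by
            gcongr <;> exact hj _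
        _ = _ := by ring)
  refine ⟨C / 2, fun x => ?_⟩
  have h1 := hC () trivial x
  have h0 := rsq_nonneg x
  rw [abs_div, abs_of_nonneg (Real.sqrt_nonneg _), div_le_iff₀ (Real.sqrt_pos.2 (conf_pos x)),
    sqrt_conf]
  linarith

/-- A continuous field of covariant tensors of rank two on the sphere is bounded. -/
theorem exists_bound_of_bilin {f f' : Fin 2 → Fin 2 → E2 → ℝ} (hf : ∀ A B, Continuous (f A B))
    (hf' : ∀ A B, Continuous (f' A B))
    (h : ∀ x ≠ 0, ∀ A B, f A B x =
      jac x 0 A * (jac x 0 B * f' 0 0 (sinv x) + jac x 1 B * f' 0 1 (sinv x)) +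
      jac x 1 A * (jac x 0 B * f' 1 0 (sinv x) + jac x 1 B * f' 1 1 (sinv x))) (A B : Fin 2) :
    ∃ C, ∀ x, |f A B x / conf x| ≤ C := by
  obtain ⟨C, -, hC⟩ := exists_decay_bound (α := Unit) (K := Set.univ) isCompact_univ
    (f := fun _ => f A B)
    (g := fun _ y => 9 * (|f' 0 0 y| + |f' 0 1 y| + (|f' 1 0 y| + |f' 1 1 y|)))
    ((hf A B).comp continuous_snd).continuousOn
    ((((((hf' 0 0).abs.add (hf' 0 1).abs).add ((hf' 1 0).abs.add (hf' 1 1).abs)).const_mul 9).comp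
      continuous_snd).continuousOn) 2 (by
      intro _ _ x hx
      have hj := fun A B => abs_jac_le hx A B
      rw [h x hx A B, abs_of_nonneg (a := 9 * _) (by positivity)]
      calc _ ≤ |jac x 0 A| * (|jac x 0 B| * |f' 0 0 (sinv x)| + |jac x 1 B| * |f' 0 1 (sinv x)|) +
              |jac x 1 A| * (|jac x 0 B| * |f' 1 0 (sinv x)| + |jac x 1 B| * |f' 1 1 (sinv x)|) := by
            refine (abs_add_le _ _).trans (add_le_add ?_ ?_) <;>
            · rw [abs_mul]
              refine mul_le_mul_of_nonneg_left ?_ (abs_nonneg _)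
              rw [← abs_mul, ← abs_mul]
              exact abs_add_le _ _
        _ ≤ 3 * (rsq x)⁻¹ * (3 * (rsq x)⁻¹ * |f' 0 0 (sinv x)| +
                3 * (rsq x)⁻¹ * |f' 0 1 (sinv x)|) +
              3 * (rsq x)⁻¹ * (3 * (rsq x)⁻¹ * |f' 1 0 (sinv x)| +
                3 * (rsq x)⁻¹ * |f' 1 1 (sinv x)|) := by
            have h0 := rsq_pos hx
            gcongr <;> exact hj _ _
        _ = _ := by ring)
  refine ⟨C / 4, fun x => ?_⟩
  have h1 := hC () trivial x
  rw [abs_div, abs_of_pos (conf_pos x), div_le_iff₀ (conf_pos x), conf_eq]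
  linarith

/-- The coefficients of the expansions count as smooth functions which do not depend on `r`. -/
theorem Sm.of_coeff {u₀ u₁ r₀ : ℝ} {f : ℝ → E2 → ℝ}
    (hf : ContDiffOn ℝ ∞ (fun z : ℝ × E2 => f z.1 z.2) (Set.Ioo u₀ u₁ ×ˢ Set.univ)) :
    Sm u₀ u₁ r₀ fun u _ x => f u x := by
  have h : ContDiffOn ℝ ∞ (fun z : ℝ × ℝ × E2 => ((z.1, z.2.2) : ℝ × E2)) (dom u₀ u₁ r₀) := by
    fun_prop
  exact ContDiffOn.comp (g := fun z : ℝ × E2 => f z.1 z.2) hf h fun z hz => ⟨hz.1, trivial⟩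

section Coeff

variable {u₀ u₁ u : ℝ} {f : ℝ → E2 → ℝ}

theorem continuous_coeff
    (hf : ContDiffOn ℝ ∞ (fun z : ℝ × E2 => f z.1 z.2) (Set.Ioo u₀ u₁ ×ˢ Set.univ))
    (hu : u ∈ Set.Ioo u₀ u₁) : Continuous (f u) :=
  ((Sm.of_coeff (r₀ := 0) hf).slice hu one_pos).continuous

theorem continuous_coeff_deriv
    (hf : ContDiffOn ℝ ∞ (fun z : ℝ × E2 => f z.1 z.2) (Set.Ioo u₀ u₁ ×ˢ Set.univ))
    (hu : u ∈ Set.Ioo u₀ u₁) : Continuous fun x => deriv (fun v => f v x) u :=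
  ((Sm.of_coeff (r₀ := 0) hf).deriv_u.slice hu one_pos).continuous

theorem hasDerivAt_coeff
    (hf : ContDiffOn ℝ ∞ (fun z : ℝ × E2 => f z.1 z.2) (Set.Ioo u₀ u₁ ×ˢ Set.univ))
    (hu : u ∈ Set.Ioo u₀ u₁) (x : E2) :
    HasDerivAt (fun v => f v x) (deriv (fun v => f v x) u) u :=
  (Sm.of_coeff (r₀ := 0) hf).hasDerivAt_u hu one_pos x

end Coeff

/-- The components of a smooth tensor field and their `u`-derivatives, which transform in the same
way, are bounded in units of the round metric. -/
theorem exists_bound_bilinComp {u₀ u₁ u : ℝ} {w : ℝ → S2 → Bilin}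
    (hw : ∀ b A B, ContDiffOn ℝ ∞ (fun z : ℝ × E2 => bilinComp b (w z.1) z.2 A B)
      (Set.Ioo u₀ u₁ ×ˢ Set.univ)) (hu : u ∈ Set.Ioo u₀ u₁) (b : Pole) (A B : Fin 2) :
    (∃ C, ∀ x, |bilinComp b (w u) x A B / conf x| ≤ C) ∧
      ∃ C, ∀ x, |deriv (fun v => bilinComp b (w v) x A B) u / conf x| ≤ C := by
  constructor
  · exact exists_bound_of_bilin (f := fun A B x => bilinComp b (w u) x A B)
      (f' := fun A B x => bilinComp b.other (w u) x A B)
      (fun A B => continuous_coeff (f := fun v x => bilinComp b (w v) x A B) (hw b A B) hu)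
      (fun A B => continuous_coeff (f := fun v x => bilinComp b.other (w v) x A B)
        (hw b.other A B) hu)
      (fun x hx A B => bilinComp_transform b (w u) hx A B) A B
  · refine exists_bound_of_bilin (f := fun A B x => deriv (fun v => bilinComp b (w v) x A B) u)
      (f' := fun A B x => deriv (fun v => bilinComp b.other (w v) x A B) u)
      (fun A B => continuous_coeff_deriv (f := fun v x => bilinComp b (w v) x A B) (hw b A B) hu)
      (fun A B => continuous_coeff_deriv (f := fun v x => bilinComp b.other (w v) x A B)
        (hw b.other A B) hu)
      (fun x hx A B => ?_) A B
    simp only [bilinComp_transform b _ hx]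
    have hd := fun A B => hasDerivAt_coeff (f := fun v x => bilinComp b.other (w v) x A B)
      (hw b.other A B) hu (sinv x)
    exact (((((hd 0 0).const_mul _).add ((hd 0 1).const_mul _)).const_mul _).add
      ((((hd 1 0).const_mul _).add ((hd 1 1).const_mul _)).const_mul _)).deriv

theorem exists_bound_covecComp {u₀ u₁ u : ℝ} {w : ℝ → S2 → Covec}
    (hw : ∀ b A, ContDiffOn ℝ ∞ (fun z : ℝ × E2 => covecComp b (w z.1) z.2 A)
      (Set.Ioo u₀ u₁ ×ˢ Set.univ)) (hu : u ∈ Set.Ioo u₀ u₁) (b : Pole) (A : Fin 2) :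
    ∃ C, ∀ x, |covecComp b (w u) x A / √(conf x)| ≤ C :=
  exists_bound_of_covec (f := fun A x => covecComp b (w u) x A)
    (f' := fun A x => covecComp b.other (w u) x A)
    (fun A => continuous_coeff (f := fun v x => covecComp b (w v) x A) (hw b A) hu)
    (fun A => continuous_coeff (f := fun v x => covecComp b.other (w v) x A) (hw b.other A) hu)
    (fun _ hx A => covecComp_transform b (w u) hx A) A

/-- The function `n` is minus the trace of `n_AB` in units of the round metric. -/
theorem Coeffs.n_eq (a : Coeffs) (b : Pole) (u : ℝ) (x : E2) :
    a.n b u x = -(bilinComp b (a.nT u) x 0 0 / conf x + bilinComp b (a.nT u) x 1 1 / conf x) := by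
  have h : (roundComp b x)⁻¹ = (conf x)⁻¹ • (1 : Matrix (Fin 2) (Fin 2) ℝ) := by
    apply Matrix.inv_eq_left_inv
    rw [roundComp_eq]
    simp [smul_smul, (conf_pos x).ne']
  simp [Coeffs.n, h, Fin.sum_univ_two, div_eq_inv_mul]

/-! ### The remainders in the charts -/

section BigO

variable {ι ι' : Type*} {k : ℕ} {u : ℝ} {F : ℝ → ℝ → ι → ℝ}

theorem IsBigOTerm.comp (h : IsBigOTerm k u F) (φ : ι' → ι) :
    IsBigOTerm k u fun v r i => F v r (φ i) := by
  obtain ⟨C, R, hR, h⟩ := h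
  exact ⟨C, R, hR, fun r hr i => h r hr (φ i)⟩

/-- The filter `comap Prod.fst atTop` describes `r → ∞`, uniformly in the second variable. -/
theorem bdd_of_le_div {E : Type*} {f : ℝ × E → ℝ} {k : ℕ} {C R : ℝ}
    (h : ∀ r ≥ R, ∀ i, |f (r, i)| ≤ C / r ^ k) :
    Bdd (comap Prod.fst atTop) fun z => f z * z.1 ^ k := by
  refine ⟨C, eventually_comap.2 ?_⟩
  filter_upwards [eventually_ge_atTop R, eventually_gt_atTop 0] with r h1 h2 z hz
  subst hz
  rw [abs_mul, abs_of_pos (pow_pos h2 k), ← le_div_iff₀ (pow_pos h2 k)]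
  exact h z.1 h1 z.2

theorem IsBigOTerm.bdd (h : IsBigOTerm k u F) :
    Bdd (comap Prod.fst atTop) (fun z : ℝ × ι => F u z.1 z.2 * z.1 ^ k) ∧
    Bdd (comap Prod.fst atTop)
      (fun z : ℝ × ι => deriv (fun r => F u r z.2) z.1 * z.1 ^ (k + 1)) ∧
    Bdd (comap Prod.fst atTop) (fun z : ℝ × ι => deriv (fun v => F v z.1 z.2) u * z.1 ^ k) := by
  obtain ⟨C, R, -, h⟩ := h
  exact ⟨bdd_of_le_div fun r hr i => (h r hr i).1, bdd_of_le_div fun r hr i => (h r hr i).2.1,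
    bdd_of_le_div fun r hr i => (h r hr i).2.2⟩

theorem bdd_of_bound {E : Type*} {f : E → ℝ} (h : ∃ C, ∀ x, |f x| ≤ C) (l : Filter (ℝ × E)) :
    Bdd l fun z => f z.2 := by
  obtain ⟨C, h⟩ := h
  exact ⟨C, Eventually.of_forall fun z => h z.2⟩

end BigO

/-- The coordinate vector `∂_A`, normalized with respect to the round metric. -/
def unitFrame (b : Pole) (A : Fin 2) (x : E2) : E3 := (√(conf x))⁻¹ • frame b A x

theorem inner_frame (b : Pole) (A B : Fin 2) (x : E2) :
    ⟪frame b A x, frame b B x⟫ = conf x * (if A = B then 1 else 0) := by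
  have h := congrFun (congrFun (roundComp_eq b x) A) B
  simpa [roundComp, Matrix.one_apply] using h

theorem inner_unitFrame (b : Pole) (A B : Fin 2) (x : E2) :
    ⟪unitFrame b A x, unitFrame b B x⟫ = if A = B then 1 else 0 := by
  have h := conf_pos x
  have h1 : √(conf x) * √(conf x) = conf x := Real.mul_self_sqrt h.le
  have h2 := Real.sqrt_pos.2 h
  rw [unitFrame, unitFrame, real_inner_smul_left, real_inner_smul_right, inner_frame]
  field_simp
  rw [Real.sq_sqrt h.le]

theorem unitFrame_unit (b : Pole) (A : Fin 2) (x : E2) :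
    IsTangent (chart b x) (unitFrame b A x) ∧ ‖unitFrame b A x‖ = 1 := by
  constructor
  · unfold IsTangent unitFrame
    rw [real_inner_smul_right, frame_tangent b A x, mul_zero]
  · have h := inner_unitFrame b A A x
    rw [real_inner_self_eq_norm_sq, if_pos rfl] at h
    exact (sq_eq_sq₀ (norm_nonneg _) zero_le_one).1 (by rw [h]; norm_num)

theorem bilin_unitFrame (b : Pole) (w : S2 → Bilin) (A B : Fin 2) (x : E2) :
    w (chart b x) (unitFrame b A x) (unitFrame b B x) = bilinComp b w x A B / conf x := by
  have h1 : √(conf x) * √(conf x) = conf x := Real.mul_self_sqrt (conf_pos x).le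
  simp only [unitFrame, map_smul, smul_apply, smul_eq_mul, bilinComp, Matrix.of_apply]
  nth_rewrite 3 [← h1]
  rw [div_eq_mul_inv, mul_inv]
  ring

theorem covec_unitFrame (b : Pole) (w : S2 → Covec) (A : Fin 2) (x : E2) :
    w (chart b x) (unitFrame b A x) = covecComp b w x A / √(conf x) := by
  simp only [unitFrame, map_smul, smul_eq_mul, covecComp]
  rw [div_eq_inv_mul]

section Flat

variable {g : BSMetric} {a : Coeffs} {u₀ u₁ u : ℝ}

theorem IsAsymptoticallyFlat.ang_comp (hf : IsAsymptoticallyFlat g a u₀ u₁)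
    (hu : u ∈ Set.Ioo u₀ u₁) (b : Pole) (A B : Fin 2) :
    IsBigOTerm 1 u fun v r x => g.h b v r x A B / conf x -
      (-(if A = B then 1 else 0) * r ^ 2 + bilinComp b (a.nT v) x A B / conf x * r +
        bilinComp b (a.mT v) x A B / conf x) := by
  have h := (hf.exp_ang u hu).comp (ι' := E2) fun x =>
    ⟨(chart b x, unitFrame b A x, unitFrame b B x), unitFrame_unit b A x, unitFrame_unit b B x⟩
  simp only [inner_unitFrame, bilin_unitFrame] at h
  exact h

theorem IsAsymptoticallyFlat.om_comp (hf : IsAsymptoticallyFlat g a u₀ u₁)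
    (hu : u ∈ Set.Ioo u₀ u₁) (b : Pole) (A : Fin 2) :
    IsBigOTerm 2 u fun v r x => g.omc b A v r x / √(conf x) -
      (covecComp b (a.ψ v) x A / √(conf x) + covecComp b (a.κ v) x A / √(conf x) / r) := by
  have h := (hf.exp_om u hu).comp (ι' := E2) fun x =>
    ⟨(chart b x, unitFrame b A x), unitFrame_unit b A x⟩
  simp only [covec_unitFrame] at h
  exact h

end Flat

/-! ### The asymptotics of the density and of the mass aspect -/

section

variable {g : BSMetric} {a : Coeffs} {u₀ u₁ r₀ u : ℝ}

theorem BSMetric.IsRegular.density_sq (hg : g.IsRegular u₀ u₁ r₀) (hu : u ∈ Set.Ioo u₀ u₁) {r : ℝ}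
    (hr : r₀ < r) (b : Pole) (x : E2) :
    g.density b u r x * g.density b u r x = g.hd b u r x := by
  rw [hg.density_eq hu hr, Real.mul_self_sqrt (hg.hd_pos hu hr b x).le]

/-- The expansion of a component of `g_AB` and of its derivatives, divided by the conformal factor. -/
theorem IsAsymptoticallyFlat.ang_expansion (hf : IsAsymptoticallyFlat g a u₀ u₁)
    (hu : u ∈ Set.Ioo u₀ u₁) (b : Pole) (A B : Fin 2)
    (hsm : Sm u₀ u₁ r₀ fun v r x => g.h b v r x A B) :
    ∃ P Q U : ℝ × E2 → ℝ, Bdd (comap Prod.fst atTop) P ∧ Bdd (comap Prod.fst atTop) Q ∧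
      Bdd (comap Prod.fst atTop) U ∧ ∀ᶠ z : ℝ × E2 in comap Prod.fst atTop,
      g.h b u z.1 z.2 A B / conf z.2 = -(if A = B then 1 else 0) * z.1 ^ 2 +
        bilinComp b (a.nT u) z.2 A B / conf z.2 * z.1 + bilinComp b (a.mT u) z.2 A B / conf z.2 +
        z.1⁻¹ * P z ∧
      deriv (fun r => g.h b u r z.2 A B) z.1 / conf z.2 = -(if A = B then 1 else 0) * 2 * z.1 +
        bilinComp b (a.nT u) z.2 A B / conf z.2 + z.1⁻¹ ^ 2 * Q z ∧
      deriv (fun v => g.h b v z.1 z.2 A B) u / conf z.2 =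
        deriv (fun v => bilinComp b (a.nT v) z.2 A B) u / conf z.2 * z.1 +
        deriv (fun v => bilinComp b (a.mT v) z.2 A B) u / conf z.2 + z.1⁻¹ * U z := by
  obtain ⟨h1, h2, h3⟩ := (hf.ang_comp hu b A B).bdd
  refine ⟨_, _, _, h1, h2, h3, ?_⟩
  have hev : ∀ᶠ z : ℝ × E2 in comap Prod.fst atTop, max r₀ 0 < z.1 :=
    tendsto_comap.eventually (eventually_gt_atTop _)
  filter_upwards [hev] with z hz
  have hz0 : z.1 ≠ 0 := ((le_max_right _ _).trans_lt hz).ne'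
  have hzr : r₀ < z.1 := (le_max_left _ _).trans_lt hz
  have d1 := (hsm.hasDerivAt_r hu hzr z.2).div_const (conf z.2)
  have d2 := (hsm.hasDerivAt_u hu hzr z.2).div_const (conf z.2)
  have dn := (hasDerivAt_coeff (f := fun v x => bilinComp b (a.nT v) x A B)
    (hf.smooth.smooth_nT b A B) hu z.2).div_const (conf z.2)
  have dm := (hasDerivAt_coeff (f := fun v x => bilinComp b (a.mT v) x A B)
    (hf.smooth.smooth_mT b A B) hu z.2).div_const (conf z.2)
  have e1 := (d1.sub ((((hasDerivAt_pow 2 z.1).const_mul (-(if A = B then (1 : ℝ) else 0))).add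
    ((hasDerivAt_id z.1).const_mul (bilinComp b (a.nT u) z.2 A B / conf z.2))).add_const
    (bilinComp b (a.mT u) z.2 A B / conf z.2))).deriv
  have e2 := (d2.sub (((dn.mul_const z.1).const_add
    (-(if A = B then (1 : ℝ) else 0) * z.1 ^ 2)).add dm)).deriv
  refine ⟨?_, ?_, ?_⟩
  · field_simp
    ring
  · erw [e1]
    field_simp
    norm_num
    ring
  · erw [e2]
    field_simp
    ring

theorem IsAsymptoticallyFlat.om_bdd (hf : IsAsymptoticallyFlat g a u₀ u₁)
    (hu : u ∈ Set.Ioo u₀ u₁) (b : Pole) (A : Fin 2) :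
    Bdd (comap Prod.fst atTop) fun z : ℝ × E2 => g.omc b A u z.1 z.2 / √(conf z.2) := by
  have ht := bdd_inv (tendsto_comap : Tendsto (Prod.fst : ℝ × E2 → ℝ) _ atTop)
  have h1 := bdd_of_bound (exists_bound_covecComp hf.smooth.smooth_ψ hu b A) (comap Prod.fst atTop)
  have h2 := bdd_of_bound (exists_bound_covecComp hf.smooth.smooth_κ hu b A) (comap Prod.fst atTop)
  refine ((h1.add (h2.mul ht)).add ((hf.om_comp hu b A).bdd.1.mul (ht.mul ht))).congr ?_
  have hev : ∀ᶠ z : ℝ × E2 in comap Prod.fst atTop, 0 < z.1 :=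
    tendsto_comap.eventually (eventually_gt_atTop _)
  filter_upwards [hev] with z hz
  have := hz.ne'
  field_simp
  ring

theorem IsAsymptoticallyFlat.exists_bound_M (hf : IsAsymptoticallyFlat g a u₀ u₁)
    (hu : u ∈ Set.Ioo u₀ u₁) (b : Pole) : ∃ C, ∀ x, |a.M u (chart b x)| ≤ C :=
  exists_bound_of_scalar
    (continuous_coeff (f := fun v x => a.M v (chart b x)) (hf.smooth.smooth_M b) hu)
    (continuous_coeff (f := fun v x => a.M v (chart b.other x)) (hf.smooth.smooth_M b.other) hu)
    fun x hx => by rw [chart_sinv b hx]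

/-- Four times the mass aspect, expressed by the coefficients of the expansions. -/
def fourMass (a : Coeffs) (b : Pole) (u : ℝ) (x : E2) : ℝ :=
  4 * a.M u (chart b x) +
    (-(deriv (fun v => bilinComp b (a.mT v) x 0 0) u / conf x) -
      deriv (fun v => bilinComp b (a.mT v) x 1 1) u / conf x +
      bilinComp b (a.nT u) x 1 1 / conf x * (deriv (fun v => bilinComp b (a.nT v) x 0 0) u / conf x) +
      bilinComp b (a.nT u) x 0 0 / conf x * (deriv (fun v => bilinComp b (a.nT v) x 1 1) u / conf x) -
      2 * (bilinComp b (a.nT u) x 0 1 / conf x) *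
        (deriv (fun v => bilinComp b (a.nT v) x 0 1) u / conf x)) -
    3 / 4 * ((bilinComp b (a.nT u) x 0 0 / conf x + bilinComp b (a.nT u) x 1 1 / conf x) *
      (deriv (fun v => bilinComp b (a.nT v) x 0 0) u / conf x +
        deriv (fun v => bilinComp b (a.nT v) x 1 1) u / conf x))

theorem continuous_bilinComp_div_conf {w : ℝ → S2 → Bilin}
    (hw : ∀ b A B, ContDiffOn ℝ ∞ (fun z : ℝ × E2 => bilinComp b (w z.1) z.2 A B)
      (Set.Ioo u₀ u₁ ×ˢ Set.univ)) (hu : u ∈ Set.Ioo u₀ u₁) (b : Pole) (A B : Fin 2) :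
    (Continuous fun x => bilinComp b (w u) x A B / conf x) ∧
      Continuous fun x => deriv (fun v => bilinComp b (w v) x A B) u / conf x := by
  have hc : ∀ x, conf x ≠ 0 := fun x => (conf_pos x).ne'
  exact ⟨(continuous_coeff (f := fun v x => bilinComp b (w v) x A B) (hw b A B) hu).div
      contDiff_conf.continuous hc,
    (continuous_coeff_deriv (f := fun v x => bilinComp b (w v) x A B) (hw b A B) hu).div
      contDiff_conf.continuous hc⟩

theorem Coeffs.IsSmooth.continuous_fourMass (ha : a.IsSmooth u₀ u₁) (hu : u ∈ Set.Ioo u₀ u₁) (b : Pole) :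
    Continuous (fourMass a b u) := by
  have hM := continuous_coeff (f := fun v x => a.M v (chart b x)) (ha.smooth_M b) hu
  have hn := fun A B => continuous_bilinComp_div_conf ha.smooth_nT hu b A B
  have hm := fun A B => continuous_bilinComp_div_conf ha.smooth_mT hu b A B
  exact ((continuous_const.mul hM).add (((((hm 0 0).2.neg.sub (hm 1 1).2).add
    ((hn 1 1).1.mul (hn 0 0).2)).add ((hn 0 0).1.mul (hn 1 1).2)).sub
    ((continuous_const.mul (hn 0 1).1).mul (hn 0 1).2))).sub (continuous_const.mul
    (((hn 0 0).1.add (hn 1 1).1).mul ((hn 0 0).2.add (hn 1 1).2)))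

theorem Coeffs.IsSmooth.continuous_n (ha : a.IsSmooth u₀ u₁) (hu : u ∈ Set.Ioo u₀ u₁) (b : Pole) :
    Continuous (a.n b u) := by
  have hn := fun A B => continuous_bilinComp_div_conf ha.smooth_nT hu b A B
  exact ((hn 0 0).1.add (hn 1 1).1).neg.congr fun x => (a.n_eq b u x).symm

theorem Coeffs.IsSmooth.exists_bound_n (ha : a.IsSmooth u₀ u₁) (hu : u ∈ Set.Ioo u₀ u₁) (b : Pole) :
    ∃ C, ∀ x, |a.n b u x| ≤ C := by
  obtain ⟨C, hC⟩ := (exists_bound_bilinComp ha.smooth_nT hu b 0 0).1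
  obtain ⟨D, hD⟩ := (exists_bound_bilinComp ha.smooth_nT hu b 1 1).1
  refine ⟨C + D, fun x => ?_⟩
  rw [a.n_eq, abs_neg]
  exact (abs_add_le _ _).trans (add_le_add (hC x) (hD x))

/-- The expansions of `σ`, of `σ_{,r}` and of the mass aspect quotient. The remainders are uniform over
the sphere. -/
theorem IsAsymptoticallyFlat.density_expansion (hf : IsAsymptoticallyFlat g a u₀ u₁)
    (hg : g.IsRegular u₀ u₁ r₀) (hu : u ∈ Set.Ioo u₀ u₁) (b : Pole) :
    Bdd (comap Prod.fst atTop) (fun z : ℝ × E2 => g.density b u z.1 z.2 / conf z.2 -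
      (z.1 ^ 2 + a.n b u z.2 * z.1 / 2)) ∧
    Bdd (comap Prod.fst atTop) (fun z : ℝ × E2 =>
      (deriv (fun r => g.density b u r z.2) z.1 / conf z.2 - (2 * z.1 + a.n b u z.2 / 2)) * z.1) ∧
    Bdd (comap Prod.fst atTop) (fun z : ℝ × E2 =>
      (4 * g.massQuotient b u z.1 z.2 - fourMass a b u z.2) * z.1) := by
  obtain ⟨P₀, Q₀, U₀, hP₀, hQ₀, hU₀, h₀⟩ := hf.ang_expansion hu b 0 0 (hg.sm_ha b)
  obtain ⟨P₁, Q₁, U₁, hP₁, hQ₁, hU₁, h₁⟩ := hf.ang_expansion hu b 0 1 (hg.sm_hb b)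
  obtain ⟨P₂, Q₂, U₂, hP₂, hQ₂, hU₂, h₂⟩ := hf.ang_expansion hu b 1 1 (hg.sm_hc b)
  have hN := fun A B => exists_bound_bilinComp hf.smooth.smooth_nT hu b A B
  have hMm := fun A B => exists_bound_bilinComp hf.smooth.smooth_mT hu b A B
  have hev : ∀ᶠ z : ℝ × E2 in comap Prod.fst atTop, max r₀ 0 < z.1 :=
    tendsto_comap.eventually (eventually_gt_atTop _)
  have key := mass_expansion (α := ℝ × E2) (l := comap Prod.fst atTop) (r := Prod.fst)
    tendsto_comap
    (bdd_of_bound (hN 0 0).1 _) (bdd_of_bound (hN 0 1).1 _) (bdd_of_bound (hN 1 1).1 _)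
    (bdd_of_bound (hMm 0 0).1 _) (bdd_of_bound (hMm 0 1).1 _) (bdd_of_bound (hMm 1 1).1 _)
    (bdd_of_bound (hN 0 0).2 _) (bdd_of_bound (hN 0 1).2 _) (bdd_of_bound (hN 1 1).2 _)
    (bdd_of_bound (hMm 0 0).2 _) (bdd_of_bound (hMm 0 1).2 _) (bdd_of_bound (hMm 1 1).2 _)
    hP₀ hP₁ hP₂ hQ₀ hQ₁ hQ₂ hU₀ hU₁ hU₂ (hf.om_bdd hu b 0) (hf.om_bdd hu b 1)
    (bdd_of_bound (hf.exists_bound_M hu b) _) (hf.exp_g00 u hu b).bdd.1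
    (a := fun z => g.ha b u z.1 z.2 / conf z.2) (b := fun z => g.hb b u z.1 z.2 / conf z.2)
    (c := fun z => g.hc b u z.1 z.2 / conf z.2)
    (ar := fun z => deriv (fun r => g.ha b u r z.2) z.1 / conf z.2)
    (br := fun z => deriv (fun r => g.hb b u r z.2) z.1 / conf z.2)
    (cr := fun z => deriv (fun r => g.hc b u r z.2) z.1 / conf z.2)
    (au := fun z => deriv (fun v => g.ha b v z.1 z.2) u / conf z.2)
    (bu := fun z => deriv (fun v => g.hb b v z.1 z.2) u / conf z.2)
    (cu := fun z => deriv (fun v => g.hc b v z.1 z.2) u / conf z.2)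
    (s := fun z => g.density b u z.1 z.2 / conf z.2)
    (sr := fun z => deriv (fun r => g.density b u r z.2) z.1 / conf z.2)
    (su := fun z => deriv (fun v => g.density b v z.1 z.2) u / conf z.2)
    (g11 := fun z => g.g11Up b u z.1 z.2)
    (by filter_upwards [h₀] with z hz; exact hz.1.trans (by simp))
    (by filter_upwards [h₁] with z hz; exact hz.1.trans (by simp))
    (by filter_upwards [h₂] with z hz; exact hz.1.trans (by simp))
    (by filter_upwards [h₀] with z hz; exact hz.2.1.trans (by simp))
    (by filter_upwards [h₁] with z hz; exact hz.2.1.trans (by simp))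
    (by filter_upwards [h₂] with z hz; exact hz.2.1.trans (by simp))
    (by filter_upwards [h₀] with z hz; exact hz.2.2)
    (by filter_upwards [h₁] with z hz; exact hz.2.2)
    (by filter_upwards [h₂] with z hz; exact hz.2.2) ?_ ?_ ?_ ?_ ?_
  · refine ⟨key.1.congr ?_, key.2.1.congr ?_, key.2.2.congr ?_⟩
    · exact Eventually.of_forall fun z => by rw [a.n_eq]
    · exact Eventually.of_forall fun z => by rw [a.n_eq]
    · refine Eventually.of_forall fun z => ?_
      have hc := (conf_pos z.2).ne'
      congr 1
      rw [BSMetric.massQuotient, roundDensity_eq, fourMass]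
      field_simp
  · filter_upwards [hev] with z hz
    exact div_pos (hg.density_pos hu ((le_max_left _ _).trans_lt hz) b z.2) (conf_pos _)
  · filter_upwards [hev] with z hz
    have hr : r₀ < z.1 := (le_max_left _ _).trans_lt hz
    have hc := (conf_pos z.2).ne'
    have h := hg.density_sq hu hr b z.2
    rw [BSMetric.hd] at h
    field_simp
    linear_combination h
  · filter_upwards [hev] with z hz
    have hr : r₀ < z.1 := (le_max_left _ _).trans_lt hz
    have hc := (conf_pos z.2).ne'
    have e : (fun r => g.density b u r z.2 * g.density b u r z.2) =ᶠ[𝓝 z.1]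
        fun r => g.hd b u r z.2 := by
      filter_upwards [Ioi_mem_nhds hr] with r hr
      exact hg.density_sq hu hr b z.2
    have d1 := (hg.sm_density b).hasDerivAt_r hu hr z.2
    have h := ((d1.mul d1).congr_of_eventuallyEq e.symm).unique
      ((((hg.sm_ha b).hasDerivAt_r hu hr z.2).mul ((hg.sm_hc b).hasDerivAt_r hu hr z.2)).sub
        (((hg.sm_hb b).hasDerivAt_r hu hr z.2).mul ((hg.sm_hb b).hasDerivAt_r hu hr z.2)))
    field_simp
    linear_combination h
  · filter_upwards [hev] with z hz
    have hr : r₀ < z.1 := (le_max_left _ _).trans_lt hz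
    have hc := (conf_pos z.2).ne'
    have e : (fun v => g.density b v z.1 z.2 * g.density b v z.1 z.2) =ᶠ[𝓝 u]
        fun v => g.hd b v z.1 z.2 := by
      filter_upwards [Ioo_mem_nhds hu.1 hu.2] with v hv
      exact hg.density_sq hv hr b z.2
    have d1 := (hg.sm_density b).hasDerivAt_u hu hr z.2
    have h := ((d1.mul d1).congr_of_eventuallyEq e.symm).unique
      ((((hg.sm_ha b).hasDerivAt_u hu hr z.2).mul ((hg.sm_hc b).hasDerivAt_u hu hr z.2)).sub
        (((hg.sm_hb b).hasDerivAt_u hu hr z.2).mul ((hg.sm_hb b).hasDerivAt_u hu hr z.2)))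
    field_simp
    linear_combination h
  · filter_upwards [hev] with z hz
    have hr : r₀ < z.1 := (le_max_left _ _).trans_lt hz
    have hz0 : z.1 ≠ 0 := ((le_max_right _ _).trans_lt hz).ne'
    have hc := (conf_pos z.2).ne'
    have hs := hg.density_sq hu hr b z.2
    have hq : √(conf z.2) ^ 2 = conf z.2 := Real.sq_sqrt (conf_pos _).le
    have hq0 : √(conf z.2) ≠ 0 := (Real.sqrt_pos.2 (conf_pos _)).ne'
    have hd0 := (hg.hd_pos hu hr b z.2).ne'
    have dn := fun A => (hasDerivAt_coeff (f := fun v x => bilinComp b (a.nT v) x A A)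
      (hf.smooth.smooth_nT b A A) hu z.2).div_const (conf z.2)
    have hn : deriv (fun v => a.n b v z.2) u =
        -(deriv (fun v => bilinComp b (a.nT v) z.2 0 0) u / conf z.2 +
          deriv (fun v => bilinComp b (a.nT v) z.2 1 1) u / conf z.2) := by
      simp only [a.n_eq]
      exact ((dn 0).add (dn 1)).neg.deriv
    obtain ⟨o0, o1⟩ := hg.omUp_eq hu hr b z.2
    have hss : g.density b u z.1 z.2 / conf z.2 * (g.density b u z.1 z.2 / conf z.2) =
        g.hd b u z.1 z.2 / conf z.2 ^ 2 := by
      rw [← hs]; ring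
    rw [← hn, hss]
    simp only [BSMetric.g11Up, Fin.sum_univ_two, o0, o1]
    change (_ * g.omc b 0 u z.1 z.2 + _ * g.omc b 1 u z.1 z.2) - _ = _
    -- the powers of the conformal factor cancel
    have hω : (g.hd b u z.1 z.2 / conf z.2 ^ 2)⁻¹ *
        (g.hc b u z.1 z.2 / conf z.2 * (g.omc b 0 u z.1 z.2 / √(conf z.2)) *
            (g.omc b 0 u z.1 z.2 / √(conf z.2)) -
          2 * (g.hb b u z.1 z.2 / conf z.2) * (g.omc b 0 u z.1 z.2 / √(conf z.2)) *
            (g.omc b 1 u z.1 z.2 / √(conf z.2)) +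
          g.ha b u z.1 z.2 / conf z.2 * (g.omc b 1 u z.1 z.2 / √(conf z.2)) *
            (g.omc b 1 u z.1 z.2 / √(conf z.2))) =
        (g.hd b u z.1 z.2)⁻¹ * (g.hc b u z.1 z.2 * g.omc b 0 u z.1 z.2 * g.omc b 0 u z.1 z.2 -
          2 * g.hb b u z.1 z.2 * g.omc b 0 u z.1 z.2 * g.omc b 1 u z.1 z.2 +
          g.ha b u z.1 z.2 * g.omc b 1 u z.1 z.2 * g.omc b 1 u z.1 z.2) := by
      have e : ∀ p q : ℝ, p / √(conf z.2) * (q / √(conf z.2)) = p * q / conf z.2 := by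
        intro p q
        rw [div_mul_div_comm, ← pow_two, hq]
      simp only [mul_assoc, e]
      field_simp
    rw [hω]
    field_simp
    ring

end

/-! ### The limit at null infinity -/

theorem Bdd.exists_of_comap {E : Type*} {f : ℝ × E → ℝ} (h : Bdd (comap Prod.fst atTop) f) :
    ∃ C, ∀ᶠ r in atTop, ∀ i, |f (r, i)| ≤ C := by
  obtain ⟨C, hC⟩ := h
  refine ⟨C, ?_⟩
  filter_upwards [eventually_comap.1 hC] with r hr i
  exact hr (r, i) rfl

/-- A concave function on a half-line which tends to zero is nonpositive: it lies above its
chords, and the far end of a chord may be moved to infinity. -/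
theorem ConcaveOn.nonpos_of_tendsto_zero {k : ℝ → ℝ} {r₀ r : ℝ} (hk : ConcaveOn ℝ (Set.Ioi r₀) k)
    (hlim : Tendsto k atTop (𝓝 0)) (hr : r₀ < r) : k r ≤ 0 := by
  have h1 : Tendsto (fun s : ℝ => 1 / 2 * r + 1 / 2 * s) atTop atTop :=
    tendsto_atTop_add_const_left _ _ (tendsto_id.const_mul_atTop (by norm_num))
  have h2 := (hlim.const_mul (1 / 2)).const_add (1 / 2 * k r)
  have h3 := le_of_tendsto_of_tendsto h2 (hlim.comp h1) (by
    filter_upwards [eventually_gt_atTop r₀] with s hs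
    have := hk.2 (Set.mem_Ioi.2 hr) (Set.mem_Ioi.2 hs) (by norm_num : (0 : ℝ) ≤ 1 / 2)
      (by norm_num : (0 : ℝ) ≤ 1 / 2) (by norm_num)
    simpa only [smul_eq_mul, Function.comp_apply] using this)
  linarith

section

variable {g : BSMetric} {a : Coeffs} {u₀ u₁ r₀ u : ℝ}

theorem exists_bound_fourMass (hf : IsAsymptoticallyFlat g a u₀ u₁) (hu : u ∈ Set.Ioo u₀ u₁) (b : Pole) :
    ∃ C, ∀ x, |fourMass a b u x| ≤ C := by
  have top : ∀ {f : E2 → ℝ}, (∃ C, ∀ x, |f x| ≤ C) → Bdd ⊤ f :=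
    fun ⟨C, h⟩ => ⟨C, Eventually.of_forall h⟩
  have hN := fun A B => exists_bound_bilinComp hf.smooth.smooth_nT hu b A B
  have hm := fun A B => exists_bound_bilinComp hf.smooth.smooth_mT hu b A B
  have h1 := top (hN 0 0).1
  have h2 := top (hN 0 1).1
  have h3 := top (hN 1 1).1
  have h4 := top (hN 0 0).2
  have h5 := top (hN 0 1).2
  have h6 := top (hN 1 1).2
  have h7 := top (hm 0 0).2
  have h8 := top (hm 1 1).2
  have h9 := top (hf.exists_bound_M hu b)
  have h : Bdd ⊤ (fourMass a b u) :=
    (((Bdd.const 4).mul h9).add ((((h7.neg.sub h8).add (h3.mul h4)).add (h1.mul h6)).sub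
      (((Bdd.const 2).mul h2).mul h5))).sub ((Bdd.const (3 / 4)).mul ((h1.add h3).mul (h4.add h6)))
  obtain ⟨C, hC⟩ := h
  exact ⟨C, eventually_top.1 hC⟩

theorem IsAsymptoticallyFlat.tendsto_massQuotient (hf : IsAsymptoticallyFlat g a u₀ u₁)
    (hg : g.IsRegular u₀ u₁ r₀) (hu : u ∈ Set.Ioo u₀ u₁) (b : Pole) (x : E2) :
    Tendsto (fun r => g.massQuotient b u r x) atTop (𝓝 (fourMass a b u x / 4)) := by
  obtain ⟨C, hC⟩ := (hf.density_expansion hg hu b).2.2.exists_of_comap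
  have h1 : Tendsto (fun r : ℝ => C / r) atTop (𝓝 0) := tendsto_const_nhds.div_atTop tendsto_id
  have h2 : Tendsto (fun r => 4 * g.massQuotient b u r x - fourMass a b u x) atTop (𝓝 0) := by
    refine squeeze_zero_norm' ?_ h1
    filter_upwards [hC, eventually_gt_atTop 0] with r hr h0
    have h3 := hr x
    rw [abs_mul, abs_of_pos h0] at h3
    rwa [Real.norm_eq_abs, le_div_iff₀ h0]
  have h3 := (h2.add_const (fourMass a b u x)).div_const 4
  simpa using h3

theorem IsAsymptoticallyFlat.massAspect_eq (hf : IsAsymptoticallyFlat g a u₀ u₁)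
    (hg : g.IsRegular u₀ u₁ r₀) (hu : u ∈ Set.Ioo u₀ u₁) (b : Pole) (x : E2) :
    g.massAspect b u x = fourMass a b u x / 4 :=
  (hf.tendsto_massQuotient hg hu b x).limUnder_eq

theorem integrable_mul_conf {f : E2 → ℝ} (hf : Continuous f) (h : ∃ C, ∀ x, |f x| ≤ C) :
    Integrable fun x => f x * conf x := by
  obtain ⟨C, hC⟩ := h
  refine (integrable_conf.const_mul C).mono'
    (hf.mul contDiff_conf.continuous).aestronglyMeasurable (ae_of_all _ fun x => ?_)
  rw [Real.norm_eq_abs, abs_mul, abs_of_pos (conf_pos x)]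
  exact mul_le_mul_of_nonneg_right (hC x) (conf_pos x).le

theorem IsAsymptoticallyFlat.integrable_fourMass (hf : IsAsymptoticallyFlat g a u₀ u₁)
    (hu : u ∈ Set.Ioo u₀ u₁) (b : Pole) : Integrable fun x => fourMass a b u x * conf x :=
  integrable_mul_conf (hf.smooth.continuous_fourMass hu b) (exists_bound_fourMass hf hu b)

theorem Coeffs.IsSmooth.integrable_n (ha : a.IsSmooth u₀ u₁) (hu : u ∈ Set.Ioo u₀ u₁) (b : Pole) :
    Integrable fun x => a.n b u x * conf x :=
  integrable_mul_conf (ha.continuous_n hu b) (ha.exists_bound_n hu b)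

/-- The limit of the integrated ingoing expansion: up to a divergence, `σ θ₋` is the density of
four times the mass aspect quotient minus `σ_{,r}`, and both converge uniformly over the sphere. -/
theorem IsAsymptoticallyFlat.tendsto_intThetaMinus (hf : IsAsymptoticallyFlat g a u₀ u₁)
    (hg : g.IsRegular u₀ u₁ r₀) (hu : u ∈ Set.Ioo u₀ u₁) :
    Tendsto (fun r => g.intThetaMinus u r + 8 * Real.pi * r) atTop
      (𝓝 (16 * Real.pi * g.energy u - 2 * Real.pi * a.nMean u)) := by
  have hπ := Real.pi_pos
  obtain ⟨-, e1, e2⟩ := hf.density_expansion hg hu Pole.north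
  obtain ⟨C, hC⟩ := e1.exists_of_comap
  obtain ⟨D, hD⟩ := e2.exists_of_comap
  have iF := hf.integrable_fourMass hu Pole.north
  have iN := hf.smooth.integrable_n hu Pole.north
  have hE : 16 * Real.pi * g.energy u - 2 * Real.pi * a.nMean u =
      ∫ x, (fourMass a Pole.north u x * conf x - 1 / 2 * (a.n Pole.north u x * conf x)) := by
    rw [integral_sub iF (iN.const_mul _), integral_const_mul, BSMetric.energy, Coeffs.nMean]
    simp only [hf.massAspect_eq hg hu, roundDensity_eq]
    have : ∫ x, fourMass a Pole.north u x / 4 * conf x =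
        1 / 4 * ∫ x, fourMass a Pole.north u x * conf x := by
      rw [← integral_const_mul]
      congr 1
      ext x
      ring
    rw [this]
    field_simp
    ring
  rw [hE]
  have h1 : Tendsto (fun r : ℝ => (C + D) / r * (4 * Real.pi)) atTop (𝓝 0) := by
    simpa using (tendsto_const_nhds.div_atTop tendsto_id :
      Tendsto (fun r : ℝ => (C + D) / r) atTop (𝓝 0)).mul_const (4 * Real.pi)
  rw [tendsto_iff_norm_sub_tendsto_zero]
  refine squeeze_zero' (Eventually.of_forall fun r => norm_nonneg _) ?_ h1
  filter_upwards [hC, hD, eventually_gt_atTop 0, eventually_gt_atTop r₀] with r h2 h3 h0 hr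
  have iE := hg.integrable_expDens hu hr Pole.north
  have hF : g.intThetaMinus u r + 8 * Real.pi * r =
      ∫ x, (g.expDens Pole.north u r x + 2 * r * conf x) := by
    rw [integral_add iE (integrable_conf.const_mul _), integral_const_mul, integral_conf,
      hg.intThetaMinus_eq hu hr]
    ring
  have i1 : Integrable fun x => g.expDens Pole.north u r x + 2 * r * conf x :=
    iE.add (integrable_conf.const_mul _)
  have i2 : Integrable fun x =>
      fourMass a Pole.north u x * conf x - 1 / 2 * (a.n Pole.north u x * conf x) :=
    iF.sub (iN.const_mul _)
  rw [hF, ← integral_sub i1 i2, ← integral_conf, ← integral_const_mul]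
  refine norm_integral_le_of_norm_le (integrable_conf.const_mul _) (ae_of_all _ fun x => ?_)
  have hc := conf_pos x
  have key : g.expDens Pole.north u r x + 2 * r * conf x - (fourMass a Pole.north u x * conf x -
      1 / 2 * (a.n Pole.north u x * conf x)) =
      ((4 * g.massQuotient Pole.north u r x - fourMass a Pole.north u x) * r -
        (deriv (fun r => g.density Pole.north u r x) r / conf x -
          (2 * r + a.n Pole.north u x / 2)) * r) / r * conf x := by
    rw [BSMetric.massQuotient, roundDensity_eq, BSMetric.expDens]
    field_simp
    ring
  rw [key, Real.norm_eq_abs, abs_mul, abs_of_pos hc, abs_div, abs_of_pos h0]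
  refine mul_le_mul_of_nonneg_right ?_ hc.le
  refine div_le_div_of_nonneg_right ?_ h0.le
  have h4 := (abs_sub _ _).trans (add_le_add (h3 x) (h2 x))
  linarith

/-- The lower bound of the energy: the sum of `∫ σ θ₋` and `8 π r` does not decrease with `r`, and so
lies below its limit. -/
theorem IsAsymptoticallyFlat.le_energy (hf : IsAsymptoticallyFlat g a u₀ u₁)
    (hg : g.IsRegular u₀ u₁ r₀) (hu : u ∈ Set.Ioo u₀ u₁) {T : Tensor4}
    (hT : ∀ r > r₀, ∀ p, DominantEnergy g T u r p)
    (hE : ∀ r > r₀, ∀ b x, EinsteinTrace g T b u r x) {r : ℝ} (hr : r₀ < r) :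
    1 / 2 * r + 1 / 8 * a.nMean u + 1 / (16 * Real.pi) * g.intThetaMinus u r ≤ g.energy u := by
  have hπ := Real.pi_pos
  have h : g.intThetaMinus u r + 8 * Real.pi * r ≤
      16 * Real.pi * g.energy u - 2 * Real.pi * a.nMean u := by
    refine ge_of_tendsto (hf.tendsto_intThetaMinus hg hu) ?_
    filter_upwards [eventually_ge_atTop r] with s hs
    exact hg.intThetaMinus_mono hu hT hE hr hs
  have h2 : 1 / (16 * Real.pi) * g.intThetaMinus u r = g.intThetaMinus u r / (16 * Real.pi) := by
    ring
  have h3 : g.intThetaMinus u r / (16 * Real.pi) ≤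
      g.energy u - 1 / 2 * r - 1 / 8 * a.nMean u := by
    rw [div_le_iff₀ (by positivity)]
    linarith
  linarith

/-- By the Raychaudhuri equation `√σ` is a concave function of `r`; hence it lies below its asymptote
`√σ_s (r + n / 4)`. -/
theorem IsAsymptoticallyFlat.density_le (hf : IsAsymptoticallyFlat g a u₀ u₁)
    (hg : g.IsRegular u₀ u₁ r₀) (hu : u ∈ Set.Ioo u₀ u₁) {T : Tensor4}
    (hT : ∀ r > r₀, ∀ p, DominantEnergy g T u r p)
    (hE : ∀ r > r₀, ∀ b x, EinsteinRR g T b u r x) {r : ℝ} (hr : r₀ < r) (b : Pole) (x : E2) :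
    0 < r + 1 / 4 * a.n b u x ∧ g.density b u r x ≤ conf x * (r + 1 / 4 * a.n b u x) ^ 2 := by
  have hc := conf_pos x
  have hcs := Real.sqrt_pos.2 hc
  obtain ⟨q, hq⟩ : ∃ q : ℝ → ℝ, q = fun r => (√(conf x))⁻¹ * √(g.density b u r x) := ⟨_, rfl⟩
  have hq0 : ∀ s > r₀, 0 < q s := by
    intro s hs
    have := Real.sqrt_pos.2 (hg.density_pos hu hs b x)
    rw [hq]
    positivity
  have hq2 : ∀ s > r₀, q s ^ 2 = g.density b u s x / conf x := by
    intro s hs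
    rw [hq]
    simp only
    rw [mul_pow, inv_pow, Real.sq_sqrt hc.le, Real.sq_sqrt (hg.density_pos hu hs b x).le]
    field_simp
  obtain ⟨n, hn⟩ : ∃ n, n = a.n b u x := ⟨_, rfl⟩
  have hconc : ConcaveOn ℝ (Set.Ioi r₀) fun s => q s - (s + 1 / 4 * n) := by
    have h1 : ConcaveOn ℝ (Set.Ioi r₀) q := by
      rw [hq]
      exact (hg.concaveOn_sqrt_density hu b x (fun s hs => hT s hs _)
        (fun s hs => hE s hs b x)).smul (inv_pos.2 hcs).le
    exact h1.sub ((convexOn_id (convex_Ioi r₀)).add_const _)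
  -- `(q - (s + n / 4)) (q + (s + n / 4))` is bounded by the expansion of `σ = σ_s q²`
  have hlim : Tendsto (fun s => q s - (s + 1 / 4 * n)) atTop (𝓝 0) := by
    obtain ⟨C, hC⟩ := (hf.density_expansion hg hu b).1.exists_of_comap
    have h1 : Tendsto (fun s : ℝ => (C + n ^ 2 / 16) / (s + 1 / 4 * n)) atTop (𝓝 0) :=
      tendsto_const_nhds.div_atTop (tendsto_atTop_add_const_right _ _ tendsto_id)
    refine squeeze_zero_norm' ?_ h1
    filter_upwards [hC, eventually_gt_atTop r₀, eventually_gt_atTop (-(1 / 4 * n))] with s h2 h3 h4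
    have h5 : 0 < s + 1 / 4 * n := by linarith
    have h6 := h2 x
    rw [← hq2 s h3, ← hn] at h6
    have h7 : (q s - (s + 1 / 4 * n)) * (q s + (s + 1 / 4 * n)) =
        q s ^ 2 - (s ^ 2 + n * s / 2) - n ^ 2 / 16 := by ring
    have h8 : |q s - (s + 1 / 4 * n)| * (q s + (s + 1 / 4 * n)) ≤ C + n ^ 2 / 16 := by
      rw [← abs_of_pos (add_pos (hq0 s h3) h5), ← abs_mul, h7]
      refine (abs_sub _ _).trans (add_le_add h6 ?_)
      rw [abs_of_nonneg (by positivity)]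
    rw [Real.norm_eq_abs, le_div_iff₀ h5]
    refine le_trans (mul_le_mul_of_nonneg_left ?_ (abs_nonneg _)) h8
    linarith [hq0 s h3]
  have h1 := ConcaveOn.nonpos_of_tendsto_zero hconc hlim hr
  have h2 := hq0 r hr
  rw [← hn]
  refine ⟨by linarith, ?_⟩
  have h3 : q r ^ 2 ≤ (r + 1 / 4 * n) ^ 2 := pow_le_pow_left₀ h2.le (by linarith) 2
  rw [hq2 r hr, div_le_iff₀ hc] at h3
  linarith

/-- On a cut with constant `c = r + n / 4` the area is at most that of a round sphere of radius `c`. -/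
theorem IsAsymptoticallyFlat.sqrt_area_le (hf : IsAsymptoticallyFlat g a u₀ u₁)
    (hg : g.IsRegular u₀ u₁ r₀) (hu : u ∈ Set.Ioo u₀ u₁) {T : Tensor4}
    (hT : ∀ r > r₀, ∀ p, DominantEnergy g T u r p)
    (hE : ∀ r > r₀, ∀ b x, EinsteinRR g T b u r x) {r c : ℝ} (hr : r₀ < r)
    (hc : ∀ b x, r + 1 / 4 * a.n b u x = c) :
    √(g.area u r / (16 * Real.pi)) ≤ 1 / 2 * r + 1 / 8 * a.nMean u := by
  have hπ := Real.pi_pos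
  have hc0 : 0 < c := by
    have := (hf.density_le hg hu hT hE hr Pole.north 0).1
    rwa [hc] at this
  have hA : g.area u r ≤ 4 * Real.pi * c ^ 2 := by
    rw [← integral_conf, ← integral_mul_const]
    refine integral_mono (hg.integrable_density hu hr Pole.north) (integrable_conf.mul_const _)
      fun x => ?_
    have := (hf.density_le hg hu hT hE hr Pole.north x).2
    rwa [hc] at this
  have hn : a.nMean u = 4 * (c - r) := by
    have h1 : ∀ x, a.n Pole.north u x * roundDensity Pole.north x = 4 * (c - r) * conf x := by
      intro x
      rw [roundDensity_eq, ← hc Pole.north x]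
      ring
    rw [Coeffs.nMean]
    simp only [h1]
    rw [integral_const_mul, integral_conf]
    field_simp
  rw [hn, show 1 / 2 * r + 1 / 8 * (4 * (c - r)) = c / 2 by ring]
  refine (Real.sqrt_le_left (by positivity)).2 ?_
  rw [div_le_iff₀ (by positivity)]
  linarith

end

end BondiSachs

end

theorem mainTheorem3 (u₀ u₁ r₀ : ℝ) (g : BondiSachs.BSMetric) (a : BondiSachs.Coeffs)
    (T : BondiSachs.Tensor4)
    (hreg : g.IsRegular u₀ u₁ r₀) (hflat : BondiSachs.IsAsymptoticallyFlat g a u₀ u₁)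
    (u : ℝ) (hu : u ∈ Set.Ioo u₀ u₁)
    (hdec : ∀ r > r₀, ∀ p, BondiSachs.DominantEnergy g T u r p)
    (hrr : ∀ r > r₀, ∀ b x, BondiSachs.EinsteinRR g T b u r x)
    (htr : ∀ r > r₀, ∀ b x, BondiSachs.EinsteinTrace g T b u r x) :
    -- the energy, the mean value, the areas and the integrals of `θ₋` are well defined
    ((∀ b x, Filter.Tendsto (fun r => g.massQuotient b u r x) Filter.atTop
        (nhds (g.massAspect b u x))) ∧
      MeasureTheory.Integrable (fun x => g.massAspect BondiSachs.Pole.north u x *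
        BondiSachs.roundDensity BondiSachs.Pole.north x) ∧
      MeasureTheory.Integrable (fun x => a.n BondiSachs.Pole.north u x *
        BondiSachs.roundDensity BondiSachs.Pole.north x) ∧
      ∀ r > r₀,
        MeasureTheory.Integrable (fun x => g.density BondiSachs.Pole.north u r x) ∧
        MeasureTheory.Integrable (fun x => g.density BondiSachs.Pole.north u r x *
          g.thetaMinus BondiSachs.Pole.north u r x)) ∧
    -- the lower bound of the energy
    (∀ r > r₀, g.energy u ≥
      1 / 2 * r + 1 / 8 * a.nMean u + 1 / (16 * Real.pi) * g.intThetaMinus u r) ∧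
    -- positivity of `r + n / 4`
    (∀ r > r₀, ∀ b x, r + 1 / 4 * a.n b u x > 0) ∧
    -- the refinement for cuts on which `r + n / 4` is constant
    (∀ r > r₀, (∃ c : ℝ, ∀ b x, r + 1 / 4 * a.n b u x = c) →
      g.energy u ≥ √(g.area u r / (16 * Real.pi)) +
        1 / (16 * Real.pi) * g.intThetaMinus u r) := by
  refine ⟨⟨fun b x => ?_, ?_, ?_, fun r hr => ⟨hreg.integrable_density hu hr _,
    hreg.integrable_density_mul_thetaMinus hu hr _⟩⟩, fun r hr => hflat.le_energy hreg hu hdec htr hr,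
    fun r hr b x => (hflat.density_le hreg hu hdec hrr hr b x).1, ?_⟩
  · rw [hflat.massAspect_eq hreg hu]
    exact hflat.tendsto_massQuotient hreg hu b x
  · simp only [hflat.massAspect_eq hreg hu, BondiSachs.roundDensity_eq]
    refine ((hflat.integrable_fourMass hu BondiSachs.Pole.north).const_mul (1 / 4)).congr
      (MeasureTheory.ae_of_all _ fun x => ?_)
    ring
  · simp only [BondiSachs.roundDensity_eq]
    exact hflat.smooth.integrable_n hu BondiSachs.Pole.north
  · rintro r hr ⟨c, hc⟩
    have h1 := hflat.sqrt_area_le hreg hu hdec hrr hr hc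
    have h2 := hflat.le_energy hreg hu hdec htr hr
    linarith
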